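/- **Setting.** Let $\mathbb R^{k,m}=[0,\infty)^k\times\mathbb R^{m-k}$. For a function $f$ on an open $U\subseteq\mathbb R^{k,m}$ put ${}^b\partial_if=x_i\,\partial f/\partial x_i$ for $i\le k$ (set to $0$ where $x_i=0$) and ${}^b\partial_if=\partial f/\partial x_i$ for $i>k$. The function $f$ is *a-differentiable* if $f$ and all ${}^b\partial_if$ exist and are continuous and, for every compact $S\subseteq U$ and $i\le k$, there are $C,\alpha>0$ with $|{}^b\partial_if|\le Cx_i^\alpha$ on $S$; it is *a-smooth* if its iterated b-derivatives of all orders are a-differentiable. A continuous map $(f_1,\dots,f_n)$ from $U$ to an open subset of $\mathbb R^{l,n}$ is *a-smooth* if $f_j$ is a-smooth for $j>l$ and, for $j\le l$, near each $u\in U$ either $f_j=F_j\,x_1^{a_{1,j}}\cdots x_k^{a_{k,j}}$ with $F_j>0$ a-smooth, $a_{i,j}\ge0$, and $a_{i,j}=0$ if $u_i\ne0$, or $f_j=0$. An $m$-dimensional *manifold with a-corners* $X$ is a second countable Hausdorff space with a maximal atlas of charts onto open subsets of the $\mathbb R^{k,m}$ ($0\le k\le m$) whose coordinate changes are a-smooth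 with a-smooth inverse. The interior $X^\circ$, where no boundary coordinate vanishes, is an ordinary smooth manifold, and it is dense in $X$. The b-tangent bundle ${}^bTX$ has local frame $x_1\partial_{x_1},\dots,x_k\partial_{x_k},\partial_{x_{k+1}},\dots,\partial_{x_m}$ in a chart; it has a b-Lie bracket ${}^b[\,,]$, and ${}^bTX|_{X^\circ}=TX^\circ$. The b-differential ${}^b\mathrm dc$ of an a-smooth function $c$ is the section of the dual bundle ${}^bT^*X$ with components ${}^b\partial_ic$ in the dual frame. A point of $\partial X$ is a point of $X$ together with a local boundary component there, and the line bundle ${}^bN_{\partial X}$ over $\partial X$ is spanned by $x_i\partial_{x_i}$ along $\{x_i=0\}$; it has the flat connection for which these sections are constant. A *weight* $\lambda$ is a constant section of the dual line bundle ${}^bN^*_{\partial X}$: along $\{x_i=0\}$ it is $\lambda_i\,x_i^{-1}\mathrm dx_i$ with $\lambda_i\in\mathbb R$ locally constant. The line bundle $L_\lambda$ over $X$ has a canonical identification $L_\lambda|_{X^\circ}\cong X^\circ\times\mathbb R$ and, over each chart on which the $\lambda_i$ are constant ($\lambda_i=0$ if $\{x_i=0\}$ does not meet the chart), a nonvanishing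 section corresponding on $X^\circ$ to $x_1^{\lambda_1}\cdots x_k^{\lambda_k}$; it carries the flat b-connection ${}^b\nabla_\lambda$ which over $X^\circ$ is the trivial connection. A *b-connection* on a vector bundle $E\to X$ is an $\mathbb R$-linear map ${}^b\nabla:\Gamma^\infty(E)\to\Gamma^\infty(E\otimes{}^bT^*X)$ on a-smooth sections with ${}^b\nabla(c\,e)=c\,{}^b\nabla e+e\otimes{}^b\mathrm dc$ for all a-smooth $c:X\to\mathbb R$. A *weighted b-metric of weight $\lambda$* is $g\in\Gamma^\infty(S^2({}^bT^*X)\otimes L_{-2\lambda})$ which is positive definite on ${}^bT_xX\otimes L_\lambda|_x$ for every $x\in X$; it restricts to a Riemannian metric $g|_{X^\circ}$ under the natural isomorphism $({}^bTX\otimes L_\lambda)|_{X^\circ}\cong TX^\circ$. **Proposition 5.1 (Levi-Civita b-connection).** Let $g$ be a weighted b-metric of weight $\lambda$ on a manifold with a-corners $X$. Then there is a unique b-connection ${}^b\nabla$ on ${}^bTX\otimes L_\lambda$ such that ${}^b\nabla|_{X^\circ}$ is identified with the Levi-Civita connection of $g|_{X^\circ}$ under the natural isomorphism $({}^bTX\otimes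 L_\lambda)|_{X^\circ}\cong TX^\circ$. Moreover ${}^b\nabla$ is torsion-free, that is, for all $u,v\in\Gamma^\infty({}^bTX)$ and $e\in\Gamma^\infty(L_\lambda)$, $$\bigl({}^b\nabla_u(v\otimes e)-v\otimes{}^b\nabla_{\lambda,u}e\bigr)-\bigl({}^b\nabla_v(u\otimes e)-u\otimes{}^b\nabla_{\lambda,v}e\bigr)={}^b[u,v]\otimes e,$$ and ${}^b\nabla g=0$, that is, $w\bigl(g(s,t)\bigr)=g({}^b\nabla_ws,t)+g(s,{}^b\nabla_wt)$ for all a-smooth sections $s,t$ of ${}^bTX\otimes L_\lambda$ and all b-tangent vectors $w$. -/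

import Mathlib

open Set Filter Topology
open scoped Manifold ContDiff Bundle TensorProduct

namespace ACorners

/-- The local model `⟦0,∞)ᵏ × ℝᵐ⁻ᵏ`: the first `k` coordinates are nonnegative. -/
def quad (k m : ℕ) : Set (Fin m → ℝ) := {x | ∀ i : Fin m, i.val < k → 0 ≤ x i}

/-- The `i`-th b-derivative of a function `f` of `m` variables, the first `k` of which are
boundary variables: `xᵢ ∂f/∂xᵢ` for `i < k` (so `0` where `xᵢ = 0`), and `∂f/∂xᵢ` for `i ≥ k`. -/
noncomputable def bpartial {m : ℕ} (k : ℕ) (i : Fin m) (f : (Fin m → ℝ) → ℝ)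
    (x : Fin m → ℝ) : ℝ :=
  if i.val < k then
    if x i = 0 then 0 else x i * deriv (fun t => f (Function.update x i t)) (x i)
  else deriv (fun t => f (Function.update x i t)) (x i)

/-- `f` is a-differentiable on the (relatively open) set `U ⊆ quad k m`: it is continuous, the
partial derivatives entering its b-derivatives exist, the b-derivatives are continuous on `U`, and
on compact subsets the boundary b-derivatives are `O(xᵢ^α)` for some `α > 0`. -/
structure ADiffOn {m : ℕ} (k : ℕ) (U : Set (Fin m → ℝ)) (f : (Fin m → ℝ) → ℝ) : Prop where
  continuousOn : ContinuousOn f U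
  differentiableAt : ∀ i : Fin m, ∀ x ∈ U, (i.val < k → x i ≠ 0) →
    DifferentiableAt ℝ (fun t => f (Function.update x i t)) (x i)
  continuousOn_bpartial : ∀ i : Fin m, ContinuousOn (bpartial k i f) U
  decay : ∀ i : Fin m, i.val < k → ∀ S ⊆ U, IsCompact S →
    ∃ C > (0 : ℝ), ∃ α > (0 : ℝ), ∀ x ∈ S, |bpartial k i f x| ≤ C * x i ^ α

/-- The iterated b-derivatives of `f` of order at most `n` are all a-differentiable on `U`. -/
def ASmoothUpTo {m : ℕ} (k : ℕ) (U : Set (Fin m → ℝ)) : ℕ → ((Fin m → ℝ) → ℝ) → Prop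
  | 0, f => ADiffOn k U f
  | n + 1, f => ADiffOn k U f ∧ ∀ i : Fin m, ASmoothUpTo k U n (bpartial k i f)

/-- `f` is a-smooth on `U`: the iterated b-derivatives of all orders are a-differentiable. -/
def ASmoothOn {m : ℕ} (k : ℕ) (U : Set (Fin m → ℝ)) (f : (Fin m → ℝ) → ℝ) : Prop :=
  ∀ n : ℕ, ASmoothUpTo k U n f

/-- `U` is a relatively open subset of the local model. -/
def IsQuadOpen {m : ℕ} (k : ℕ) (U : Set (Fin m → ℝ)) : Prop :=
  ∃ O : Set (Fin m → ℝ), IsOpen O ∧ U = O ∩ quad k m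

section Analysis

variable {m k : ℕ} {U : Set (Fin m → ℝ)} {f g : (Fin m → ℝ) → ℝ}

lemma IsQuadOpen.eventually_mem (hU : IsQuadOpen k U) {i : Fin m} {x : Fin m → ℝ} (hx : x ∈ U)
    (hi : i.val < k → x i ≠ 0) : ∀ᶠ t in 𝓝 (x i), Function.update x i t ∈ U := by
  obtain ⟨O, hO, rfl⟩ := hU
  have hc : ContinuousAt (fun t : ℝ => Function.update x i t) (x i) :=
    (continuous_const.update i continuous_id).continuousAt
  have h1 : ∀ᶠ t in 𝓝 (x i), Function.update x i t ∈ O :=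
    hc.eventually_mem (hO.mem_nhds (by simpa using hx.1))
  have h2 : ∀ᶠ t in 𝓝 (x i), i.val < k → 0 ≤ t := by
    by_cases h : i.val < k
    · have : 0 < x i := lt_of_le_of_ne (hx.2 i h) (Ne.symm (hi h))
      filter_upwards [lt_mem_nhds this] with t ht _ using ht.le
    · exact Eventually.of_forall fun t h' => absurd h' h
  filter_upwards [h1, h2] with t h1 h2
  refine ⟨h1, fun j hj => ?_⟩
  by_cases hji : j = i
  · subst hji; simpa using h2 hj
  · simpa [Function.update_of_ne hji] using hx.2 j hj

lemma IsQuadOpen.eventuallyEq (hU : IsQuadOpen k U) (h : EqOn f g U) {i : Fin m} {x : Fin m → ℝ}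
    (hx : x ∈ U) (hi : i.val < k → x i ≠ 0) :
    (fun t => f (Function.update x i t)) =ᶠ[𝓝 (x i)] fun t => g (Function.update x i t) := by
  filter_upwards [hU.eventually_mem hx hi] with t ht using h ht

lemma bpartial_congr (hU : IsQuadOpen k U) (h : EqOn f g U) (i : Fin m) :
    EqOn (bpartial k i f) (bpartial k i g) U := by
  intro x hx
  unfold bpartial
  split_ifs with h1 h2
  · rfl
  · rw [(hU.eventuallyEq h hx fun _ => h2).deriv_eq]
  · rw [(hU.eventuallyEq h hx fun h' => absurd h' h1).deriv_eq]

lemma ADiffOn.congr (hU : IsQuadOpen k U) (hf : ADiffOn k U f) (h : EqOn g f U) :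
    ADiffOn k U g where
  continuousOn := hf.continuousOn.congr h
  differentiableAt i x hx hi :=
    (hf.differentiableAt i x hx hi).congr_of_eventuallyEq (hU.eventuallyEq h hx hi)
  continuousOn_bpartial i := (hf.continuousOn_bpartial i).congr (bpartial_congr hU h i)
  decay i hi S hS hSc := by
    obtain ⟨C, hC, α, hα, hb⟩ := hf.decay i hi S hS hSc
    exact ⟨C, hC, α, hα, fun x hx => by rw [bpartial_congr hU h i (hS hx)]; exact hb x hx⟩

lemma ASmoothUpTo.congr (hU : IsQuadOpen k U) {n : ℕ} (hf : ASmoothUpTo k U n f)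
    (h : EqOn g f U) : ASmoothUpTo k U n g := by
  induction n generalizing f g with
  | zero => exact ADiffOn.congr hU hf h
  | succ n ih => exact ⟨hf.1.congr hU h, fun i => ih (hf.2 i) (bpartial_congr hU h i)⟩

lemma ASmoothUpTo.aDiffOn {n : ℕ} (hf : ASmoothUpTo k U n f) : ADiffOn k U f := by
  cases n with
  | zero => exact hf
  | succ n => exact hf.1

lemma ASmoothUpTo.of_succ {n : ℕ} (hf : ASmoothUpTo k U (n + 1) f) : ASmoothUpTo k U n f := by
  induction n generalizing f with
  | zero => exact hf.1
  | succ n ih => exact ⟨hf.1, fun i => ih (hf.2 i)⟩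

lemma ASmoothOn.congr (hU : IsQuadOpen k U) (hf : ASmoothOn k U f) (h : EqOn g f U) :
    ASmoothOn k U g := fun n => (hf n).congr hU h

lemma bpartial_add (hf : ADiffOn k U f) (hg : ADiffOn k U g) (i : Fin m) :
    EqOn (bpartial k i (fun x => f x + g x)) (fun x => bpartial k i f x + bpartial k i g x) U := by
  intro x hx
  simp only [bpartial]
  split_ifs with h1 h2
  · simp
  · rw [deriv_fun_add (hf.differentiableAt i x hx fun _ => h2)
      (hg.differentiableAt i x hx fun _ => h2)]; ring
  · rw [deriv_fun_add (hf.differentiableAt i x hx fun h => absurd h h1)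
      (hg.differentiableAt i x hx fun h => absurd h h1)]

lemma bpartial_mul (hf : ADiffOn k U f) (hg : ADiffOn k U g) (i : Fin m) :
    EqOn (bpartial k i (fun x => f x * g x))
      (fun x => bpartial k i f x * g x + f x * bpartial k i g x) U := by
  intro x hx
  simp only [bpartial]
  split_ifs with h1 h2
  · simp
  · rw [deriv_fun_mul (hf.differentiableAt i x hx fun _ => h2)
      (hg.differentiableAt i x hx fun _ => h2)]; simp; ring
  · rw [deriv_fun_mul (hf.differentiableAt i x hx fun h => absurd h h1)
      (hg.differentiableAt i x hx fun h => absurd h h1)]; simp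

lemma decay_aux {S : Set (Fin m → ℝ)} (hSc : IsCompact S) (hSq : S ⊆ quad k m) {i : Fin m}
    (hi : i.val < k) {u v : (Fin m → ℝ) → ℝ} {C D α β : ℝ} (hC : 0 < C) (hD : 0 < D) (hα : 0 < α)
    (hβ : 0 < β) (hu : ∀ x ∈ S, |u x| ≤ C * x i ^ α) (hv : ∀ x ∈ S, |v x| ≤ D * x i ^ β) :
    ∃ C > (0 : ℝ), ∃ α > (0 : ℝ), ∀ x ∈ S, |u x + v x| ≤ C * x i ^ α := by
  obtain ⟨R, hR⟩ := (hSc.image (continuous_apply i)).isBounded.exists_norm_le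
  set M : ℝ := max R 1
  have hM : 1 ≤ M := le_max_right _ _
  have key : ∀ x ∈ S, ∀ γ, min α β ≤ γ → x i ^ γ ≤ M ^ γ * x i ^ min α β := by
    intro x hx γ hγ
    have h0 : 0 ≤ x i := hSq hx i hi
    have hxM : x i ≤ M := (le_abs_self _).trans ((hR _ ⟨x, hx, rfl⟩).trans (le_max_left _ _))
    have hmin : 0 < min α β := lt_min hα hβ
    calc x i ^ γ = x i ^ (γ - min α β + min α β) := by ring_nf
      _ = x i ^ (γ - min α β) * x i ^ min α β :=
          Real.rpow_add_of_nonneg h0 (by linarith) hmin.le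
      _ ≤ M ^ (γ - min α β) * x i ^ min α β := by
          gcongr
      _ ≤ M ^ γ * x i ^ min α β := by
          gcongr
          · linarith
  refine ⟨C * M ^ α + D * M ^ β, by positivity, min α β, lt_min hα hβ, fun x hx => ?_⟩
  calc |u x + v x| ≤ |u x| + |v x| := abs_add_le _ _
    _ ≤ C * x i ^ α + D * x i ^ β := add_le_add (hu x hx) (hv x hx)
    _ ≤ C * (M ^ α * x i ^ min α β) + D * (M ^ β * x i ^ min α β) := by
        gcongr
        · exact key x hx α (min_le_left _ _)
        · exact key x hx β (min_le_right _ _)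
    _ = _ := by ring

lemma IsQuadOpen.subset_quad (hU : IsQuadOpen k U) : U ⊆ quad k m := by
  obtain ⟨O, _, rfl⟩ := hU; exact inter_subset_right

lemma ADiffOn.add (hU : IsQuadOpen k U) (hf : ADiffOn k U f) (hg : ADiffOn k U g) :
    ADiffOn k U (fun x => f x + g x) where
  continuousOn := hf.continuousOn.add hg.continuousOn
  differentiableAt i x hx hi := (hf.differentiableAt i x hx hi).fun_add
    (hg.differentiableAt i x hx hi)
  continuousOn_bpartial i := ((hf.continuousOn_bpartial i).add (hg.continuousOn_bpartial i)).congr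
    (bpartial_add hf hg i)
  decay i hi S hS hSc := by
    obtain ⟨C, hC, α, hα, hb⟩ := hf.decay i hi S hS hSc
    obtain ⟨D, hD, β, hβ, hb'⟩ := hg.decay i hi S hS hSc
    obtain ⟨E, hE, γ, hγ, h⟩ :=
      decay_aux hSc (hS.trans hU.subset_quad) hi hC hD hα hβ hb hb'
    exact ⟨E, hE, γ, hγ, fun x hx => by rw [bpartial_add hf hg i (hS hx)]; exact h x hx⟩

lemma ADiffOn.mul (hU : IsQuadOpen k U) (hf : ADiffOn k U f) (hg : ADiffOn k U g) :
    ADiffOn k U (fun x => f x * g x) where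
  continuousOn := hf.continuousOn.mul hg.continuousOn
  differentiableAt i x hx hi := (hf.differentiableAt i x hx hi).fun_mul
    (hg.differentiableAt i x hx hi)
  continuousOn_bpartial i := (((hf.continuousOn_bpartial i).mul hg.continuousOn).add
    (hf.continuousOn.mul (hg.continuousOn_bpartial i))).congr (bpartial_mul hf hg i)
  decay i hi S hS hSc := by
    obtain ⟨C, hC, α, hα, hb⟩ := hf.decay i hi S hS hSc
    obtain ⟨D, hD, β, hβ, hb'⟩ := hg.decay i hi S hS hSc
    obtain ⟨M, hM⟩ := hSc.exists_bound_of_continuousOn (hf.continuousOn.mono hS)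
    obtain ⟨N, hN⟩ := hSc.exists_bound_of_continuousOn (hg.continuousOn.mono hS)
    have hpos : ∀ x ∈ S, 0 ≤ x i := fun x hx => hU.subset_quad (hS hx) i hi
    obtain ⟨E, hE, γ, hγ, h⟩ := decay_aux (u := fun x => bpartial k i f x * g x)
      (v := fun x => f x * bpartial k i g x) hSc (hS.trans hU.subset_quad) hi
      (C := C * max N 1) (D := D * max M 1) (by positivity) (by positivity) hα hβ
      (fun x hx => by
        have h1 := hb x hx
        have h2 : |g x| ≤ max N 1 := (hN x hx).trans (le_max_left _ _)
        have h3 := Real.rpow_nonneg (hpos x hx) α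
        rw [abs_mul]
        calc _ ≤ (C * x i ^ α) * max N 1 := by gcongr
          _ = _ := by ring)
      (fun x hx => by
        have h1 := hb' x hx
        have h2 : |f x| ≤ max M 1 := (hM x hx).trans (le_max_left _ _)
        have h3 := Real.rpow_nonneg (hpos x hx) β
        rw [abs_mul]
        calc _ ≤ max M 1 * (D * x i ^ β) := by gcongr
          _ = _ := by ring)
    exact ⟨E, hE, γ, hγ, fun x hx => by rw [bpartial_mul hf hg i (hS hx)]; exact h x hx⟩

lemma ASmoothUpTo.add (hU : IsQuadOpen k U) {n : ℕ} (hf : ASmoothUpTo k U n f)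
    (hg : ASmoothUpTo k U n g) : ASmoothUpTo k U n (fun x => f x + g x) := by
  induction n generalizing f g with
  | zero => exact ADiffOn.add hU hf hg
  | succ n ih => exact ⟨hf.1.add hU hg.1, fun i =>
      (ih (hf.2 i) (hg.2 i)).congr hU (bpartial_add hf.1 hg.1 i)⟩

lemma ASmoothUpTo.mul (hU : IsQuadOpen k U) {n : ℕ} (hf : ASmoothUpTo k U n f)
    (hg : ASmoothUpTo k U n g) : ASmoothUpTo k U n (fun x => f x * g x) := by
  induction n generalizing f g with
  | zero => exact ADiffOn.mul hU hf hg
  | succ n ih => exact ⟨hf.1.mul hU hg.1, fun i =>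
      ((ih (hf.2 i) hg.of_succ).add hU (ih hf.of_succ (hg.2 i))).congr hU
        (bpartial_mul hf.1 hg.1 i)⟩

lemma bpartial_const (c : ℝ) (i : Fin m) :
    bpartial k i (fun _ : Fin m → ℝ => c) = fun _ => 0 := by
  ext x; simp [bpartial]

lemma aDiffOn_const (hU : IsQuadOpen k U) (c : ℝ) : ADiffOn k U (fun _ : Fin m → ℝ => c) where
  continuousOn := continuousOn_const
  differentiableAt _ _ _ _ := differentiableAt_const _
  continuousOn_bpartial i := by rw [bpartial_const]; exact continuousOn_const
  decay i hi S hS _ := ⟨1, one_pos, 1, one_pos, fun x hx => by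
    rw [bpartial_const]; simpa using hU.subset_quad (hS hx) i hi⟩

lemma aSmoothOn_const (hU : IsQuadOpen k U) (c : ℝ) :
    ASmoothOn k U (fun _ : Fin m → ℝ => c) := by
  intro n
  induction n generalizing c with
  | zero => exact aDiffOn_const hU c
  | succ n ih => exact ⟨aDiffOn_const hU c, fun i => by rw [bpartial_const]; exact ih 0⟩

lemma ASmoothOn.add (hU : IsQuadOpen k U) (hf : ASmoothOn k U f) (hg : ASmoothOn k U g) :
    ASmoothOn k U (fun x => f x + g x) := fun n => (hf n).add hU (hg n)

lemma ASmoothOn.mul (hU : IsQuadOpen k U) (hf : ASmoothOn k U f) (hg : ASmoothOn k U g) :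
    ASmoothOn k U (fun x => f x * g x) := fun n => (hf n).mul hU (hg n)

lemma ASmoothOn.bpartial (hf : ASmoothOn k U f) (i : Fin m) :
    ASmoothOn k U (bpartial k i f) := fun n => (hf (n + 1)).2 i

/-- A function with continuous partial derivatives on an open set is differentiable there. -/
lemma hasFDerivAt_of_partials {V : Set (Fin m → ℝ)} (hV : IsOpen V)
    {f : (Fin m → ℝ) → ℝ} {f' : Fin m → (Fin m → ℝ) → ℝ}
    (hd : ∀ i, ∀ x ∈ V, HasDerivAt (fun t => f (Function.update x i t)) (f' i x) (x i))
    (hc : ∀ i, ContinuousOn (f' i) V) {x : Fin m → ℝ} (hx : x ∈ V) :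
    HasFDerivAt f (∑ i, f' i x • ContinuousLinearMap.proj (R := ℝ) (φ := fun _ : Fin m => ℝ) i)
      x := by
  -- `z n y` has the first `n` coordinates of `y` and the remaining ones of `x`
  let z : ℕ → (Fin m → ℝ) → (Fin m → ℝ) := fun n y j => if j.val < n then y j else x j
  have hzx : ∀ n, z n x = x := fun n => by ext j; simp [z]
  have hzc : ∀ n, Continuous (z n) := fun n => continuous_pi fun j => by
    by_cases h : j.val < n
    · simpa [z, h] using continuous_apply j
    · simpa [z, h] using continuous_const
  have hz0 : ∀ y, z 0 y = x := fun y => by ext j; simp [z]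
  have hzm : ∀ y, z m y = y := fun y => by ext j; simp [z]
  have hup : ∀ (i : Fin m) y, Function.update (z i y) i (y i) = z (i.val + 1) y := fun i y => by
    ext j
    by_cases h : j = i
    · subst h; simp [z]
    · have : j.val ≠ i.val := fun h' => h (Fin.ext h')
      rw [Function.update_of_ne h]
      simp only [z]
      congr 1
      simp only [eq_iff_iff]; omega
  have hlo : ∀ (i : Fin m) y, Function.update (z i y) i (x i) = z i.val y := fun i y => by
    ext j
    by_cases h : j = i
    · subst h; simp [z]
    · rw [Function.update_of_ne h]
  have key : ∀ i : Fin m, (fun y => f (z (i.val + 1) y) - f (z i.val y) - f' i x * (y i - x i))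
      =o[𝓝 x] fun y => y - x := by
    intro i
    rw [Asymptotics.isLittleO_iff]
    intro ε hε
    have hev : ∀ᶠ w in 𝓝 x, w ∈ V ∧ dist (f' i w) (f' i x) < ε :=
      Filter.Eventually.and (hV.mem_nhds hx) (((hc i).continuousAt (hV.mem_nhds hx)).eventually
        (Metric.ball_mem_nhds _ hε))
    obtain ⟨δ, hδ, hball⟩ := Metric.eventually_nhds_iff.1 hev
    filter_upwards [Metric.ball_mem_nhds x hδ] with y hy
    have hseg : ∀ t ∈ segment ℝ (x i) (y i), Function.update (z i y) i t ∈ V ∧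
        dist (f' i (Function.update (z i y) i t)) (f' i x) < ε := by
      intro t ht
      apply hball
      rw [dist_pi_lt_iff hδ]
      have hy' : ∀ j, dist (y j) (x j) < δ := fun j => (dist_le_pi_dist y x j).trans_lt hy
      intro j
      by_cases h : j = i
      · subst h
        rw [Function.update_self]
        refine lt_of_le_of_lt ?_ (hy' j)
        rw [dist_comm, dist_comm (y j)]
        obtain ⟨a, b, ha, hb, hab, rfl⟩ := ht
        have : x j - (a • x j + b • y j) = b * (x j - y j) := by
          simp only [smul_eq_mul]; linear_combination (-x j) * hab
        rw [Real.dist_eq, Real.dist_eq, this, abs_mul, abs_of_nonneg hb]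
        exact mul_le_of_le_one_left (abs_nonneg _) (by linarith)
      · rw [Function.update_of_ne h]
        by_cases h' : j.val < i.val
        · simpa [z, h'] using hy' j
        · simpa [z, h'] using hδ
    have hmv := Convex.norm_image_sub_le_of_norm_hasDerivWithin_le (𝕜 := ℝ)
      (f := fun t => f (Function.update (z i y) i t) - f' i x * t)
      (f' := fun t => f' i (Function.update (z i y) i t) - f' i x) (C := ε)
      (s := segment ℝ (x i) (y i))
      (fun t ht => by
        have h := hd i _ (hseg t ht).1
        simp only [Function.update_self, Function.update_idem] at h
        simpa using (h.fun_sub ((hasDerivAt_id t).const_mul (f' i x))).hasDerivWithinAt)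
      (fun t ht => (hseg t ht).2.le) (convex_segment _ _) (left_mem_segment ℝ _ _)
      (right_mem_segment ℝ _ _)
    rw [hup, hlo] at hmv
    have e : f (z (i.val + 1) y) - f' i x * y i - (f (z i.val y) - f' i x * x i) =
        f (z (i.val + 1) y) - f (z i.val y) - f' i x * (y i - x i) := by ring
    rw [e] at hmv
    refine hmv.trans ?_
    gcongr
    simpa using norm_le_pi_norm (y - x) i
  rw [hasFDerivAt_iff_isLittleO]
  refine (Asymptotics.IsLittleO.fun_sum (s := Finset.univ) fun i _ => key i).congr_left fun y => ?_
  rw [Finset.sum_sub_distrib, Fin.sum_univ_eq_sum_range (fun n => f (z (n + 1) y) - f (z n y)),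
    Finset.sum_range_sub (fun n => f (z n y)), hz0, hzm]
  simp

/-- Away from the boundary hyperplanes, a-smooth functions are smooth in the ordinary sense. -/
lemma ASmoothOn.contDiffOn (hf : ASmoothOn k U f) {V : Set (Fin m → ℝ)} (hV : IsOpen V)
    (hVU : V ⊆ U) (hpos : ∀ x ∈ V, ∀ i : Fin m, i.val < k → x i ≠ 0) :
    ContDiffOn ℝ ∞ f V := by
  rw [contDiffOn_infty]
  intro n
  induction n generalizing f with
  | zero =>
    simpa using (hf 0).aDiffOn.continuousOn.mono hVU
  | succ n ih =>
    let c : Fin m → (Fin m → ℝ) → ℝ := fun i x => if i.val < k then (x i)⁻¹ else 1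
    have hcs : ∀ i (N : ℕ), ContDiffOn ℝ N (c i) V := fun i N => by
      by_cases h : i.val < k
      · simp only [c, h, if_true]
        exact (contDiff_apply ℝ ℝ i).contDiffOn.inv fun x hx => hpos x hx i h
      · simp only [c, h, if_false]
        exact contDiffOn_const
    have hD := (hf 0).aDiffOn
    have hfd : ∀ x ∈ V, HasFDerivAt f (∑ i, (c i x * ACorners.bpartial k i f x) •
        ContinuousLinearMap.proj (R := ℝ) (φ := fun _ : Fin m => ℝ) i) x := fun x hx => by
      refine hasFDerivAt_of_partials hV (f' := fun i x => c i x * ACorners.bpartial k i f x)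
        (fun i y hy => ?_) (fun i => ?_) hx
      · have h := (hD.differentiableAt i y (hVU hy) (hpos y hy i)).hasDerivAt
        have e : c i y * ACorners.bpartial k i f y =
            deriv (fun t => f (Function.update y i t)) (y i) := by
          by_cases h' : i.val < k
          · have := hpos y hy i h'
            simp only [c, ACorners.bpartial, h', this, if_true, if_false]
            field_simp
          · simp [c, ACorners.bpartial, h']
        rw [e]; exact h
      · exact ((hcs i 0).continuousOn).mul ((hD.continuousOn_bpartial i).mono hVU)
    push_cast
    rw [contDiffOn_succ_iff_fderiv_of_isOpen hV]
    refine ⟨fun x hx => (hfd x hx).differentiableAt.differentiableWithinAt, by simp, ?_⟩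
    refine ContDiffOn.congr ?_ fun x hx => (hfd x hx).fderiv
    exact ContDiffOn.sum fun i _ => ((hcs i n).mul (ih (hf.bpartial i))).smul contDiffOn_const

end Analysis

/-! ### Manifolds with a-corners -/

/-- `f` is an a-smooth map from `U ⊆ quad k m` to `quad l n`: the components `fⱼ` with `j ≥ l` are
a-smooth functions, and near each `u ∈ U` each of the first `l` components is either
`F · ∏ᵢ xᵢ^{aᵢ}` with `F > 0` a-smooth and exponents `aᵢ ≥ 0` which vanish unless `i` is a boundary
index with `uᵢ = 0`, or identically zero. -/
structure ASmoothMapOn {m n : ℕ} (k l : ℕ) (U : Set (Fin m → ℝ))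
    (f : (Fin m → ℝ) → (Fin n → ℝ)) : Prop where
  continuousOn : ContinuousOn f U
  mapsTo : MapsTo f U (quad l n)
  aSmoothOn : ∀ j : Fin n, l ≤ j.val → ASmoothOn k U (fun x => f x j)
  boundary : ∀ u ∈ U, ∃ W : Set (Fin m → ℝ), IsOpen W ∧ u ∈ W ∧ ∀ j : Fin n, j.val < l →
    ((∃ (F : (Fin m → ℝ) → ℝ) (a : Fin m → ℝ), ASmoothOn k (U ∩ W) F ∧ (∀ x ∈ U ∩ W, 0 < F x) ∧
        (∀ i, 0 ≤ a i) ∧ (∀ i, ¬ (i.val < k ∧ u i = 0) → a i = 0) ∧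
        ∀ x ∈ U ∩ W, f x j = F x * ∏ i, x i ^ a i) ∨
      ∀ x ∈ U ∩ W, f x j = 0)

/-- An `m`-dimensional a-chart on `X`, written as its coordinate map: a homeomorphism from an open
set `source ⊆ X` onto a relatively open subset `target` of `⟦0,∞)ᵏ × ℝᵐ⁻ᵏ`. -/
structure AChart (m : ℕ) (X : Type*) [TopologicalSpace X] extends PartialEquiv X (Fin m → ℝ) where
  k : ℕ
  k_le : k ≤ m
  open_source : IsOpen source
  open_target : IsQuadOpen k target
  continuousOn_toFun : ContinuousOn toFun source
  continuousOn_invFun : ContinuousOn invFun target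

section Charts

variable {m : ℕ} {X : Type*} [TopologicalSpace X]

/-- The coordinates of a point in an a-chart. -/
def AChart.coord (c : AChart m X) (x : X) : Fin m → ℝ := c.toFun x

/-- The point of `X` with given coordinates. -/
def AChart.point (c : AChart m X) (u : Fin m → ℝ) : X := c.invFun u

/-- The coordinate change from `c` to `d` is a-smooth. -/
def AChart.TransitionSmooth (c d : AChart m X) : Prop :=
  ASmoothMapOn c.k d.k (c.target ∩ c.point ⁻¹' d.source) (fun u => d.coord (c.point u))

/-- Compatibility of a-charts: the coordinate change is an a-diffeomorphism. -/
def AChart.Compatible (c d : AChart m X) : Prop := c.TransitionSmooth d ∧ d.TransitionSmooth c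

/-- All boundary coordinates of `x` in the a-chart `c` are positive. -/
def AChart.PosAt (c : AChart m X) (x : X) : Prop :=
  x ∈ c.source ∧ ∀ i : Fin m, i.val < c.k → 0 < c.coord x i

lemma isOpen_pos (k m : ℕ) : IsOpen {u : Fin m → ℝ | ∀ i : Fin m, i.val < k → 0 < u i} := by
  simp only [ofPred_forall]
  exact isOpen_iInter_of_finite fun i => isOpen_iInter_of_finite fun _ =>
    isOpen_lt continuous_const (continuous_apply i)

lemma AChart.isOpen_posTarget (c : AChart m X) :
    IsOpen (c.target ∩ {u | ∀ i : Fin m, i.val < c.k → 0 < u i}) := by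
  obtain ⟨O, hO, h⟩ := c.open_target
  have : c.target ∩ {u | ∀ i : Fin m, i.val < c.k → 0 < u i} =
      O ∩ {u | ∀ i : Fin m, i.val < c.k → 0 < u i} := by
    rw [h]
    ext u
    exact ⟨fun hu => ⟨hu.1.1, hu.2⟩, fun hu => ⟨⟨hu.1, fun i hi => (hu.2 i hi).le⟩, hu.2⟩⟩
  rw [this]
  exact hO.inter (isOpen_pos c.k m)

lemma AChart.isOpen_posAt (c : AChart m X) : IsOpen {x : X | c.PosAt x} :=
  c.continuousOn_toFun.isOpen_inter_preimage c.open_source (isOpen_pos c.k m)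

end Charts

/-- An `m`-dimensional manifold with a-corners: a second countable Hausdorff space with a maximal
`m`-dimensional a-atlas. -/
class AManifold (m : outParam ℕ) (X : Type*) [TopologicalSpace X] : Type _ where
  t2Space : T2Space X
  secondCountableTopology : SecondCountableTopology X
  charts : Set (AChart m X)
  exists_chart : ∀ x : X, ∃ c ∈ charts, x ∈ c.source
  compatible : ∀ c ∈ charts, ∀ d ∈ charts, c.Compatible d
  maximal : ∀ c : AChart m X, (∀ d ∈ charts, c.Compatible d) → c ∈ charts

section Manifold

variable {m : ℕ} (X : Type*) [TopologicalSpace X] [AManifold m X]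

/-- The interior `X°`: the points at which no boundary coordinate vanishes. -/
def aInterior : Set X := {x | ∃ c ∈ AManifold.charts (X := X), c.PosAt x}

variable {X}

/-- The ordinary chart of the interior `X°` given by the coordinates of an a-chart. -/
noncomputable def AChart.interiorChart (c : AChart m X) (hc : c ∈ AManifold.charts (X := X))
    (x₀ : aInterior X) : OpenPartialHomeomorph (aInterior X) (Fin m → ℝ) where
  toFun x := c.coord x
  invFun u := open Classical in
    if h : u ∈ c.target ∩ {u | ∀ i : Fin m, i.val < c.k → 0 < u i} then
      ⟨c.point u, c, hc, c.map_target h.1, fun i hi => by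
        have := h.2 i hi
        exact this.trans_eq (congrFun (c.right_inv h.1) i).symm⟩
    else x₀
  source := {x | c.PosAt x}
  target := c.target ∩ {u | ∀ i : Fin m, i.val < c.k → 0 < u i}
  map_source' x hx := ⟨c.map_source hx.1, hx.2⟩
  map_target' u hu := by
    rw [dif_pos hu]
    exact ⟨c.map_target hu.1, fun i hi => by
      have := hu.2 i hi
      exact this.trans_eq (congrFun (c.right_inv hu.1) i).symm⟩
  left_inv' x hx := by
    have h : c.coord x ∈ c.target ∩ {u | ∀ i : Fin m, i.val < c.k → 0 < u i} :=
      ⟨c.map_source hx.1, hx.2⟩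
    rw [dif_pos h]
    exact Subtype.ext (c.left_inv hx.1)
  right_inv' u hu := by
    rw [dif_pos hu]
    exact c.right_inv hu.1
  open_source := c.isOpen_posAt.preimage continuous_subtype_val
  open_target := c.isOpen_posTarget
  continuousOn_toFun := c.continuousOn_toFun.comp continuous_subtype_val.continuousOn
    fun x hx => hx.1
  continuousOn_invFun := by
    rw [Topology.IsInducing.subtypeVal.continuousOn_iff]
    refine (c.continuousOn_invFun.mono inter_subset_left).congr fun u hu => ?_
    simp only [Function.comp_apply]
    rw [dif_pos hu]
    rfl

/-- The preferred a-chart at an interior point. -/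
noncomputable def interiorChartAt (x : aInterior X) : AChart m X := x.2.choose

lemma interiorChartAt_mem (x : aInterior X) :
    interiorChartAt x ∈ AManifold.charts (X := X) := x.2.choose_spec.1

lemma interiorChartAt_posAt (x : aInterior X) : (interiorChartAt x).PosAt (x : X) :=
  x.2.choose_spec.2

/-- The interior is a manifold without boundary, with charts the a-charts of `X`. -/
noncomputable instance : ChartedSpace (Fin m → ℝ) (aInterior X) where
  atlas := {e | ∃ (c : AChart m X) (hc : c ∈ AManifold.charts (X := X)) (x₀ : aInterior X),
    e = c.interiorChart hc x₀}
  chartAt x := (interiorChartAt x).interiorChart (interiorChartAt_mem x) x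
  mem_chart_source x := interiorChartAt_posAt x
  chart_mem_atlas x := ⟨_, interiorChartAt_mem x, x, rfl⟩

lemma ASmoothMapOn.contDiffOn {m n k l : ℕ} {U : Set (Fin m → ℝ)}
    {f : (Fin m → ℝ) → (Fin n → ℝ)} (hf : ASmoothMapOn k l U f) {V : Set (Fin m → ℝ)}
    (hV : IsOpen V) (hVU : V ⊆ U)
    (hpos : ∀ x ∈ V, ∀ i : Fin m, i.val < k → x i ≠ 0) : ContDiffOn ℝ ∞ f V := by
  rw [contDiffOn_pi]
  intro j
  by_cases hj : j.val < l
  · intro u hu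
    obtain ⟨W, hW, huW, h⟩ := hf.boundary u (hVU hu)
    have hVW : IsOpen (V ∩ W) := hV.inter hW
    have hmem : V ∩ W ∈ 𝓝 u := hVW.mem_nhds ⟨hu, huW⟩
    suffices hs : ContDiffOn ℝ ∞ (fun x => f x j) (V ∩ W) from
      (hs.contDiffAt hmem).contDiffWithinAt
    rcases h j hj with ⟨F, a, hF, -, -, ha0, hfe⟩ | h0
    · have hFs : ContDiffOn ℝ ∞ F (V ∩ W) :=
        hF.contDiffOn hVW (inter_subset_inter_left W hVU) fun x hx => hpos x hx.1
      refine (hFs.mul (contDiffOn_prod (t := Finset.univ) (f := fun i x => x i ^ a i)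
        fun i _ => ?_)).congr fun x hx => ?_
      · by_cases hi : i.val < k ∧ u i = 0
        · exact absurd hi.2 (hpos u hu i hi.1)
        · simp only [ha0 i hi, Real.rpow_zero]
          exact contDiffOn_const
      · simpa using hfe x ⟨hVU hx.1, hx.2⟩
    · exact contDiffOn_const.congr fun x hx => h0 x ⟨hVU hx.1, hx.2⟩
  · exact (hf.aSmoothOn j (not_lt.1 hj)).contDiffOn hV hVU hpos

instance : IsManifold 𝓘(ℝ, Fin m → ℝ) ∞ (aInterior X) := by
  refine isManifold_of_contDiffOn _ _ _ ?_
  rintro _ _ ⟨c, hc, x, rfl⟩ ⟨d, hd, y, rfl⟩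
  simp only [modelWithCornersSelf_coe, modelWithCornersSelf_coe_symm, Function.id_comp,
    Function.comp_id, preimage_id, range_id, inter_univ, OpenPartialHomeomorph.coe_trans]
  have hpt : ∀ u ∈ (c.interiorChart hc x).target,
      ((c.interiorChart hc x).symm u : X) = c.point u := fun u hu => by
    exact congrArg Subtype.val (dif_pos hu)
  have hs := ((AManifold.compatible c hc d hd).1).contDiffOn
    ((c.interiorChart hc x).symm.trans (d.interiorChart hd y)).open_source
    (fun u hu => by
      rw [OpenPartialHomeomorph.trans_source] at hu
      have h1 : u ∈ (c.interiorChart hc x).target := hu.1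
      have h2 : ((c.interiorChart hc x).symm u : X) ∈ d.source := hu.2.1
      rw [hpt u h1] at h2
      exact ⟨h1.1, h2⟩)
    (fun u hu i hi => by
      rw [OpenPartialHomeomorph.trans_source] at hu
      exact ((hu.1 : u ∈ (c.interiorChart hc x).target).2 i hi).ne')
  refine hs.congr fun u hu => ?_
  rw [OpenPartialHomeomorph.trans_source] at hu
  simp only [Function.comp_apply]
  rw [← hpt u hu.1]
  rfl


/-! ### The b-tangent bundle -/

/-- At interior points, the coefficient of `∂/∂x̃ⱼ` (or of `x̃ⱼ∂/∂x̃ⱼ` for boundary indices `j` of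
`d`) in the `i`-th b-coordinate vector field `xᵢ∂/∂xᵢ` or `∂/∂xᵢ` of `c`; here `x`, `x̃` are the
coordinates of the a-charts `c`, `d`. -/
noncomputable def AChart.bJacobian (c d : AChart m X) (j i : Fin m) (y : X) : ℝ :=
  (if j.val < d.k then (d.coord y j)⁻¹ else 1) *
    bpartial c.k i (fun u => d.coord (c.point u) j) (c.coord y)

/-- The transition functions of `ᵇTX` from `c` to `d`: the continuous extension of `bJacobian` from
the (dense) interior to all of the overlap of the two charts. -/
noncomputable def AChart.bTransition (c d : AChart m X) (x : X) (j i : Fin m) : ℝ :=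
  limUnder (𝓝[aInterior X] x) (c.bJacobian d j i)

/-- The fibre `ᵇTₓX`. An element `v` assigns to each a-chart `c` at `x` its components `v c` in the
frame `x₁∂/∂x₁, …, xₖ∂/∂xₖ, ∂/∂xₖ₊₁, …, ∂/∂xₘ` of `c`, compatibly with changes of charts (and the
value `0` to everything that is not an a-chart at `x`). -/
def BTangent (x : X) : Submodule ℝ (AChart m X → Fin m → ℝ) where
  carrier := {v | (∀ c, ¬ (c ∈ AManifold.charts (X := X) ∧ x ∈ c.source) → v c = 0) ∧
    ∀ c ∈ AManifold.charts (X := X), ∀ d ∈ AManifold.charts (X := X), x ∈ c.source → x ∈ d.source →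
      ∀ j, v d j = ∑ i, c.bTransition d x j i * v c i}
  add_mem' {v w} hv hw := by
    refine ⟨fun c hc => by simp [hv.1 c hc, hw.1 c hc], fun c hc d hd hxc hxd j => ?_⟩
    simp only [Pi.add_apply, hv.2 c hc d hd hxc hxd j, hw.2 c hc d hd hxc hxd j, mul_add,
      Finset.sum_add_distrib]
  zero_mem' := ⟨fun _ _ => rfl, fun _ _ _ _ _ _ _ => by simp⟩
  smul_mem' r v hv := by
    refine ⟨fun c hc => by simp [hv.1 c hc], fun c hc d hd hxc hxd j => ?_⟩
    simp only [Pi.smul_apply, hv.2 c hc d hd hxc hxd j, smul_eq_mul, Finset.mul_sum]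
    exact Finset.sum_congr rfl fun i _ => by ring

/-- The components of a b-tangent vector in the b-frame of an a-chart. -/
def bComp (x : X) (c : AChart m X) : BTangent x →ₗ[ℝ] (Fin m → ℝ) :=
  (LinearMap.proj c).comp (BTangent x).subtype

/-- `C^∞(X)`: the a-smooth functions. -/
def IsASmooth (f : X → ℝ) : Prop :=
  ∀ c ∈ AManifold.charts (X := X), ASmoothOn c.k c.target (fun u => f (c.point u))

/-- `Γ^∞(ᵇTX)`: the a-smooth b-vector fields. -/
def bVectorFields (X : Type*) [TopologicalSpace X] [AManifold m X] :
    Submodule ℝ (Π x : X, BTangent x) where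
  carrier := {v | ∀ c ∈ AManifold.charts (X := X), ∀ i,
    ASmoothOn c.k c.target (fun u => bComp _ c (v (c.point u)) i)}
  add_mem' hv hw c hc i := (hv c hc i).add c.open_target (hw c hc i)
  zero_mem' c _ _ := aSmoothOn_const c.open_target 0
  smul_mem' r _ hv c hc i := (aSmoothOn_const c.open_target r).mul c.open_target (hv c hc i)

/-- In the a-chart `c`, the derivative `w(f) = ∑ᵢ wᵢ ᵇ∂ᵢf` of a function `f` along `w ∈ ᵇTₓX`. -/
noncomputable def AChart.bDeriv (c : AChart m X) (f : X → ℝ) (x : X) : BTangent x →ₗ[ℝ] ℝ :=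
  ∑ i, bpartial c.k i (fun u => f (c.point u)) (c.coord x) •
    (LinearMap.proj i).comp (bComp x c)

/-- An a-chart at `x`. -/
noncomputable def aChartAt (x : X) : AChart m X := (AManifold.exists_chart x).choose

/-- The b-de Rham differential `ᵇdf ∈ ᵇT*ₓX` of a function, computed in any a-chart at `x`. -/
noncomputable def bd (f : X → ℝ) (x : X) : BTangent x →ₗ[ℝ] ℝ := (aChartAt x).bDeriv f x

/-- The components of the b-Lie bracket `ᵇ[u,v]` in the b-frame of the a-chart `c`. -/
noncomputable def AChart.bBracket (c : AChart m X) (u v : Π x : X, BTangent x) (x : X)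
    (i : Fin m) : ℝ :=
  c.bDeriv (fun y => bComp y c (v y) i) x (u x) - c.bDeriv (fun y => bComp y c (u y) i) x (v x)

/-! ### The boundary, the b-normal bundle and weights -/

/-- The germ at `x` of the hypersurface `{xᵢ = 0}` of the a-chart `c`, as a filter on `X`. -/
def AChart.faceGerm (c : AChart m X) (i : Fin m) (x : X) : Filter X :=
  𝓝[{y | y ∈ c.source ∧ c.coord y i = 0}] x

/-- The boundary `∂X`: pairs of a point and a local boundary component of `X` at that point. -/
structure Boundary (X : Type*) [TopologicalSpace X] [AManifold m X] where
  pt : X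
  germ : Filter X
  exists_chart : ∃ c ∈ AManifold.charts (X := X), ∃ i : Fin m, i.val < c.k ∧ pt ∈ c.source ∧
    c.coord pt i = 0 ∧ germ = c.faceGerm i pt

/-- The boundary point `p` lies on the boundary face `{xᵢ = 0}` of the a-chart `c`. -/
def AChart.OnFace (c : AChart m X) (i : Fin m) (p : Boundary X) : Prop :=
  i.val < c.k ∧ p.pt ∈ c.source ∧ c.coord p.pt i = 0 ∧ p.germ = c.faceGerm i p.pt

/-- The fibre at `p` of the b-normal bundle `ᵇN_{∂X} ⊆ i_X^*(ᵇTX)`: the line spanned by `xᵢ∂/∂xᵢ`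
if `p` lies on the face `{xᵢ = 0}` of an a-chart. -/
def BNormal (p : Boundary X) : Submodule ℝ (BTangent p.pt) where
  carrier := {v | ∀ c ∈ AManifold.charts (X := X), ∀ i, c.OnFace i p →
    ∀ j, j ≠ i → bComp p.pt c v j = 0}
  add_mem' hv hw c hc i hi j hj := by
    rw [map_add, Pi.add_apply, hv c hc i hi j hj, hw c hc i hi j hj, add_zero]
  zero_mem' c _ i _ j _ := by rw [map_zero, Pi.zero_apply]
  smul_mem' r v hv c hc i hi j hj := by
    rw [map_smul, Pi.smul_apply, hv c hc i hi j hj, smul_zero]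

/-- A weight: a constant section of the dual of the b-normal bundle, with its flat connection. In
each a-chart the weight equals `a · xᵢ⁻¹dxᵢ` with `a` locally constant along the face
`{xᵢ = 0}`. -/
structure Weight (X : Type*) [TopologicalSpace X] [AManifold m X] where
  toFun : Π p : Boundary X, Module.Dual ℝ (BNormal p)
  locally_constant : ∀ c ∈ AManifold.charts (X := X), ∀ i : Fin m, ∀ x ∈ c.source,
    ∃ a : ℝ, ∃ V ∈ 𝓝 x, ∀ p : Boundary X, p.pt ∈ V → c.OnFace i p →
      ∀ v : BNormal p, toFun p v = a * bComp p.pt c (v : BTangent p.pt) i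

/-- An a-chart over which the weight `wt` is `λᵢ · xᵢ⁻¹dxᵢ` on each boundary face `{xᵢ = 0}`, for
constants `λᵢ`, where `λᵢ = 0` if the face is empty (and for `i ≥ k`). -/
structure WeightChart (wt : Weight X) where
  chart : AChart m X
  mem_charts : chart ∈ AManifold.charts (X := X)
  exponent : Fin m → ℝ
  weight_eq : ∀ (i : Fin m) (p : Boundary X), chart.OnFace i p → ∀ v : BNormal p,
    wt.toFun p v = exponent i * bComp p.pt chart (v : BTangent p.pt) i
  exponent_eq_zero : ∀ i : Fin m, (¬ ∃ p : Boundary X, chart.OnFace i p) → exponent i = 0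

/-! ### The line bundle of a weight -/

section LineBundle

variable (wt : Weight X)

/-- The line bundle `L_λ` is trivialized over each weight chart `W` by a section `e_W`, and over
`X°` by the canonical section `1`. These index the trivializations (`none` is the one over
`X°`). -/
abbrev LineTriv := Option (WeightChart wt)

variable {wt}

/-- The domain of a trivialization of `L_λ`. -/
def LineTriv.domain : LineTriv wt → Set X
  | none => aInterior X
  | some W => W.chart.source

/-- The function on `X°` corresponding to the trivializing section under `L_λ|_{X°} ≅ ℝ`: this is
`x₁^{λ₁} ⋯ xₖ^{λₖ}` for `e_W`, and `1` for the canonical section. -/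
noncomputable def LineTriv.frame : LineTriv wt → X → ℝ
  | none, _ => 1
  | some W, y => ∏ i, W.chart.coord y i ^ W.exponent i

/-- The transition functions of `L_λ`: `e_P = (lineTransition P Q) e_Q`, the continuous extension
of the quotient of the corresponding functions on the (dense) interior. -/
noncomputable def LineTriv.lineTransition (P Q : LineTriv wt) (x : X) : ℝ :=
  limUnder (𝓝[aInterior X] x) (fun y => LineTriv.frame P y / LineTriv.frame Q y)

variable (wt) in
/-- The fibre of `L_λ` at `x`: an element `ℓ` assigns to each trivialization `P` at `x` the
coefficient `ℓ P` of the trivializing section, compatibly with the transition functions. -/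
def LFibre (x : X) : Submodule ℝ (LineTriv wt → ℝ) where
  carrier := {l | (∀ P, x ∉ LineTriv.domain P → l P = 0) ∧
    ∀ P Q, x ∈ LineTriv.domain P → x ∈ LineTriv.domain Q →
      l Q = LineTriv.lineTransition P Q x * l P}
  add_mem' {l l'} hl hl' := by
    refine ⟨fun P hP => by simp [hl.1 P hP, hl'.1 P hP], fun P Q hP hQ => ?_⟩
    simp only [Pi.add_apply, hl.2 P Q hP hQ, hl'.2 P Q hP hQ]; ring
  zero_mem' := ⟨fun _ _ => rfl, fun _ _ _ _ => by simp⟩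
  smul_mem' r l hl := by
    refine ⟨fun P hP => by simp [hl.1 P hP], fun P Q hP hQ => ?_⟩
    simp only [Pi.smul_apply, hl.2 P Q hP hQ, smul_eq_mul]; ring

variable (wt) in
/-- The coefficient of an element of `L_λ` in a trivialization. -/
def lComp (x : X) (P : LineTriv wt) : LFibre wt x →ₗ[ℝ] ℝ :=
  (LinearMap.proj P).comp (LFibre wt x).subtype

variable (wt) in
/-- `Γ^∞(L_λ)`. -/
def lineSections : Submodule ℝ (Π x : X, LFibre wt x) where
  carrier := {l | ∀ W : WeightChart wt,
    ASmoothOn W.chart.k W.chart.target (fun u => lComp wt _ (some W) (l (W.chart.point u)))}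
  add_mem' hv hw W := (hv W).add W.chart.open_target (hw W)
  zero_mem' W := aSmoothOn_const W.chart.open_target 0
  smul_mem' r _ hv W := (aSmoothOn_const W.chart.open_target r).mul W.chart.open_target (hv W)

/-- The flat b-connection `ᵇ∇_λ` of `L_λ`, for which `ᵇ∇_λ e_W = ∑ᵢ λᵢ e_W ⊗ xᵢ⁻¹dxᵢ`: the
coefficient of `ᵇ∇_λ l` at `x` in the frame `e_W`, as a b-covector. -/
noncomputable def WeightChart.flatDeriv (W : WeightChart wt) (l : Π x : X, LFibre wt x) (x : X) :
    BTangent x →ₗ[ℝ] ℝ :=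
  W.chart.bDeriv (fun y => lComp wt y (some W) (l y)) x +
    lComp wt x (some W) (l x) •
      ∑ i, W.exponent i • (LinearMap.proj i).comp (bComp x W.chart)

/-! ### The bundle `ᵇTX ⊗ L_λ` -/

variable (wt) in
/-- The fibre of `ᵇTX ⊗ L_λ` at `x`. -/
abbrev EFibre (x : X) := BTangent x ⊗[ℝ] LFibre wt x

/-- The components of an element of `ᵇTX ⊗ L_λ` in the frame `xᵢ∂/∂xᵢ ⊗ e_W`, `∂/∂xᵢ ⊗ e_W` given
by a weight chart: `v ⊗ l ↦ (lᵂ vᵢ)ᵢ`. -/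
noncomputable def WeightChart.comp (W : WeightChart wt) (x : X) :
    EFibre wt x →ₗ[ℝ] (Fin m → ℝ) :=
  TensorProduct.lift
    ((LinearMap.lsmul ℝ (Fin m → ℝ)).flip.compl₁₂ (bComp x W.chart) (lComp wt x (some W)))

lemma WeightChart.comp_tmul (W : WeightChart wt) (x : X) (v : BTangent x) (l : LFibre wt x) :
    W.comp x (v ⊗ₜ l) = lComp wt x (some W) l • bComp x W.chart v := by
  simp [WeightChart.comp]

variable (wt) in
/-- `Γ^∞(ᵇTX ⊗ L_λ)`. -/
def eSections : Submodule ℝ (Π x : X, EFibre wt x) where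
  carrier := {s | ∀ (W : WeightChart wt) (i : Fin m),
    ASmoothOn W.chart.k W.chart.target (fun u => W.comp _ (s (W.chart.point u)) i)}
  add_mem' hv hw W i := by
    simpa using (hv W i).add W.chart.open_target (hw W i)
  zero_mem' W i := by
    simpa using aSmoothOn_const W.chart.open_target 0
  smul_mem' r _ hv W i := by
    simpa using (aSmoothOn_const W.chart.open_target r).mul W.chart.open_target (hv W i)

lemma smul_mem_eSections {f : X → ℝ} (hf : IsASmooth f) {s : Π x : X, EFibre wt x}
    (hs : s ∈ eSections wt) : (fun x => f x • s x) ∈ eSections wt := fun W i => by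
  simpa using (hf W.chart W.mem_charts).mul W.chart.open_target (hs W i)

lemma tmul_mem_eSections {v : Π x : X, BTangent x} (hv : v ∈ bVectorFields X)
    {l : Π x : X, LFibre wt x} (hl : l ∈ lineSections wt) :
    (fun x => v x ⊗ₜ[ℝ] l x) ∈ eSections wt := fun W i => by
  simpa [WeightChart.comp_tmul] using
    (hl W).mul W.chart.open_target (hv W.chart W.mem_charts i)

/-- `A ∈ Γ^∞((ᵇTX ⊗ L_λ) ⊗ ᵇT*X)`, where the fibre of this bundle at `x` is
`Hom(ᵇTₓX, ᵇTₓX ⊗ L_λ|ₓ)`: the components of `A` in the frames of weight charts are a-smooth. -/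
def IsASmoothHom (A : Π x : X, BTangent x →ₗ[ℝ] EFibre wt x) : Prop :=
  ∀ W : WeightChart wt, ∃ a : Fin m → Fin m → (Fin m → ℝ) → ℝ,
    (∀ i j, ASmoothOn W.chart.k W.chart.target (a i j)) ∧
    ∀ u ∈ W.chart.target, ∀ (w : BTangent (W.chart.point u)) (i : Fin m),
      W.comp _ (A (W.chart.point u) w) i = ∑ j, a i j u * bComp _ W.chart w j

variable (wt) in
/-- A b-connection on `ᵇTX ⊗ L_λ`: an `ℝ`-linear map
`Γ^∞(ᵇTX ⊗ L_λ) → Γ^∞((ᵇTX ⊗ L_λ) ⊗ ᵇT*X)` with the Leibniz rule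
`ᵇ∇(f s) = f ᵇ∇s + s ⊗ ᵇdf`. Here `D s x w` is `(ᵇ∇_w s)(x)`. -/
structure BConnection where
  toLinearMap : eSections wt →ₗ[ℝ] (Π x : X, BTangent x →ₗ[ℝ] EFibre wt x)
  isASmoothHom : ∀ s, IsASmoothHom (toLinearMap s)
  leibniz : ∀ (f : X → ℝ) (hf : IsASmooth f) (s : eSections wt) (x : X) (w : BTangent x),
    toLinearMap ⟨fun y => f y • s.1 y, smul_mem_eSections hf s.2⟩ x w =
      f x • toLinearMap s x w + bd f x w • s.1 x

variable (wt) in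
/-- A weighted b-metric of weight `λ`: an a-smooth section `g` of `S²(ᵇT*X) ⊗ L_{-2λ}`, that is, an
a-smooth family of symmetric bilinear forms on the fibres of `ᵇTX ⊗ L_λ`, which is positive
definite at every point of `X`. -/
structure WeightedBMetric where
  form : Π x : X, EFibre wt x →ₗ[ℝ] EFibre wt x →ₗ[ℝ] ℝ
  symm : ∀ x s t, form x s t = form x t s
  pos : ∀ x s, s ≠ 0 → 0 < form x s s
  aSmooth : ∀ W : WeightChart wt, ∃ G : Fin m → Fin m → (Fin m → ℝ) → ℝ,
    (∀ i j, ASmoothOn W.chart.k W.chart.target (G i j)) ∧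
    ∀ u ∈ W.chart.target, ∀ s t : EFibre wt (W.chart.point u),
      form _ s t = ∑ i, ∑ j, G i j u * W.comp _ s i * W.comp _ t j

/-- `ᵇ∇` is torsion-free. Together with the flat b-connection of `L_λ`, the b-connection `ᵇ∇` on
`ᵇTX ⊗ L_λ` induces a b-connection on `ᵇTX`, with `(ᵇ∇_u v) ⊗ l = ᵇ∇_u(v ⊗ l) - v ⊗ ᵇ∇_{λ,u} l`;
the condition is `(ᵇ∇_u v - ᵇ∇_v u) ⊗ l = ᵇ[u,v] ⊗ l` for all `u`, `v`, `l`, written out in the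
frames of weight charts. -/
def BConnection.TorsionFree (D : BConnection wt) : Prop :=
  ∀ (u v : bVectorFields X) (l : lineSections wt) (W : WeightChart wt), ∀ x ∈ W.chart.source,
    ∀ i : Fin m,
      (W.comp x (D.toLinearMap ⟨_, tmul_mem_eSections v.2 l.2⟩ x (u.1 x)) i
          - W.flatDeriv l.1 x (u.1 x) * bComp x W.chart (v.1 x) i)
        - (W.comp x (D.toLinearMap ⟨_, tmul_mem_eSections u.2 l.2⟩ x (v.1 x)) i
          - W.flatDeriv l.1 x (v.1 x) * bComp x W.chart (u.1 x) i)
      = lComp wt x (some W) (l.1 x) * W.chart.bBracket u.1 v.1 x i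

/-- `ᵇ∇g = 0`: for all sections `s`, `t` of `ᵇTX ⊗ L_λ` and all b-tangent vectors `w`,
`w(g(s,t)) = g(ᵇ∇_w s, t) + g(s, ᵇ∇_w t)`. -/
def BConnection.Parallel (D : BConnection wt) (g : WeightedBMetric wt) : Prop :=
  ∀ (s t : eSections wt) (x : X) (w : BTangent x),
    bd (fun y => g.form y (s.1 y) (t.1 y)) x w =
      g.form x (D.toLinearMap s x w) (t.1 x) + g.form x (s.1 x) (D.toLinearMap t x w)

/-! ### Restriction to the interior -/

/-- The tangent space of the ordinary manifold `X°`. -/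
abbrev IntTangent (x : aInterior X) : Type := TangentSpace 𝓘(ℝ, Fin m → ℝ) x

/-- The natural isomorphism `ᵇTₓX ≅ TₓX°` for `x ∈ X°`: in the coordinates of the preferred chart
at `x`, it maps `∑_{i<k} qᵢ xᵢ∂/∂xᵢ + ∑_{i≥k} qᵢ ∂/∂xᵢ` to the tangent vector given by this
expression. -/
noncomputable def toIntTangent (x : aInterior X) : BTangent (x : X) →ₗ[ℝ] IntTangent x :=
  (LinearMap.pi fun i : Fin m =>
    (if i.val < (interiorChartAt x).k then (interiorChartAt x).coord x i else 1) •
      (LinearMap.proj i).comp (bComp (x : X) (interiorChartAt x)) :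
    BTangent (x : X) →ₗ[ℝ] (Fin m → ℝ))

variable (wt) in
/-- The natural isomorphism `(ᵇTX ⊗ L_λ)|_{X°} ≅ TX°` induced by `ᵇTX|_{X°} ≅ TX°` and the
canonical trivialization `L_λ|_{X°} ≅ ℝ`. -/
noncomputable def identify (x : aInterior X) : EFibre wt (x : X) →ₗ[ℝ] IntTangent x :=
  TensorProduct.lift
    ((LinearMap.lsmul ℝ (IntTangent x)).flip.compl₁₂ (toIntTangent x) (lComp wt (x : X) none))

variable (X) in
/-- A (smooth) Riemannian metric on the ordinary manifold `X°`. -/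
abbrev IntMetric := Bundle.ContMDiffRiemannianMetric 𝓘(ℝ, Fin m → ℝ) ∞ (Fin m → ℝ)
  (fun x : aInterior X => TangentSpace 𝓘(ℝ, Fin m → ℝ) x)

variable (X) in
/-- A covariant derivative on the tangent bundle of the ordinary manifold `X°`. -/
abbrev IntConnection := CovariantDerivative 𝓘(ℝ, Fin m → ℝ) (Fin m → ℝ)
  (fun x : aInterior X => TangentSpace 𝓘(ℝ, Fin m → ℝ) x)

/-- The Levi-Civita connection of a Riemannian metric on `X°`: it is torsion-free and compatible
with the metric. -/
def IsLeviCivita (h : IntMetric X) (cov : IntConnection X) : Prop :=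
  letI : Bundle.RiemannianBundle
    (fun x : aInterior X => TangentSpace 𝓘(ℝ, Fin m → ℝ) x) := ⟨h.toRiemannianMetric⟩
  cov.torsion = 0 ∧ cov.IsMetricCompatible

/-- `h` is the restriction `g|_{X°}` under `(ᵇTX ⊗ L_λ)|_{X°} ≅ TX°`. -/
def WeightedBMetric.RestrictsTo (g : WeightedBMetric wt) (h : IntMetric X) : Prop :=
  ∀ (x : aInterior X) (s t : EFibre wt (x : X)),
    h.inner x (identify wt x s) (identify wt x t) = g.form x s t

/-- The restriction `ᵇ∇|_{X°}` is identified with `cov` under `(ᵇTX ⊗ L_λ)|_{X°} ≅ TX°`. -/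
def BConnection.RestrictsTo (D : BConnection wt) (cov : IntConnection X) : Prop :=
  ∀ (s : eSections wt) (x : aInterior X) (w : BTangent (x : X)),
    identify wt x (D.toLinearMap s x w) =
      cov (fun y : aInterior X => identify wt y (s.1 y)) x (toIntTangent x w)

/-- `ᵇ∇|_{X°}` is identified with the Levi-Civita connection of `g|_{X°}`. -/
def BConnection.IsLeviCivita (D : BConnection wt) (g : WeightedBMetric wt) : Prop :=
  ∃ (h : IntMetric X) (cov : IntConnection X),
    g.RestrictsTo h ∧ ACorners.IsLeviCivita h cov ∧ D.RestrictsTo cov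

end LineBundle

end Manifold

end ACorners
open ACorners

set_option linter.unusedSectionVars false

/-! ### The Levi-Civita connection of a Riemannian manifold -/

namespace ACorners

section LeviCivita

open VectorField

variable {E : Type*} [NormedAddCommGroup E] [NormedSpace ℝ E] [FiniteDimensional ℝ E]
  {H : Type*} [TopologicalSpace H] (I : ModelWithCorners ℝ E H)
  {M : Type*} [TopologicalSpace M] [ChartedSpace H M] [IsManifold I ∞ M]
  [Bundle.RiemannianBundle (fun x : M => TangentSpace I x)]
  [IsContMDiffRiemannianBundle I ∞ E (fun x : M => TangentSpace I x)]

/-- The right hand side of the Koszul formula for `2⟪∇_X Y, Z⟫`. -/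
noncomputable def koszul (X Y Z : Π x : M, TangentSpace I x) (x : M) : ℝ :=
  mvfderiv I (fun y => inner ℝ (Y y) (Z y)) x (X x)
    + mvfderiv I (fun y => inner ℝ (X y) (Z y)) x (Y x)
    - mvfderiv I (fun y => inner ℝ (X y) (Y y)) x (Z x)
    + inner ℝ (mlieBracket I X Y x) (Z x) - inner ℝ (mlieBracket I X Z x) (Y x)
    - inner ℝ (mlieBracket I Y Z x) (X x)

variable {I} {X X' Y Y' Z Z' : Π x : M, TangentSpace I x} {x : M}

lemma mdifferentiableAt_inner (hX : MDiffAt (T% X) x) (hY : MDiffAt (T% Y) x) :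
    MDiffAt (fun y => (inner ℝ (X y) (Y y) : ℝ)) x :=
  MDifferentiableAt.inner_bundle (E := fun y : M => TangentSpace I y) hX hY

lemma mvfderiv_inner_smul_left {f : M → ℝ} (hf : MDiffAt f x) (hX : MDiffAt (T% X) x)
    (hY : MDiffAt (T% Y) x) (v : TangentSpace I x) :
    mvfderiv I (fun y => inner ℝ (f y • X y) (Y y)) x v =
      f x * mvfderiv I (fun y => inner ℝ (X y) (Y y)) x v +
        mvfderiv I f x v * inner ℝ (X x) (Y x) := by
  have h : (fun y => inner ℝ (f y • X y) (Y y)) = fun y => f y * inner ℝ (X y) (Y y) := by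
    ext y; simp [inner_smul_left]
  rw [h, mvfderiv_fun_mul hf (mdifferentiableAt_inner hX hY)]
  simp [mul_comm]

lemma mvfderiv_inner_comm (v : TangentSpace I x) :
    mvfderiv I (fun y => inner ℝ (X y) (Y y)) x v =
      mvfderiv I (fun y => inner ℝ (Y y) (X y)) x v := by
  simp_rw [real_inner_comm]

lemma mvfderiv_inner_smul_right {f : M → ℝ} (hf : MDiffAt f x) (hX : MDiffAt (T% X) x)
    (hY : MDiffAt (T% Y) x) (v : TangentSpace I x) :
    mvfderiv I (fun y => inner ℝ (X y) (f y • Y y)) x v =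
      f x * mvfderiv I (fun y => inner ℝ (X y) (Y y)) x v +
        mvfderiv I f x v * inner ℝ (X x) (Y x) := by
  simp_rw [fun y => real_inner_comm (f y • Y y) (X y)]
  rw [mvfderiv_inner_smul_left hf hY hX, mvfderiv_inner_comm,
    real_inner_comm]

lemma mvfderiv_inner_add_left (hX : MDiffAt (T% X) x) (hX' : MDiffAt (T% X') x)
    (hY : MDiffAt (T% Y) x) (v : TangentSpace I x) :
    mvfderiv I (fun y => inner ℝ (X y + X' y) (Y y)) x v =
      mvfderiv I (fun y => inner ℝ (X y) (Y y)) x v +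
        mvfderiv I (fun y => inner ℝ (X' y) (Y y)) x v := by
  have h : (fun y => inner ℝ (X y + X' y) (Y y)) =
      fun y => inner ℝ (X y) (Y y) + inner ℝ (X' y) (Y y) := by
    ext y; simp [inner_add_left]
  rw [h, mvfderiv_fun_add (mdifferentiableAt_inner hX hY) (mdifferentiableAt_inner hX' hY)]
  simp

lemma mvfderiv_inner_add_right (hX : MDiffAt (T% X) x) (hY : MDiffAt (T% Y) x)
    (hY' : MDiffAt (T% Y') x) (v : TangentSpace I x) :
    mvfderiv I (fun y => inner ℝ (X y) (Y y + Y' y)) x v =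
      mvfderiv I (fun y => inner ℝ (X y) (Y y)) x v +
        mvfderiv I (fun y => inner ℝ (X y) (Y' y)) x v := by
  simp_rw [fun y => real_inner_comm (Y y + Y' y) (X y)]
  rw [mvfderiv_inner_add_left hY hY' hX, mvfderiv_inner_comm,
    mvfderiv_inner_comm (X := Y')]

lemma koszul_tensorial_left (hY : MDiffAt (T% Y) x) (hZ : MDiffAt (T% Z) x) :
    TensorialAt I E (fun X => koszul I X Y Z x) x where
  smul {f X} hf hX := by
    simp only [koszul, mvfderiv_inner_smul_left hf hX hZ, mvfderiv_inner_smul_left hf hX hY,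
      mlieBracket_smul_left hf hX, Pi.smul_apply']
    simp only [inner_add_left, inner_smul_left, inner_smul_right, map_smul, smul_eq_mul,
      inner_neg_left, neg_smul]
    simp only [conj_trivial]
    rw [real_inner_comm (Z x) (X x)]
    ring
  add {X X'} hX hX' := by
    simp only [koszul, mvfderiv_inner_add_left hX hX' hZ, mvfderiv_inner_add_left hX hX' hY,
      mlieBracket_add_left hX hX', Pi.add_apply]
    simp only [inner_add_left, inner_add_right, map_add]
    ring

lemma koszul_tensorial_right (hX : MDiffAt (T% X) x) (hY : MDiffAt (T% Y) x) :
    TensorialAt I E (fun Z => koszul I X Y Z x) x where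
  smul {f Z} hf hZ := by
    simp only [koszul, mvfderiv_inner_smul_right hf hX hZ,
      mvfderiv_inner_smul_right hf hY hZ, mlieBracket_smul_right hf hZ, Pi.smul_apply']
    simp only [inner_add_left, inner_smul_left, inner_smul_right, map_smul, smul_eq_mul]
    simp only [conj_trivial]
    rw [real_inner_comm (X x) (Z x), real_inner_comm (Y x) (Z x)]
    ring
  add {Z Z'} hZ hZ' := by
    simp only [koszul, mvfderiv_inner_add_right hX hZ hZ',
      mvfderiv_inner_add_right hY hZ hZ', mlieBracket_add_right hZ hZ', Pi.add_apply]
    simp only [inner_add_left, inner_add_right, map_add]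
    ring

lemma koszul_add_middle (hX : MDiffAt (T% X) x) (hY : MDiffAt (T% Y) x)
    (hY' : MDiffAt (T% Y') x) (hZ : MDiffAt (T% Z) x) :
    koszul I X (Y + Y') Z x = koszul I X Y Z x + koszul I X Y' Z x := by
  simp only [koszul, mvfderiv_inner_add_left hY hY' hZ, mvfderiv_inner_add_right hX hY hY',
      mlieBracket_add_right hY hY', mlieBracket_add_left hY hY', Pi.add_apply]
  simp only [inner_add_left, inner_add_right, map_add]
  ring

lemma koszul_smul_middle {f : M → ℝ} (hf : MDiffAt f x) (hX : MDiffAt (T% X) x)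
    (hY : MDiffAt (T% Y) x) (hZ : MDiffAt (T% Z) x) :
    koszul I X (f • Y) Z x =
      f x * koszul I X Y Z x + 2 * (mvfderiv I f x (X x) * inner ℝ (Y x) (Z x)) := by
  simp only [koszul, mvfderiv_inner_smul_left hf hY hZ, mvfderiv_inner_smul_right hf hX hY,
      mlieBracket_smul_right hf hY, mlieBracket_smul_left hf hY, Pi.smul_apply']
  simp only [inner_add_left, inner_smul_left, inner_smul_right, map_smul, smul_eq_mul,
      inner_neg_left, neg_smul]
  simp only [conj_trivial]
  rw [real_inner_comm (X x) (Y x)]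
  ring

lemma eq_of_inner_eq {v w : TangentSpace I x} (h : ∀ z, inner ℝ v z = inner ℝ w z) : v = w :=
  ext_inner_right ℝ h

variable (I x) in
lemma innerₗ_nondegenerate :
    (innerₗ (TangentSpace I x) : LinearMap.BilinForm ℝ (TangentSpace I x)).Nondegenerate :=
  ⟨fun v hv => inner_self_eq_zero.1 (hv v), fun v hv => inner_self_eq_zero.1 (hv v)⟩

instance : FiniteDimensional ℝ (TangentSpace I x) := inferInstanceAs (FiniteDimensional ℝ E)

open Classical in
variable (I M) in
/-- The Levi-Civita connection as an operator on vector fields, defined by the Koszul formula at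
points of differentiability. -/
noncomputable def leviCivitaFun (Y : Π x : M, TangentSpace I x) (x : M) :
    TangentSpace I x →L[ℝ] TangentSpace I x :=
  if hY : MDiffAt (T% Y) x then
    LinearMap.toContinuousLinearMap
      (((LinearMap.BilinForm.toDual _ (innerₗ_nondegenerate I x)).symm.toLinearMap ∘ₗ
        (ContinuousLinearMap.coeLM ℝ) ∘ₗ
        ((2 : ℝ)⁻¹ • (TensorialAt.mkHom₂ (fun X Z => koszul I X Y Z x) x
          (fun _ hZ => koszul_tensorial_left hY hZ)
          (fun _ hX => koszul_tensorial_right hX hY)).toLinearMap)))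
  else 0

lemma inner_leviCivitaFun (hX : MDiffAt (T% X) x) (hY : MDiffAt (T% Y) x)
    (hZ : MDiffAt (T% Z) x) :
    2 * inner ℝ (leviCivitaFun I M Y x (X x)) (Z x) = koszul I X Y Z x := by
  have h := LinearMap.BilinForm.apply_toDual_symm_apply (hB := innerₗ_nondegenerate I x)
    (f := ContinuousLinearMap.coeLM ℝ (((2 : ℝ)⁻¹ • (TensorialAt.mkHom₂
          (fun X Z => koszul I X Y Z x) x (fun _ hZ => koszul_tensorial_left hY hZ)
          (fun _ hX => koszul_tensorial_right hX hY)).toLinearMap) (X x))) (v := Z x)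
  rw [leviCivitaFun, dif_pos hY]
  have e : (TensorialAt.mkHom₂ (fun X Z => koszul I X Y Z x) x
      (fun _ hZ => koszul_tensorial_left hY hZ)
      (fun _ hX => koszul_tensorial_right hX hY)) (X x) (Z x) = koszul I X Y Z x :=
    TensorialAt.mkHom₂_apply _ _ hX hZ
  rw [← e]
  refine (congrArg (2 * ·) h).trans ?_
  simp

end LeviCivita
end ACorners

namespace ACorners

section LeviCivita

open VectorField

variable {E : Type*} [NormedAddCommGroup E] [NormedSpace ℝ E] [FiniteDimensional ℝ E]
  {H : Type*} [TopologicalSpace H] {I : ModelWithCorners ℝ E H}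
  {M : Type*} [TopologicalSpace M] [ChartedSpace H M] [IsManifold I ∞ M]
  [Bundle.RiemannianBundle (fun x : M => TangentSpace I x)]
  [IsContMDiffRiemannianBundle I ∞ E (fun x : M => TangentSpace I x)]
  {X Y Z : Π x : M, TangentSpace I x} {x : M}

lemma clm_eq_of_inner_eq {A B : TangentSpace I x →L[ℝ] TangentSpace I x}
    (h : ∀ {X Z : Π x : M, TangentSpace I x}, MDiffAt (T% X) x → MDiffAt (T% Z) x →
      2 * inner ℝ (A (X x)) (Z x) = 2 * inner ℝ (B (X x)) (Z x)) : A = B := by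
  ext v
  refine eq_of_inner_eq fun z => ?_
  have := h (FiberBundle.mdifferentiableAt_extend I E v)
    (FiberBundle.mdifferentiableAt_extend I E z)
  simp only [FiberBundle.extend_apply_self] at this
  linarith

variable (I M) in
/-- The Levi-Civita connection of a Riemannian manifold. -/
noncomputable def leviCivita : CovariantDerivative I E (fun x : M => TangentSpace I x) where
  toFun := leviCivitaFun I M
  isCovariantDerivativeOnUniv :=
    { add := by
        intro Y Y' x hY hY' _
        refine clm_eq_of_inner_eq fun hX hZ => ?_
        rw [inner_leviCivitaFun hX (mdifferentiableAt_add_section hY hY') hZ, add_apply,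
          inner_add_left, mul_add, inner_leviCivitaFun hX hY hZ, inner_leviCivitaFun hX hY' hZ,
          koszul_add_middle hX hY hY' hZ]
      leibniz := by
        intro Y f x hY hf _
        refine clm_eq_of_inner_eq fun hX hZ => ?_
        rw [inner_leviCivitaFun hX (hf.smul_section hY) hZ, koszul_smul_middle hf hX hY hZ,
          ← inner_leviCivitaFun hX hY hZ]
        simp only [add_apply, smul_apply,
          ContinuousLinearMap.smulRight_apply, inner_add_left, inner_smul_left, conj_trivial]
        ring }

lemma inner_leviCivita (hX : MDiffAt (T% X) x) (hY : MDiffAt (T% Y) x) (hZ : MDiffAt (T% Z) x) :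
    2 * inner ℝ (leviCivita I M Y x (X x)) (Z x) = koszul I X Y Z x :=
  inner_leviCivitaFun hX hY hZ

lemma leviCivita_torsion : (leviCivita I M).torsion = 0 := by
  rw [CovariantDerivative.torsion_eq_zero_iff]
  intro X Y x hX hY
  refine eq_of_inner_eq fun z => ?_
  have hZ := FiberBundle.mdifferentiableAt_extend I E z (V := fun x : M => TangentSpace I x)
  have h1 := inner_leviCivita hX hY hZ
  have h2 := inner_leviCivita hY hX hZ
  simp only [FiberBundle.extend_apply_self] at h1 h2
  rw [inner_sub_left]
  simp only [koszul, FiberBundle.extend_apply_self] at h1 h2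
  rw [mvfderiv_inner_comm (X := Y) (Y := X), mlieBracket_swap_apply (V := Y) (W := X),
    inner_neg_left] at h2
  linarith

lemma leviCivita_isMetricCompatible :
    CovariantDerivative.IsMetricCompatible (V := fun x : M => TangentSpace I x)
      (leviCivita I M) := by
  rw [CovariantDerivative.isMetricCompatible_iff]
  intro x X Y Z hX hY hZ
  have h1 := inner_leviCivita hX hY hZ
  have h2 := inner_leviCivita hX hZ hY
  simp only [koszul] at h1 h2
  rw [mvfderiv_inner_comm (X := Z) (Y := Y), mlieBracket_swap_apply (V := Z) (W := Y),
    inner_neg_left] at h2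
  beta_reduce
  rw [real_inner_comm (leviCivita I M Z x (X x)) (Y x)]
  linarith

lemma inner_eq_koszul {cov : CovariantDerivative I E (fun x : M => TangentSpace I x)}
    (htor : cov.torsion = 0)
    (hmet : CovariantDerivative.IsMetricCompatible (V := fun x : M => TangentSpace I x) cov)
    (hX : MDiffAt (T% X) x)
    (hY : MDiffAt (T% Y) x) (hZ : MDiffAt (T% Z) x) :
    2 * inner ℝ (cov Y x (X x)) (Z x) = koszul I X Y Z x := by
  rw [CovariantDerivative.torsion_eq_zero_iff] at htor
  have m1 := hmet.mvfderiv_inner_eq X hY hZ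
  have m2 := hmet.mvfderiv_inner_eq Y hX hZ
  have m3 := hmet.mvfderiv_inner_eq Z hX hY
  simp only [koszul, m1, m2, m3, ← htor hX hY, ← htor hX hZ, ← htor hY hZ, inner_sub_left]
  rw [real_inner_comm (cov Z x (X x)) (Y x), real_inner_comm (cov Z x (Y x)) (X x),
    real_inner_comm (cov Y x (Z x)) (X x)]
  ring

/-- Uniqueness of the Levi-Civita connection, on differentiable vector fields. -/
lemma eq_leviCivita {cov : CovariantDerivative I E (fun x : M => TangentSpace I x)}
    (htor : cov.torsion = 0)
    (hmet : CovariantDerivative.IsMetricCompatible (V := fun x : M => TangentSpace I x) cov)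
    (hY : MDiffAt (T% Y) x) :
    cov Y x = leviCivita I M Y x :=
  clm_eq_of_inner_eq fun hX hZ => by
    rw [inner_eq_koszul htor hmet hX hY hZ, inner_leviCivita hX hY hZ]

end LeviCivita
end ACorners

namespace ACorners

section LeviCivitaFrame

open VectorField

variable {E : Type*} [NormedAddCommGroup E] [NormedSpace ℝ E] [FiniteDimensional ℝ E]
  {H : Type*} [TopologicalSpace H] {I : ModelWithCorners ℝ E H}
  {M : Type*} [TopologicalSpace M] [ChartedSpace H M] [IsManifold I ∞ M]
  {x : M} {ι : Type*} [Fintype ι] {F : ι → Π x : M, TangentSpace I x}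

lemma covariantDerivative_sum (cov : CovariantDerivative I E (fun x : M => TangentSpace I x))
    (s : Finset ι) {v : ι → M → ℝ} (hF : ∀ i, MDiffAt (T% (F i)) x) (hv : ∀ i, MDiffAt (v i) x)
    (w : TangentSpace I x) :
    cov (fun y => ∑ i ∈ s, v i y • F i y) x w =
      ∑ i ∈ s, (v i x • cov (F i) x w + mvfderiv I (v i) x w • F i x) := by
  classical
  have hU := cov.isCovariantDerivativeOnUniv
  induction s using Finset.induction_on with
  | empty =>
    have h := congrFun cov.zero x
    simp only [Finset.sum_empty]
    exact (congrArg (· w) h).trans rfl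
  | insert a s ha ih =>
    have h1 : MDiffAt (T% (v a • F a)) x := (hv a).smul_section (hF a)
    have h2 : MDiffAt (T% (fun y => ∑ i ∈ s, v i y • F i y)) x :=
      .sum_section fun i _ => (hv i).smul_section (hF i)
    have h3 : (fun y => ∑ i ∈ insert a s, v i y • F i y) =
        v a • F a + fun y => ∑ i ∈ s, v i y • F i y := by
      funext y
      rw [Finset.sum_insert ha]
      rfl
    rw [h3, hU.add h1 h2, hU.leibniz (hF a) (hv a), Finset.sum_insert ha, ← ih]
    simp

variable [Bundle.RiemannianBundle (fun x : M => TangentSpace I x)]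
  [IsContMDiffRiemannianBundle I ∞ E (fun x : M => TangentSpace I x)]

/-- The Levi-Civita connection in a commuting frame. -/
lemma leviCivita_frame (hF : ∀ i, MDiffAt (T% (F i)) x)
    (hbr : ∀ i j, mlieBracket I (F i) (F j) x = 0)
    (hspan : ∀ z : TangentSpace I x, ∃ a : ι → ℝ, z = ∑ j, a j • F j x) {Γ : ι → ι → ι → ℝ}
    (hΓ : ∀ k i j, 2 * ∑ l, Γ l k i * inner ℝ (F l x) (F j x) =
      mvfderiv I (fun y => inner ℝ (F i y) (F j y)) x (F k x) +
        mvfderiv I (fun y => inner ℝ (F k y) (F j y)) x (F i x) -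
        mvfderiv I (fun y => inner ℝ (F k y) (F i y)) x (F j x)) (k i : ι) :
    leviCivita I M (F i) x (F k x) = ∑ l, Γ l k i • F l x := by
  refine eq_of_inner_eq fun z => ?_
  obtain ⟨a, rfl⟩ := hspan z
  rw [inner_sum, inner_sum]
  refine Finset.sum_congr rfl fun j _ => ?_
  have h := inner_leviCivita (hF k) (hF i) (hF j)
  rw [koszul, hbr, hbr, hbr, inner_zero_left, inner_zero_left, inner_zero_left] at h
  have h' := hΓ k i j
  rw [inner_smul_right, inner_smul_right, sum_inner]
  simp only [inner_smul_left, conj_trivial]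
  congr 1
  linarith

lemma leviCivita_sum_frame (hF : ∀ i, MDiffAt (T% (F i)) x)
    (hbr : ∀ i j, mlieBracket I (F i) (F j) x = 0)
    (hspan : ∀ z : TangentSpace I x, ∃ a : ι → ℝ, z = ∑ j, a j • F j x) {Γ : ι → ι → ι → ℝ}
    (hΓ : ∀ k i j, 2 * ∑ l, Γ l k i * inner ℝ (F l x) (F j x) =
      mvfderiv I (fun y => inner ℝ (F i y) (F j y)) x (F k x) +
        mvfderiv I (fun y => inner ℝ (F k y) (F j y)) x (F i x) -
        mvfderiv I (fun y => inner ℝ (F k y) (F i y)) x (F j x))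
    {v : ι → M → ℝ} (hv : ∀ i, MDiffAt (v i) x) (k : ι) :
    leviCivita I M (fun y => ∑ i, v i y • F i y) x (F k x) =
      ∑ l, (mvfderiv I (v l) x (F k x) + ∑ i, Γ l k i * v i x) • F l x := by
  rw [covariantDerivative_sum _ _ hF hv]
  simp only [leviCivita_frame hF hbr hspan hΓ, Finset.sum_add_distrib, add_smul, Finset.smul_sum,
    Finset.sum_smul]
  rw [add_comm, Finset.sum_comm]
  simp only [smul_smul, mul_comm]

end LeviCivitaFrame

end ACorners

/-! ### The algebra of a-smooth functions -/

namespace ACorners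

section Algebra

variable {m k : ℕ} {U V : Set (Fin m → ℝ)} {f g : (Fin m → ℝ) → ℝ}

lemma ADiffOn.mono (hf : ADiffOn k U f) (hVU : V ⊆ U) : ADiffOn k V f where
  continuousOn := hf.continuousOn.mono hVU
  differentiableAt i x hx := hf.differentiableAt i x (hVU hx)
  continuousOn_bpartial i := (hf.continuousOn_bpartial i).mono hVU
  decay i hi S hS := hf.decay i hi S (hS.trans hVU)

lemma ASmoothUpTo.mono {n : ℕ} (hf : ASmoothUpTo k U n f) (hVU : V ⊆ U) :
    ASmoothUpTo k V n f := by
  induction n generalizing f with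
  | zero => exact ADiffOn.mono hf hVU
  | succ n ih => exact ⟨hf.1.mono hVU, fun i => ih (hf.2 i)⟩

lemma ASmoothOn.mono (hf : ASmoothOn k U f) (hVU : V ⊆ U) : ASmoothOn k V f :=
  fun n => (hf n).mono hVU

lemma ASmoothMapOn.mono {n l : ℕ} {F : (Fin m → ℝ) → (Fin n → ℝ)} (hF : ASmoothMapOn k l U F)
    (hVU : V ⊆ U) : ASmoothMapOn k l V F where
  continuousOn := hF.continuousOn.mono hVU
  mapsTo := hF.mapsTo.mono_left hVU
  aSmoothOn j hj := (hF.aSmoothOn j hj).mono hVU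
  boundary u hu := by
    obtain ⟨W, hW, huW, h⟩ := hF.boundary u (hVU hu)
    refine ⟨W, hW, huW, fun j hj => ?_⟩
    have hs : V ∩ W ⊆ U ∩ W := inter_subset_inter_left W hVU
    rcases h j hj with ⟨G, a, hG, hpos, ha, ha0, he⟩ | h0
    · exact Or.inl ⟨G, a, hG.mono hs, fun x hx => hpos x (hs hx), ha, ha0,
        fun x hx => he x (hs hx)⟩
    · exact Or.inr fun x hx => h0 x (hs hx)

lemma ASmoothOn.aDiffOn (hf : ASmoothOn k U f) : ADiffOn k U f := hf 0

lemma ASmoothOn.continuousOn (hf : ASmoothOn k U f) : ContinuousOn f U := hf.aDiffOn.continuousOn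

lemma ASmoothOn.const_mul (hU : IsQuadOpen k U) (c : ℝ) (hf : ASmoothOn k U f) :
    ASmoothOn k U (fun x => c * f x) := (aSmoothOn_const hU c).mul hU hf

lemma ASmoothOn.sub (hU : IsQuadOpen k U) (hf : ASmoothOn k U f) (hg : ASmoothOn k U g) :
    ASmoothOn k U (fun x => f x - g x) :=
  (hf.add hU (hg.const_mul hU (-1))).congr hU fun x _ => by ring

lemma ASmoothOn.sum (hU : IsQuadOpen k U) {ι : Type*} {s : Finset ι}
    {F : ι → (Fin m → ℝ) → ℝ} (hF : ∀ i ∈ s, ASmoothOn k U (F i)) :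
    ASmoothOn k U (fun x => ∑ i ∈ s, F i x) := by
  classical
  induction s using Finset.induction_on with
  | empty => simpa using aSmoothOn_const hU 0
  | insert a s ha ih =>
    simp only [Finset.sum_insert ha]
    exact (hF a (Finset.mem_insert_self a s)).add hU
      (ih fun i hi => hF i (Finset.mem_insert_of_mem hi))

lemma ASmoothOn.prod (hU : IsQuadOpen k U) {ι : Type*} {s : Finset ι}
    {F : ι → (Fin m → ℝ) → ℝ} (hF : ∀ i ∈ s, ASmoothOn k U (F i)) :
    ASmoothOn k U (fun x => ∏ i ∈ s, F i x) := by
  classical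
  induction s using Finset.induction_on with
  | empty => simpa using aSmoothOn_const hU 1
  | insert a s ha ih =>
    simp only [Finset.prod_insert ha]
    exact (hF a (Finset.mem_insert_self a s)).mul hU
      (ih fun i hi => hF i (Finset.mem_insert_of_mem hi))

lemma ASmoothOn.det (hU : IsQuadOpen k U) {n : ℕ} {G : Fin n → Fin n → (Fin m → ℝ) → ℝ}
    (hG : ∀ i j, ASmoothOn k U (G i j)) :
    ASmoothOn k U (fun x => (Matrix.of fun i j => G i j x).det) := by
  simp only [Matrix.det_apply', Matrix.of_apply]
  exact ASmoothOn.sum hU fun σ _ => (ASmoothOn.prod hU fun i _ => hG (σ i) i).const_mul hU _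

lemma bpartial_inv (hf : ADiffOn k U f) (h0 : ∀ x ∈ U, f x ≠ 0) (i : Fin m) :
    EqOn (bpartial k i (fun x => (f x)⁻¹))
      (fun x => (-1) * (bpartial k i f x * ((f x)⁻¹ * (f x)⁻¹))) U := by
  intro x hx
  have h0' : f (Function.update x i (x i)) ≠ 0 := by simpa using h0 x hx
  simp only [bpartial]
  split_ifs with h1 h2
  · simp
  · rw [deriv_fun_inv'' (hf.differentiableAt i x hx fun _ => h2) h0']
    simp only [Function.update_eq_self]
    field_simp
  · rw [deriv_fun_inv'' (hf.differentiableAt i x hx fun h => absurd h h1) h0']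
    simp only [Function.update_eq_self]
    field_simp

lemma ADiffOn.inv (hf : ADiffOn k U f) (hU : IsQuadOpen k U) (h0 : ∀ x ∈ U, f x ≠ 0) :
    ADiffOn k U (fun x => (f x)⁻¹) where
  continuousOn := hf.continuousOn.inv₀ h0
  differentiableAt i x hx hi := (hf.differentiableAt i x hx hi).fun_inv (by simpa using h0 x hx)
  continuousOn_bpartial i := by
    have hc := hf.continuousOn.inv₀ h0
    exact (continuousOn_const.mul ((hf.continuousOn_bpartial i).mul (hc.mul hc))).congr
      (bpartial_inv hf h0 i)
  decay i hi S hS hSc := by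
    obtain ⟨C, hC, α, hα, hb⟩ := hf.decay i hi S hS hSc
    have hc := (hf.continuousOn.inv₀ h0).mono hS
    obtain ⟨N, hN⟩ := hSc.exists_bound_of_continuousOn (hc.mul hc)
    refine ⟨C * max N 1, by positivity, α, hα, fun x hx => ?_⟩
    rw [bpartial_inv hf h0 i (hS hx)]
    have h1 := hb x hx
    have h2 : |(f x)⁻¹ * (f x)⁻¹| ≤ max N 1 := (hN x hx).trans (le_max_left _ _)
    have h3 := Real.rpow_nonneg (hU.subset_quad (hS hx) i hi) α
    beta_reduce
    rw [neg_one_mul, abs_neg, abs_mul]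
    calc _ ≤ (C * x i ^ α) * max N 1 := by gcongr
      _ = _ := by ring

lemma ASmoothOn.inv (hU : IsQuadOpen k U) (hf : ASmoothOn k U f) (h0 : ∀ x ∈ U, f x ≠ 0) :
    ASmoothOn k U (fun x => (f x)⁻¹) := by
  intro n
  induction n with
  | zero => exact hf.aDiffOn.inv hU h0
  | succ n ih =>
    refine ⟨hf.aDiffOn.inv hU h0, fun i => ?_⟩
    exact ((aSmoothOn_const hU (-1) n).mul hU (((hf.bpartial i) n).mul hU (ih.mul hU ih))).congr hU
      (bpartial_inv hf.aDiffOn h0 i)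

lemma ASmoothOn.matrix_inv (hU : IsQuadOpen k U) {n : ℕ} {G : Fin n → Fin n → (Fin m → ℝ) → ℝ}
    (hG : ∀ i j, ASmoothOn k U (G i j)) (h0 : ∀ x ∈ U, (Matrix.of fun i j => G i j x).det ≠ 0)
    (i j : Fin n) : ASmoothOn k U (fun x => (Matrix.of fun i j => G i j x)⁻¹ i j) := by
  simp only [Matrix.inv_def, Ring.inverse_eq_inv', Matrix.smul_apply, smul_eq_mul,
    Matrix.adjugate_apply]
  refine ((ASmoothOn.det hU hG).inv hU h0).mul hU ?_
  have : ∀ x, (Matrix.of fun i j => G i j x).updateRow j (Pi.single i 1) =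
      Matrix.of fun a b => if a = j then (Pi.single i (1 : ℝ) : Fin n → ℝ) b else G a b x := by
    intro x; ext a b; simp [Matrix.updateRow_apply]
  simp only [this]
  refine ASmoothOn.det hU (G := fun a b x =>
    if a = j then (Pi.single i (1 : ℝ) : Fin n → ℝ) b else G a b x) fun a b => ?_
  by_cases h : a = j
  · simpa [h] using aSmoothOn_const hU _
  · simpa [h] using hG a b

lemma bpartial_sum (hU : IsQuadOpen k U) {ι : Type*} {s : Finset ι} {F : ι → (Fin m → ℝ) → ℝ}
    (hF : ∀ j ∈ s, ASmoothOn k U (F j)) (i : Fin m) :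
    EqOn (bpartial k i (fun x => ∑ j ∈ s, F j x)) (fun x => ∑ j ∈ s, bpartial k i (F j) x) U := by
  classical
  induction s using Finset.induction_on with
  | empty => intro x _; simp [bpartial_const]
  | insert a s ha ih =>
    intro x hx
    have h1 := hF a (Finset.mem_insert_self a s)
    have h2 : ∀ j ∈ s, ASmoothOn k U (F j) := fun j hj => hF j (Finset.mem_insert_of_mem hj)
    simp only [Finset.sum_insert ha]
    rw [bpartial_add h1.aDiffOn (ASmoothOn.sum hU h2).aDiffOn i hx]
    simp only [ih h2 hx]

/-- The coefficient of `∂/∂xᵢ` in the `i`-th b-coordinate vector field. -/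
noncomputable def bScale (k : ℕ) (i : Fin m) (u : Fin m → ℝ) : ℝ := if i.val < k then u i else 1

lemma bpartial_eq_fderiv {x : Fin m → ℝ} (hf : DifferentiableAt ℝ f x) (i : Fin m) :
    bpartial k i f x = bScale k i x * fderiv ℝ f x (Pi.single i 1) := by
  have h : HasDerivAt (fun t => f (Function.update x i t)) (fderiv ℝ f x (Pi.single i 1)) (x i) := by
    have h1 := hasDerivAt_update x i (x i)
    have h2 : HasFDerivAt f (fderiv ℝ f x) (Function.update x i (x i)) := by
      simpa using hf.hasFDerivAt
    exact h2.comp_hasDerivAt (x i) h1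
  rw [bpartial, bScale, h.deriv]
  split_ifs with h1 h2 <;> simp [*]

end Algebra

end ACorners

/-! ### Charts of a manifold with a-corners -/

namespace ACorners

section Charts

variable {m : ℕ} {X : Type*} [TopologicalSpace X]

namespace AChart

variable (c : AChart m X) {x : X} {u : Fin m → ℝ}

lemma coord_mem (hx : x ∈ c.source) : c.coord x ∈ c.target := c.map_source hx

lemma point_mem (hu : u ∈ c.target) : c.point u ∈ c.source := c.map_target hu

lemma point_coord (hx : x ∈ c.source) : c.point (c.coord x) = x := c.left_inv hx

lemma coord_point (hu : u ∈ c.target) : c.coord (c.point u) = u := c.right_inv hu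

lemma continuousOn_coord : ContinuousOn c.coord c.source := c.continuousOn_toFun

lemma continuousOn_point : ContinuousOn c.point c.target := c.continuousOn_invFun

lemma continuousAt_coord (hx : x ∈ c.source) : ContinuousAt c.coord x :=
  c.continuousOn_coord.continuousAt (c.open_source.mem_nhds hx)

lemma coord_nonneg (hx : x ∈ c.source) {i : Fin m} (hi : i.val < c.k) : 0 ≤ c.coord x i :=
  c.open_target.subset_quad (c.coord_mem hx) i hi

lemma isQuadOpen_inter {V : Set X} (hV : IsOpen V) :
    IsQuadOpen c.k (c.target ∩ c.point ⁻¹' V) := by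
  obtain ⟨O, hO, h⟩ := c.open_target
  obtain ⟨O', hO', h'⟩ := continuousOn_iff'.1 c.continuousOn_point V hV
  refine ⟨O' ∩ O, hO'.inter hO, ?_⟩
  rw [inter_comm, h', h, inter_assoc]

/-- The restriction of an a-chart to an open set. -/
def restr {V : Set X} (hV : IsOpen V) : AChart m X where
  toPartialEquiv := c.toPartialEquiv.restr V
  k := c.k
  k_le := c.k_le
  open_source := c.open_source.inter hV
  open_target := c.isQuadOpen_inter hV
  continuousOn_toFun := c.continuousOn_toFun.mono inter_subset_left
  continuousOn_invFun := c.continuousOn_invFun.mono inter_subset_left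

lemma tendsto_perturb (hx : x ∈ c.source) (v : Fin m → ℝ) (hv : ∀ i : Fin m, i.val < c.k → 0 ≤ v i) :
    (∀ᶠ t in 𝓝[>] (0 : ℝ), c.coord x + t • v ∈ c.target) ∧
      Tendsto (fun t : ℝ => c.point (c.coord x + t • v)) (𝓝[>] 0) (𝓝 x) := by
  have h0 : Tendsto (fun t : ℝ => c.coord x + t • v) (𝓝[>] 0) (𝓝 (c.coord x)) := by
    have : Continuous fun t : ℝ => c.coord x + t • v := by fun_prop
    simpa using (this.tendsto 0).mono_left nhdsWithin_le_nhds
  have h1 : ∀ᶠ t in 𝓝[>] (0 : ℝ), c.coord x + t • v ∈ c.target := by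
    obtain ⟨O, hO, h⟩ := c.open_target
    have hxO : c.coord x ∈ O := by have := c.coord_mem hx; rw [h] at this; exact this.1
    filter_upwards [h0.eventually (hO.mem_nhds hxO), self_mem_nhdsWithin] with t ht ht0
    rw [h]
    refine ⟨ht, fun i hi => ?_⟩
    exact add_nonneg (c.coord_nonneg hx hi) (mul_nonneg (le_of_lt ht0) (hv i hi))
  refine ⟨h1, ?_⟩
  have h2 := (c.continuousOn_point _ (c.coord_mem hx)).tendsto.comp
    (tendsto_nhdsWithin_iff.2 ⟨h0, h1⟩)
  rwa [c.point_coord hx] at h2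

/-- Near a point of an a-chart there are points at which prescribed boundary coordinates are
unchanged and all others are positive. -/
lemma exists_perturb (hx : x ∈ c.source) (s : Set (Fin m)) {N : Set X} (hN : N ∈ 𝓝 x) :
    ∃ y ∈ N, y ∈ c.source ∧ (∀ i ∈ s, c.coord y i = c.coord x i) ∧
      ∀ i ∉ s, i.val < c.k → 0 < c.coord y i := by
  classical
  let v : Fin m → ℝ := fun i => if i ∈ s then 0 else 1
  obtain ⟨h1, h2⟩ := c.tendsto_perturb hx v fun i _ => by by_cases h : i ∈ s <;> simp [v, h]
  obtain ⟨t, ⟨ht1, ht2⟩, ht0⟩ := ((h1.and (h2.eventually hN)).and self_mem_nhdsWithin).exists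
  refine ⟨_, ht2, c.point_mem ht1, fun i hi => ?_, fun i hi hk => ?_⟩
  · rw [c.coord_point ht1]; simp [v, hi]
  · rw [c.coord_point ht1]
    have := c.coord_nonneg hx hk
    have ht0' : 0 < t := ht0
    simp [v, hi]; linarith

end AChart

variable [AManifold m X] {c d : AChart m X} {x : X}

lemma AChart.restr_mem_charts (hc : c ∈ AManifold.charts (X := X)) {V : Set X} (hV : IsOpen V) :
    c.restr hV ∈ AManifold.charts (X := X) := by
  refine AManifold.maximal _ fun d hd => ?_
  obtain ⟨h1, h2⟩ := AManifold.compatible c hc d hd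
  exact ⟨h1.mono fun u hu => ⟨hu.1.1, hu.2⟩, h2.mono fun u hu => ⟨hu.1, hu.2.1⟩⟩

lemma AChart.exists_posAt (hc : c ∈ AManifold.charts (X := X)) (hx : x ∈ c.source) {N : Set X}
    (hN : N ∈ 𝓝 x) : ∃ y ∈ N, y ∈ aInterior X ∧ c.PosAt y := by
  obtain ⟨y, hyN, hy, -, h⟩ := c.exists_perturb hx ∅ hN
  have hp : c.PosAt y := ⟨hy, fun i hi => h i (by simp) hi⟩
  exact ⟨y, hyN, ⟨c, hc, hp⟩, hp⟩

variable (X) in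
lemma dense_aInterior : Dense (aInterior X) := fun x => by
  obtain ⟨c, hc, hx⟩ := AManifold.exists_chart x
  rw [mem_closure_iff_nhds]
  intro N hN
  obtain ⟨y, hyN, hy, -⟩ := AChart.exists_posAt hc hx hN
  exact ⟨y, hyN, hy⟩

instance (x : X) : (𝓝[aInterior X] x).NeBot := mem_closure_iff_nhdsWithin_neBot.1
  (dense_aInterior X x)

lemma isOpen_aInterior : IsOpen (aInterior X) := by
  have : aInterior X = ⋃ c ∈ AManifold.charts (X := X), {x | c.PosAt x} := by
    ext x; simp [aInterior]
  rw [this]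
  exact isOpen_biUnion fun c _ => c.isOpen_posAt

/-- Near a point of the overlap, each boundary coordinate of `d` is a positive a-smooth function
times a monomial in the boundary coordinates of `c`. -/
lemma AChart.boundary_coord_eq (hc : c ∈ AManifold.charts (X := X))
    (hd : d ∈ AManifold.charts (X := X)) (hxc : x ∈ c.source) (hxd : x ∈ d.source) {j : Fin m}
    (hj : j.val < d.k) :
    ∃ (V : Set X) (F : (Fin m → ℝ) → ℝ) (a : Fin m → ℝ), IsOpen V ∧ x ∈ V ∧ V ⊆ c.source ∧
      V ⊆ d.source ∧
      ASmoothOn c.k (c.target ∩ c.point ⁻¹' V) F ∧ (∀ u ∈ c.target ∩ c.point ⁻¹' V, 0 < F u) ∧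
      (∀ i, 0 ≤ a i) ∧ (∀ i, ¬ (i.val < c.k ∧ c.coord x i = 0) → a i = 0) ∧
      ∀ u ∈ c.target ∩ c.point ⁻¹' V, d.coord (c.point u) j = F u * ∏ i, u i ^ a i := by
  obtain ⟨W, hW, hxW, h⟩ := ((AManifold.compatible c hc d hd).1).boundary (c.coord x)
    ⟨c.coord_mem hxc, by rw [mem_preimage, c.point_coord hxc]; exact hxd⟩
  set V : Set X := (c.source ∩ c.coord ⁻¹' W) ∩ d.source
  have hV : IsOpen V := (c.continuousOn_coord.isOpen_inter_preimage c.open_source hW).inter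
    d.open_source
  have hxV : x ∈ V := ⟨⟨hxc, hxW⟩, hxd⟩
  have hsub : c.target ∩ c.point ⁻¹' V ⊆ (c.target ∩ c.point ⁻¹' d.source) ∩ W := by
    rintro u ⟨hu, ⟨-, hu2⟩, hu3⟩
    rw [mem_preimage, c.coord_point hu] at hu2
    exact ⟨⟨hu, hu3⟩, hu2⟩
  rcases h j hj with ⟨F, a, hF, hpos, ha, ha0, he⟩ | h0
  · exact ⟨V, F, a, hV, hxV, fun y hy => hy.1.1, fun y hy => hy.2, hF.mono hsub,
      fun u hu => hpos u (hsub hu), ha, ha0, fun u hu => he u (hsub hu)⟩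
  · exfalso
    obtain ⟨y, hyV, hy, hp⟩ := AChart.exists_posAt hd hxd (hV.mem_nhds hxV)
    have hyc : y ∈ c.source := hyV.1.1
    have h1 := h0 (c.coord y) (hsub ⟨c.coord_mem hyc, by
      rw [mem_preimage, c.point_coord hyc]; exact hyV⟩)
    rw [c.point_coord hyc] at h1
    exact (hp.2 j hj).ne' h1

lemma AChart.posAt_of_mem_aInterior (hd : d ∈ AManifold.charts (X := X)) (hx : x ∈ aInterior X)
    (hxd : x ∈ d.source) : d.PosAt x := by
  refine ⟨hxd, fun j hj => ?_⟩
  obtain ⟨c, hc, hxc, hpos⟩ := hx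
  obtain ⟨V, F, a, hV, hxV, -, -, -, hF, -, ha0, he⟩ := AChart.boundary_coord_eq hc hd hxc hxd hj
  have hu : c.coord x ∈ c.target ∩ c.point ⁻¹' V :=
    ⟨c.coord_mem hxc, by rw [mem_preimage, c.point_coord hxc]; exact hxV⟩
  have h := he _ hu
  rw [c.point_coord hxc] at h
  rw [h, Finset.prod_eq_one, mul_one]
  · exact hF _ hu
  · intro i _
    rw [ha0 i fun hi => (hpos i hi.1).ne' hi.2, Real.rpow_zero]

end Charts
end ACorners

/-! ### The transition functions of the b-tangent bundle -/

namespace ACorners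

section Monomials

variable {m k : ℕ} {v : Fin m → ℝ} {a : Fin m → ℝ}

lemma contDiffAt_monomial (hv : ∀ i : Fin m, i.val < k → 0 < v i)
    (ha : ∀ i : Fin m, ¬ i.val < k → a i = 0) :
    ContDiffAt ℝ ∞ (fun u : Fin m → ℝ => ∏ i, u i ^ a i) v := by
  refine contDiffAt_prod fun i _ => ?_
  by_cases hi : i.val < k
  · exact (contDiff_apply ℝ ℝ i).contDiffAt.rpow_const_of_ne (hv i hi).ne'
  · simp only [ha i hi, Real.rpow_zero]
    exact contDiffAt_const

lemma bpartial_monomial (hv : ∀ i : Fin m, i.val < k → 0 < v i)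
    (ha : ∀ i : Fin m, ¬ i.val < k → a i = 0) (i : Fin m) :
    bpartial k i (fun u : Fin m → ℝ => ∏ l, u l ^ a l) v = a i * ∏ l, v l ^ a l := by
  classical
  have hsplit : ∀ t, ∏ l, Function.update v i t l ^ a l =
      t ^ a i * ∏ l ∈ Finset.univ.erase i, v l ^ a l := fun t => by
    rw [← Finset.mul_prod_erase _ _ (Finset.mem_univ i), Function.update_self]
    congr 1
    exact Finset.prod_congr rfl fun l hl => by
      rw [Function.update_of_ne (Finset.ne_of_mem_erase hl)]
  have hsplit' : ∏ l, v l ^ a l = v i ^ a i * ∏ l ∈ Finset.univ.erase i, v l ^ a l := by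
    simpa using hsplit (v i)
  simp only [bpartial, hsplit]
  split_ifs with h1 h2
  · exact absurd h2 (hv i h1).ne'
  · have h := (Real.hasDerivAt_rpow_const (x := v i) (p := a i) (Or.inl h2)).mul_const
      (∏ l ∈ Finset.univ.erase i, v l ^ a l)
    rw [h.deriv, hsplit', Real.rpow_sub_one h2]
    field_simp
  · simp [ha i h1]

end Monomials

section Charts

variable {m : ℕ} {X : Type*} [TopologicalSpace X] [AManifold m X] {c d e : AChart m X} {x y : X}

namespace AChart

lemma bScale_ne_zero (hy : c.PosAt y) (i : Fin m) : bScale c.k i (c.coord y) ≠ 0 := by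
  rw [bScale]
  split_ifs with h
  · exact (hy.2 i h).ne'
  · exact one_ne_zero

lemma coord_mem_posTarget (hy : c.PosAt y) :
    c.coord y ∈ c.target ∩ {u | ∀ i : Fin m, i.val < c.k → 0 < u i} :=
  ⟨c.coord_mem hy.1, hy.2⟩

lemma isOpen_posTarget_inter {V : Set X} (hV : IsOpen V) :
    IsOpen ((c.target ∩ {u | ∀ i : Fin m, i.val < c.k → 0 < u i}) ∩ c.point ⁻¹' V) :=
  (c.continuousOn_point.mono inter_subset_left).isOpen_inter_preimage c.isOpen_posTarget hV

lemma contDiffAt_of_aSmoothOn {V : Set X} (hV : IsOpen V) (hy : c.PosAt y) (hyV : y ∈ V)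
    {f : (Fin m → ℝ) → ℝ} (hf : ASmoothOn c.k (c.target ∩ c.point ⁻¹' V) f) :
    ContDiffAt ℝ ∞ f (c.coord y) := by
  refine (hf.contDiffOn (c.isOpen_posTarget_inter hV) (fun u hu => ⟨hu.1.1, hu.2⟩)
    fun u hu i hi => (hu.1.2 i hi).ne').contDiffAt ((c.isOpen_posTarget_inter hV).mem_nhds ?_)
  exact ⟨coord_mem_posTarget hy, by rwa [mem_preimage, c.point_coord hy.1]⟩

lemma contDiffAt_transition (hc : c ∈ AManifold.charts (X := X))
    (hd : d ∈ AManifold.charts (X := X)) (hy : c.PosAt y) (hyd : y ∈ d.source) :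
    ContDiffAt ℝ ∞ (fun u => d.coord (c.point u)) (c.coord y) := by
  have hV := c.isOpen_posTarget_inter d.open_source
  refine ((AManifold.compatible c hc d hd).1.contDiffOn hV (fun u hu => ⟨hu.1.1, hu.2⟩)
    fun u hu i hi => (hu.1.2 i hi).ne').contDiffAt (hV.mem_nhds ?_)
  exact ⟨coord_mem_posTarget hy, by rwa [mem_preimage, c.point_coord hy.1]⟩

lemma tendsto_point (hy : c.PosAt y) : Tendsto c.point (𝓝 (c.coord y)) (𝓝 y) := by
  have h := (c.continuousOn_point.mono inter_subset_left).continuousAt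
    (c.isOpen_posTarget.mem_nhds (coord_mem_posTarget hy))
  rwa [ContinuousAt, c.point_coord hy.1] at h

lemma bJacobian_eq (c d : AChart m X) (y : X) (j i : Fin m) : c.bJacobian d j i y =
    (bScale d.k j (d.coord y))⁻¹ * bpartial c.k i (fun u => d.coord (c.point u) j) (c.coord y) := by
  rw [bJacobian, bScale]
  split_ifs <;> simp

/-- The chain rule for b-derivatives. -/
lemma bpartial_eq_sum_bJacobian (hc : c ∈ AManifold.charts (X := X))
    (hd : d ∈ AManifold.charts (X := X)) (hyc : c.PosAt y) (hyd : d.PosAt y) {f : X → ℝ}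
    (hf : DifferentiableAt ℝ (fun u => f (d.point u)) (d.coord y)) (i : Fin m) :
    bpartial c.k i (fun u => f (c.point u)) (c.coord y) =
      ∑ j, c.bJacobian d j i y * bpartial d.k j (fun u => f (d.point u)) (d.coord y) := by
  have hT : DifferentiableAt ℝ (fun u => d.coord (c.point u)) (c.coord y) :=
    (contDiffAt_transition hc hd hyc hyd.1).differentiableAt (by simp)
  have hf' : DifferentiableAt ℝ (fun u => f (d.point u)) (d.coord (c.point (c.coord y))) := by
    rwa [c.point_coord hyc.1]
  have hev : (fun u => f (c.point u)) =ᶠ[𝓝 (c.coord y)]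
      (fun u => f (d.point u)) ∘ fun u => d.coord (c.point u) := by
    filter_upwards [(tendsto_point hyc).eventually (d.open_source.mem_nhds hyd.1)] with u hu
    simp only [Function.comp_apply]
    rw [d.point_coord hu]
  have hcomp := hf'.hasFDerivAt.comp (c.coord y) hT.hasFDerivAt
  have hcf := hcomp.congr_of_eventuallyEq hev
  rw [bpartial_eq_fderiv hcf.differentiableAt, hcf.fderiv, ContinuousLinearMap.comp_apply,
    c.point_coord hyc.1]
  set w := fderiv ℝ (fun u => d.coord (c.point u)) (c.coord y) (Pi.single i 1) with hw
  have hwj : ∀ j, w j = fderiv ℝ (fun u => d.coord (c.point u) j) (c.coord y) (Pi.single i 1) := by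
    intro j
    rw [hw, fderiv_pi fun j => (differentiableAt_pi.1 hT) j]
    rfl
  have hsum := LinearMap.pi_apply_eq_sum_univ
    (fderiv ℝ (fun u => f (d.point u)) (d.coord y) : (Fin m → ℝ) →ₗ[ℝ] ℝ) w
  rw [ContinuousLinearMap.coe_coe] at hsum
  rw [hsum, Finset.mul_sum]
  refine Finset.sum_congr rfl fun j _ => ?_
  have hs : (fun l => if j = l then (1 : ℝ) else 0) = Pi.single j 1 := by
    ext l; simp [Pi.single_apply, eq_comm]
  rw [bJacobian_eq, bpartial_eq_fderiv (differentiableAt_pi.1 hT j), bpartial_eq_fderiv hf,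
    hwj, smul_eq_mul, hs]
  have := bScale_ne_zero hyd j
  field_simp

lemma bJacobian_comp (hc : c ∈ AManifold.charts (X := X))
    (hd : d ∈ AManifold.charts (X := X)) (he : e ∈ AManifold.charts (X := X)) (hyc : c.PosAt y)
    (hyd : d.PosAt y) (hye : e.PosAt y) (l i : Fin m) :
    c.bJacobian e l i y = ∑ j, d.bJacobian e l j y * c.bJacobian d j i y := by
  rw [bJacobian_eq, bpartial_eq_sum_bJacobian hc hd hyc hyd (f := fun z => e.coord z l)
    (differentiableAt_pi.1 ((contDiffAt_transition hd he hyd hye.1).differentiableAt (by simp)) l),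
    Finset.mul_sum]
  refine Finset.sum_congr rfl fun j _ => ?_
  rw [bJacobian_eq d e]
  ring

lemma bJacobian_self_of_eqOn (hk : d.k = c.k) (hyc : c.PosAt y)
    (h : d.coord = c.coord) (j i : Fin m) : c.bJacobian d j i y = if j = i then 1 else 0 := by
  have hev : (fun u => d.coord (c.point u) j) =ᶠ[𝓝 (c.coord y)] fun u => u j := by
    filter_upwards [c.isOpen_posTarget.mem_nhds (coord_mem_posTarget hyc)] with u hu
    rw [h, c.coord_point hu.1]
  have hd : HasFDerivAt (fun u : Fin m → ℝ => u j)
    (ContinuousLinearMap.proj (R := ℝ) (φ := fun _ : Fin m => ℝ) j) (c.coord y) :=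
    (ContinuousLinearMap.proj (R := ℝ) (φ := fun _ : Fin m => ℝ) j).hasFDerivAt
  have hd' := hd.congr_of_eventuallyEq hev
  have hne := bScale_ne_zero hyc j
  rw [bJacobian_eq, bpartial_eq_fderiv hd'.differentiableAt, hd'.fderiv, h, hk]
  by_cases hji : j = i
  · subst hji; simp [hne]
  · simp [hji]

lemma eventually_posAt (hd : d ∈ AManifold.charts (X := X)) (hx : x ∈ d.source) :
    ∀ᶠ y in 𝓝[aInterior X] x, d.PosAt y := by
  filter_upwards [self_mem_nhdsWithin,
    nhdsWithin_le_nhds (d.open_source.mem_nhds hx)] with y hy hyd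
  exact posAt_of_mem_aInterior hd hy hyd

lemma tendsto_bJacobian_of_boundary (hc : c ∈ AManifold.charts (X := X))
    (hd : d ∈ AManifold.charts (X := X)) {V : Set X} {F : (Fin m → ℝ) → ℝ} {a : Fin m → ℝ}
    (hV : IsOpen V) (hxV : x ∈ V) (hVc : V ⊆ c.source) (hVd : V ⊆ d.source)
    (hF : ASmoothOn c.k (c.target ∩ c.point ⁻¹' V) F)
    (hpos : ∀ u ∈ c.target ∩ c.point ⁻¹' V, 0 < F u)
    (ha' : ∀ i : Fin m, ¬ i.val < c.k → a i = 0) {j : Fin m} (hj : j.val < d.k)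
    (he : ∀ u ∈ c.target ∩ c.point ⁻¹' V, d.coord (c.point u) j = F u * ∏ i, u i ^ a i)
    (i : Fin m) :
    Tendsto (c.bJacobian d j i) (𝓝[aInterior X] x)
      (𝓝 ((F (c.coord x))⁻¹ * bpartial c.k i F (c.coord x) + a i)) := by
  have hmem : ∀ y ∈ V, c.coord y ∈ c.target ∩ c.point ⁻¹' V := fun y hy =>
    ⟨c.coord_mem (hVc hy), by rwa [mem_preimage, c.point_coord (hVc hy)]⟩
  have hcont : ContinuousAt (fun y => (F (c.coord y))⁻¹ * bpartial c.k i F (c.coord y) + a i) x := by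
    have h1 : ContinuousOn (fun u => (F u)⁻¹ * bpartial c.k i F u + a i)
        (c.target ∩ c.point ⁻¹' V) :=
      ((hF.continuousOn.inv₀ fun u hu => (hpos u hu).ne').mul (hF.bpartial i).continuousOn).add
        continuousOn_const
    exact (h1.comp (c.continuousOn_coord.mono hVc) hmem).continuousAt (hV.mem_nhds hxV)
  refine (hcont.tendsto.mono_left nhdsWithin_le_nhds).congr' ?_
  filter_upwards [self_mem_nhdsWithin, nhdsWithin_le_nhds (hV.mem_nhds hxV)] with y hy hyV
  have hyc := posAt_of_mem_aInterior hc hy (hVc hyV)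
  have hyd := posAt_of_mem_aInterior hd hy (hVd hyV)
  have hM := contDiffAt_monomial hyc.2 ha'
  have hFd : DifferentiableAt ℝ F (c.coord y) :=
    (contDiffAt_of_aSmoothOn hV hyc hyV hF).differentiableAt (by simp)
  have hMd := hM.differentiableAt (by simp)
  have hev : (fun u => d.coord (c.point u) j) =ᶠ[𝓝 (c.coord y)]
      fun u => F u * ∏ i, u i ^ a i := by
    filter_upwards [(c.isOpen_posTarget_inter hV).mem_nhds
      ⟨coord_mem_posTarget hyc, (hmem y hyV).2⟩] with u hu using he u ⟨hu.1.1, hu.2⟩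
  have hb := bpartial_monomial hyc.2 ha' i
  rw [bpartial_eq_fderiv hMd] at hb
  have hD := (hFd.hasFDerivAt.mul hMd.hasFDerivAt).congr_of_eventuallyEq hev
  rw [bJacobian_eq, bpartial_eq_fderiv hD.differentiableAt, hD.fderiv,
    bpartial_eq_fderiv hFd]
  have hval := he _ (hmem y hyV)
  rw [c.point_coord (hVc hyV)] at hval
  have hMne : ∏ i, c.coord y i ^ a i ≠ 0 := by
    intro h0
    rw [h0, mul_zero] at hval
    exact (hyd.2 j hj).ne' hval
  have hFne := (hpos _ (hmem y hyV)).ne'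
  have hsj : bScale d.k j (d.coord y) = d.coord y j := if_pos hj
  rw [hsj, hval]
  simp only [add_apply, smul_apply, smul_eq_mul]
  field_simp
  linear_combination (-F (c.coord y)) * hb

lemma tendsto_bJacobian_of_interior (hc : c ∈ AManifold.charts (X := X))
    (hd : d ∈ AManifold.charts (X := X)) (hxc : x ∈ c.source) (hxd : x ∈ d.source) {j : Fin m}
    (hj : d.k ≤ j.val) (i : Fin m) :
    Tendsto (c.bJacobian d j i) (𝓝[aInterior X] x)
      (𝓝 (bpartial c.k i (fun u => d.coord (c.point u) j) (c.coord x))) := by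
  have h1 := (((AManifold.compatible c hc d hd).1.aSmoothOn j hj).bpartial i).continuousOn
  have h2 : ContinuousAt
      (fun y => bpartial c.k i (fun u => d.coord (c.point u) j) (c.coord y)) x := by
    refine (h1.comp (s := c.source ∩ d.source) (c.continuousOn_coord.mono inter_subset_left)
      fun y hy => ⟨c.coord_mem hy.1, ?_⟩).continuousAt
        ((c.open_source.inter d.open_source).mem_nhds ⟨hxc, hxd⟩)
    rw [mem_preimage, c.point_coord hy.1]
    exact hy.2
  refine (h2.tendsto.mono_left nhdsWithin_le_nhds).congr fun y => ?_
  rw [bJacobian, if_neg (not_lt.2 hj), one_mul]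

lemma tendsto_bJacobian (hc : c ∈ AManifold.charts (X := X))
    (hd : d ∈ AManifold.charts (X := X)) (hxc : x ∈ c.source) (hxd : x ∈ d.source) (j i : Fin m) :
    Tendsto (c.bJacobian d j i) (𝓝[aInterior X] x) (𝓝 (c.bTransition d x j i)) := by
  refine tendsto_nhds_limUnder ?_
  by_cases hj : j.val < d.k
  · obtain ⟨V, F, a, hV, hxV, hVc, hVd, hF, hpos, -, ha, he⟩ := boundary_coord_eq hc hd hxc hxd hj
    exact ⟨_, tendsto_bJacobian_of_boundary hc hd hV hxV hVc hVd hF hpos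
      (fun i hi => ha i fun h => hi h.1) hj he i⟩
  · exact ⟨_, tendsto_bJacobian_of_interior hc hd hxc hxd (not_lt.1 hj) i⟩

lemma continuousOn_bTransition (hc : c ∈ AManifold.charts (X := X))
    (hd : d ∈ AManifold.charts (X := X)) (j i : Fin m) :
    ContinuousOn (fun x => c.bTransition d x j i) (c.source ∩ d.source) :=
  continuousOn_extendFrom (fun x _ => dense_aInterior X x)
    fun _ hx => ⟨_, tendsto_bJacobian hc hd hx.1 hx.2 j i⟩

lemma bTransition_eq_of_interior (hc : c ∈ AManifold.charts (X := X))
    (hd : d ∈ AManifold.charts (X := X)) (hy : y ∈ aInterior X) (hyc : y ∈ c.source)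
    (hyd : y ∈ d.source) (j i : Fin m) : c.bTransition d y j i = c.bJacobian d j i y := by
  have hpos := posAt_of_mem_aInterior hc hy hyc
  have hposd := posAt_of_mem_aInterior hd hy hyd
  refine tendsto_nhds_unique (tendsto_bJacobian hc hd hyc hyd j i) ?_
  have hT := contDiffAt_transition hc hd hpos hyd
  have hTj : ContDiffAt ℝ ∞ (fun u => d.coord (c.point u) j) (c.coord y) := contDiffAt_pi.1 hT j
  have h1 : ContinuousAt (fun u => fderiv ℝ (fun u => d.coord (c.point u) j) u (Pi.single i 1))
      (c.coord y) :=
    ((hTj.fderiv_right (m := 0) (by simp)).continuousAt).clm_apply continuousAt_const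
  have hcc := c.continuousAt_coord hyc
  have hdc := d.continuousAt_coord hyd
  have hs : ∀ (k : ℕ) (i : Fin m), Continuous (bScale k i) := fun k i => by
    unfold bScale; split_ifs
    · exact continuous_apply i
    · exact continuous_const
  have h2 : ContinuousAt (fun z => (bScale d.k j (d.coord z))⁻¹ * (bScale c.k i (c.coord z) *
      fderiv ℝ (fun u => d.coord (c.point u) j) (c.coord z) (Pi.single i 1))) y :=
    (((hs d.k j).continuousAt.comp hdc).inv₀ (bScale_ne_zero hposd j)).mul
      (((hs c.k i).continuousAt.comp hcc).mul (ContinuousAt.comp (x := y) h1 hcc))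
  have hJ : ∀ z, c.PosAt z → d.PosAt z → c.bJacobian d j i z =
      (bScale d.k j (d.coord z))⁻¹ * (bScale c.k i (c.coord z) *
      fderiv ℝ (fun u => d.coord (c.point u) j) (c.coord z) (Pi.single i 1)) := fun z hzc hzd => by
    rw [bJacobian_eq, bpartial_eq_fderiv]
    exact differentiableAt_pi.1 ((contDiffAt_transition hc hd hzc hzd.1).differentiableAt (by simp)) j
  rw [hJ y hpos hposd]
  refine (h2.tendsto.mono_left nhdsWithin_le_nhds).congr' ?_
  filter_upwards [eventually_posAt hc hyc, eventually_posAt hd hyd] with z h1 h2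
  rw [hJ z h1 h2]

lemma bTransition_comp (hc : c ∈ AManifold.charts (X := X))
    (hd : d ∈ AManifold.charts (X := X)) (he : e ∈ AManifold.charts (X := X)) (hxc : x ∈ c.source)
    (hxd : x ∈ d.source) (hxe : x ∈ e.source) (l i : Fin m) :
    c.bTransition e x l i = ∑ j, d.bTransition e x l j * c.bTransition d x j i := by
  refine tendsto_nhds_unique (tendsto_bJacobian hc he hxc hxe l i) ?_
  refine (tendsto_finsetSum _ fun j _ => (tendsto_bJacobian hd he hxd hxe l j).mul
    (tendsto_bJacobian hc hd hxc hxd j i)).congr' ?_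
  filter_upwards [eventually_posAt hc hxc, eventually_posAt hd hxd, eventually_posAt he hxe]
    with y h1 h2 h3
  rw [bJacobian_comp hc hd he h1 h2 h3]

lemma bTransition_of_coord_eq (hc : c ∈ AManifold.charts (X := X))
    (hd : d ∈ AManifold.charts (X := X)) (hxc : x ∈ c.source) (hxd : x ∈ d.source)
    (hk : d.k = c.k) (h : d.coord = c.coord) (j i : Fin m) :
    c.bTransition d x j i = if j = i then 1 else 0 := by
  refine tendsto_nhds_unique (tendsto_bJacobian hc hd hxc hxd j i) ?_
  refine tendsto_const_nhds.congr' ?_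
  filter_upwards [eventually_posAt hc hxc] with y h1
  rw [bJacobian_self_of_eqOn hk h1 h]

lemma bTransition_self (hc : c ∈ AManifold.charts (X := X)) (hxc : x ∈ c.source) (j i : Fin m) :
    c.bTransition c x j i = if j = i then 1 else 0 :=
  bTransition_of_coord_eq hc hc hxc hxc rfl rfl j i

end AChart

lemma bComp_eq_sum (hc : c ∈ AManifold.charts (X := X)) (hd : d ∈ AManifold.charts (X := X))
    (hxc : x ∈ c.source) (hxd : x ∈ d.source) (v : BTangent x) (j : Fin m) :
    bComp x d v j = ∑ i, c.bTransition d x j i * bComp x c v i :=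
  v.2.2 c hc d hd hxc hxd j

lemma bComp_injective (hc : c ∈ AManifold.charts (X := X)) (hxc : x ∈ c.source) :
    Function.Injective (bComp x c) := by
  rw [injective_iff_map_eq_zero]
  intro v hv
  ext d j
  by_cases h : d ∈ AManifold.charts (X := X) ∧ x ∈ d.source
  · have := bComp_eq_sum hc h.1 hxc h.2 v j
    rw [hv] at this
    exact this.trans (by simp)
  · rw [v.2.1 d h]; rfl

lemma bComp_surjective (hc : c ∈ AManifold.charts (X := X)) (hxc : x ∈ c.source) :
    Function.Surjective (bComp x c) := by
  classical
  intro w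
  refine ⟨⟨fun d j => if d ∈ AManifold.charts (X := X) ∧ x ∈ d.source then
    ∑ i, c.bTransition d x j i * w i else 0, fun d hd => ?_, fun d hd e he hxd hxe l => ?_⟩, ?_⟩
  · ext j; exact if_neg hd
  · simp only [if_pos (And.intro hd hxd), if_pos (And.intro he hxe), Finset.mul_sum,
      AChart.bTransition_comp hc hd he hxc hxd hxe l, Finset.sum_mul]
    rw [Finset.sum_comm]
    simp only [mul_assoc]
  · ext j
    change (if c ∈ AManifold.charts (X := X) ∧ x ∈ c.source then
      ∑ i, c.bTransition c x j i * w i else 0) = w j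
    rw [if_pos ⟨hc, hxc⟩]
    simp [AChart.bTransition_self hc hxc]

/-- The components in the b-frame of an a-chart identify the b-tangent space with `ℝᵐ`. -/
noncomputable def bCompEquiv (hc : c ∈ AManifold.charts (X := X)) (hxc : x ∈ c.source) :
    BTangent x ≃ₗ[ℝ] (Fin m → ℝ) :=
  LinearEquiv.ofBijective (bComp x c) ⟨bComp_injective hc hxc, bComp_surjective hc hxc⟩

@[simp] lemma bCompEquiv_apply (hc : c ∈ AManifold.charts (X := X)) (hxc : x ∈ c.source)
    (v : BTangent x) : bCompEquiv hc hxc v = bComp x c v := rfl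

lemma AChart.bDeriv_apply (c : AChart m X) (f : X → ℝ) (x : X) (w : BTangent x) :
    c.bDeriv f x w =
      ∑ i, bpartial c.k i (fun u => f (c.point u)) (c.coord x) * bComp x c w i := by
  simp [bDeriv]

end Charts
end ACorners

/-! ### Boundary faces and weights -/

namespace ACorners

section Faces

variable {m : ℕ} {X : Type*} [TopologicalSpace X] [AManifold m X] {c d e : AChart m X} {x y : X}
  {i j : Fin m}

namespace AChart

/-- On the open set `V`, the boundary coordinate `x̃ⱼ` of `d` is a positive a-smooth function `F`
times the monomial with exponents `a` in the coordinates of `c`. -/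
structure MonomialOn (c d : AChart m X) (j : Fin m) (V : Set X) (F : (Fin m → ℝ) → ℝ)
    (a : Fin m → ℝ) : Prop where
  isOpen : IsOpen V
  subset_left : V ⊆ c.source
  subset_right : V ⊆ d.source
  aSmoothOn : ASmoothOn c.k (c.target ∩ c.point ⁻¹' V) F
  pos : ∀ u ∈ c.target ∩ c.point ⁻¹' V, 0 < F u
  exponent_eq_zero : ∀ i : Fin m, ¬ i.val < c.k → a i = 0
  coord_eq : ∀ u ∈ c.target ∩ c.point ⁻¹' V, d.coord (c.point u) j = F u * ∏ i, u i ^ a i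

lemma MonomialOn.mono {V V' : Set X} {F : (Fin m → ℝ) → ℝ} {a : Fin m → ℝ}
    (h : MonomialOn c d j V F a) (hV' : IsOpen V') (hs : V' ⊆ V) : MonomialOn c d j V' F a :=
  have hs' : c.target ∩ c.point ⁻¹' V' ⊆ c.target ∩ c.point ⁻¹' V := fun _ hu => ⟨hu.1, hs hu.2⟩
  ⟨hV', hs.trans h.subset_left, hs.trans h.subset_right, h.aSmoothOn.mono hs',
    fun u hu => h.pos u (hs' hu), h.exponent_eq_zero, fun u hu => h.coord_eq u (hs' hu)⟩

section

variable {V : Set X} {F : (Fin m → ℝ) → ℝ} {a : Fin m → ℝ} (h : MonomialOn c d j V F a)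

include h

lemma MonomialOn.coord_mem (hy : y ∈ V) : c.coord y ∈ c.target ∩ c.point ⁻¹' V :=
  ⟨c.coord_mem (h.subset_left hy), by rwa [mem_preimage, c.point_coord (h.subset_left hy)]⟩

lemma MonomialOn.pos' (hy : y ∈ V) : 0 < F (c.coord y) := h.pos _ (h.coord_mem hy)

lemma MonomialOn.coord_eq' (hy : y ∈ V) :
    d.coord y j = F (c.coord y) * ∏ i, c.coord y i ^ a i := by
  have := h.coord_eq _ (h.coord_mem hy)
  rwa [c.point_coord (h.subset_left hy)] at this

lemma MonomialOn.continuousAt (hy : y ∈ V) : ContinuousAt (fun z => F (c.coord z)) y :=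
  (h.aSmoothOn.continuousOn.comp (c.continuousOn_coord.mono h.subset_left)
    fun _ hz => h.coord_mem hz).continuousAt (h.isOpen.mem_nhds hy)

lemma MonomialOn.bTransition_eq (hc : c ∈ AManifold.charts (X := X))
    (hd : d ∈ AManifold.charts (X := X)) (hj : j.val < d.k) (hx : x ∈ V) (hi : i.val < c.k)
    (h0 : c.coord x i = 0) : c.bTransition d x j i = a i := by
  refine tendsto_nhds_unique
    (tendsto_bJacobian hc hd (h.subset_left hx) (h.subset_right hx) j i) ?_
  have := tendsto_bJacobian_of_boundary hc hd h.isOpen hx h.subset_left h.subset_right h.aSmoothOn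
    h.pos h.exponent_eq_zero hj h.coord_eq i
  simpa [bpartial, hi, h0] using this

end

lemma exists_monomialOn (hc : c ∈ AManifold.charts (X := X))
    (hd : d ∈ AManifold.charts (X := X)) (hxc : x ∈ c.source) (hxd : x ∈ d.source) :
    ∃ (V : Set X) (F : Fin m → (Fin m → ℝ) → ℝ) (a : Fin m → Fin m → ℝ), IsOpen V ∧ x ∈ V ∧
      V ⊆ c.source ∧ V ⊆ d.source ∧ ∀ j : Fin m, j.val < d.k → MonomialOn c d j V (F j) (a j) := by
  have key : ∀ j : Fin m, ∃ (V : Set X) (F : (Fin m → ℝ) → ℝ) (a : Fin m → ℝ), IsOpen V ∧ x ∈ V ∧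
      (j.val < d.k → MonomialOn c d j V F a) := fun j => by
    by_cases hj : j.val < d.k
    · obtain ⟨V, F, a, hV, hxV, hVc, hVd, hF, hpos, -, ha, he⟩ := boundary_coord_eq hc hd hxc hxd hj
      exact ⟨V, F, a, hV, hxV, fun _ => ⟨hV, hVc, hVd, hF, hpos,
        fun i hi => ha i fun h => hi h.1, he⟩⟩
    · exact ⟨univ, 0, 0, isOpen_univ, mem_univ _, fun h => absurd h hj⟩
  choose V F a hV hxV hM using key
  have hO : IsOpen ((c.source ∩ d.source) ∩ ⋂ j, V j) :=
    (c.open_source.inter d.open_source).inter (isOpen_iInter_of_finite hV)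
  exact ⟨(c.source ∩ d.source) ∩ ⋂ j, V j, F, a, hO, ⟨⟨hxc, hxd⟩, mem_iInter.2 hxV⟩,
    fun _ hy => hy.1.1, fun _ hy => hy.1.2,
    fun j hj => (hM j hj).mono hO fun _ hy => mem_iInter.1 hy.2 j⟩

/-- The boundary face `{xᵢ = 0}` of the a-chart `c` is the only one which contains `y`. -/
structure OnlyFace (c : AChart m X) (i : Fin m) (y : X) : Prop where
  lt : i.val < c.k
  mem : y ∈ c.source
  eq_zero : c.coord y i = 0
  pos : ∀ l : Fin m, l.val < c.k → l ≠ i → 0 < c.coord y l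

lemma exists_onlyFace (hx : x ∈ c.source) (hi : i.val < c.k) (h0 : c.coord x i = 0) {N : Set X}
    (hN : N ∈ 𝓝 x) : ∃ y ∈ N, c.OnlyFace i y := by
  obtain ⟨y, hyN, hy, hyi, hpos⟩ := c.exists_perturb hx {i} hN
  exact ⟨y, hyN, hi, hy, (hyi i rfl).trans h0, fun l hl hli => hpos l hli hl⟩

lemma OnlyFace.notMem_aInterior (hc : c ∈ AManifold.charts (X := X)) (h : c.OnlyFace i y) :
    y ∉ aInterior X := fun hy =>
  ((posAt_of_mem_aInterior hc hy h.mem).2 i h.lt).ne' h.eq_zero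

lemma OnlyFace.eventually (hc : c ∈ AManifold.charts (X := X)) (h : c.OnlyFace i y) :
    ∀ᶠ z in 𝓝 y, z ∉ aInterior X → c.OnlyFace i z := by
  have hcont := c.continuousAt_coord h.mem
  have hev : ∀ᶠ z in 𝓝 y, ∀ l : Fin m, l.val < c.k → l ≠ i → 0 < c.coord z l :=
    eventually_all.2 fun l => by
      by_cases hl : l.val < c.k ∧ l ≠ i
      · filter_upwards [(continuousAt_pi.1 hcont l).eventually (lt_mem_nhds (h.pos l hl.1 hl.2))]
          with z hz _ _ using hz
      · exact Eventually.of_forall fun z h1 h2 => absurd ⟨h1, h2⟩ hl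
  filter_upwards [hev, c.open_source.mem_nhds h.mem] with z hz hzc hzi
  refine ⟨h.lt, hzc, ?_, hz⟩
  by_contra h0
  refine hzi ⟨c, hc, hzc, fun l hl => ?_⟩
  by_cases hli : l = i
  · subst hli
    exact lt_of_le_of_ne (c.coord_nonneg hzc hl) (Ne.symm h0)
  · exact hz l hl hli

lemma OnlyFace.faceGerm_eq (hc : c ∈ AManifold.charts (X := X)) (h : c.OnlyFace i y) :
    c.faceGerm i y = 𝓝[(aInterior X)ᶜ] y := by
  refine nhdsWithin_eq_iff_eventuallyEq.2 ?_
  filter_upwards [h.eventually hc] with z hz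
  refine propext ⟨fun hzc hzi => ?_, fun hzi => ⟨(hz hzi).mem, (hz hzi).eq_zero⟩⟩
  exact ((posAt_of_mem_aInterior hc hzi hzc.1).2 i h.lt).ne' hzc.2

lemma OnlyFace.coord_eq_zero_iff (h : c.OnlyFace i y) {V : Set X} {F : (Fin m → ℝ) → ℝ}
    {a : Fin m → ℝ} (hM : MonomialOn c d j V F a) (hy : y ∈ V) :
    d.coord y j = 0 ↔ a i ≠ 0 := by
  rw [hM.coord_eq' hy, mul_eq_zero, or_iff_right (hM.pos' hy).ne', Finset.prod_eq_zero_iff]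
  constructor
  · rintro ⟨l, -, hl⟩
    by_cases hlk : l.val < c.k
    · rw [Real.rpow_eq_zero_iff_of_nonneg (c.coord_nonneg h.mem hlk)] at hl
      by_cases hli : l = i
      · subst hli; exact hl.2
      · exact absurd hl.1 (h.pos l hlk hli).ne'
    · rw [hM.exponent_eq_zero l hlk, Real.rpow_zero] at hl
      exact absurd hl one_ne_zero
  · intro ha
    exact ⟨i, Finset.mem_univ i, by rw [h.eq_zero, Real.zero_rpow ha]⟩

lemma OnlyFace.exists_onlyFace (hc : c ∈ AManifold.charts (X := X))
    (hd : d ∈ AManifold.charts (X := X)) (h : c.OnlyFace i y) (hyd : y ∈ d.source) :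
    ∃ j, d.OnlyFace j y := by
  obtain ⟨j, hj, hj0⟩ : ∃ j : Fin m, j.val < d.k ∧ d.coord y j = 0 := by
    by_contra! hne
    exact h.notMem_aInterior hc ⟨d, hd, hyd, fun l hl =>
      lt_of_le_of_ne (d.coord_nonneg hyd hl) (hne l hl).symm⟩
  refine ⟨j, hj, hyd, hj0, fun l hl hlj => lt_of_le_of_ne (d.coord_nonneg hyd hl) fun hl0 => ?_⟩
  obtain ⟨V, F, a, hV, hyV, -, -, hM⟩ := exists_monomialOn hc hd h.mem hyd
  have ha := (h.coord_eq_zero_iff (hM l hl) hyV).1 hl0.symm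
  obtain ⟨z, ⟨hzV, hz⟩, hzd, hzj, hzpos⟩ :=
    d.exists_perturb hyd {j} (Filter.inter_mem (hV.mem_nhds hyV) (h.eventually hc))
  have hzi : z ∉ aInterior X := fun hzi =>
    ((posAt_of_mem_aInterior hd hzi hzd).2 j hj).ne' ((hzj j rfl).trans hj0)
  exact (hzpos l hlj hl).ne' (((hz hzi).coord_eq_zero_iff (hM l hl) hzV).2 ha)

lemma OnlyFace.bTransition_eq_zero (hc : c ∈ AManifold.charts (X := X))
    (hd : d ∈ AManifold.charts (X := X)) (h : c.OnlyFace i y) (h' : d.OnlyFace j y) {l : Fin m}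
    (hl : l ≠ j) : c.bTransition d y l i = 0 := by
  by_cases hlk : l.val < d.k
  · obtain ⟨V, F, a, hV, hyV, -, -, hM⟩ := exists_monomialOn hc hd h.mem h'.mem
    rw [(hM l hlk).bTransition_eq hc hd hlk hyV h.lt h.eq_zero]
    by_contra hne
    exact (h'.pos l hlk hl).ne' ((h.coord_eq_zero_iff (hM l hlk) hyV).2 hne)
  · refine tendsto_nhds_unique (tendsto_bJacobian hc hd h.mem h'.mem l i) ?_
    have := tendsto_bJacobian_of_interior hc hd h.mem h'.mem (not_lt.1 hlk) i
    simpa [bpartial, h.lt, h.eq_zero] using this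

/-- The boundary point of `X` given by a point on the face `{xᵢ = 0}` of an a-chart. -/
def facePoint (hc : c ∈ AManifold.charts (X := X)) (hi : i.val < c.k) (hx : x ∈ c.source)
    (h0 : c.coord x i = 0) : Boundary X :=
  ⟨x, c.faceGerm i x, c, hc, i, hi, hx, h0, rfl⟩

lemma onFace_facePoint (hc : c ∈ AManifold.charts (X := X)) (hi : i.val < c.k) (hx : x ∈ c.source)
    (h0 : c.coord x i = 0) : c.OnFace i (facePoint hc hi hx h0) :=
  ⟨hi, hx, h0, rfl⟩

lemma onFace_restr_iff {V : Set X} (hV : IsOpen V) (p : Boundary X) :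
    (c.restr hV).OnFace i p ↔ p.pt ∈ V ∧ c.OnFace i p := by
  have hg : p.pt ∈ V → (c.restr hV).faceGerm i p.pt = c.faceGerm i p.pt := fun hp => by
    refine nhdsWithin_eq_iff_eventuallyEq.2 ?_
    filter_upwards [hV.mem_nhds hp] with z hz
    exact propext ⟨fun h => ⟨h.1.1, h.2⟩, fun h => ⟨⟨h.1, hz⟩, h.2⟩⟩
  constructor
  · rintro ⟨h1, h2, h3, h4⟩
    exact ⟨h2.2, h1, h2.1, h3, h4.trans (hg h2.2)⟩
  · rintro ⟨hp, h1, h2, h3, h4⟩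
    exact ⟨h1, ⟨h2, hp⟩, h3, h4.trans (hg hp).symm⟩

end AChart

lemma bComp_eq_of_coord_eq (hc : c ∈ AManifold.charts (X := X))
    (hd : d ∈ AManifold.charts (X := X)) (hxc : x ∈ c.source) (hxd : x ∈ d.source)
    (hk : d.k = c.k) (h : d.coord = c.coord) (v : BTangent x) : bComp x d v = bComp x c v := by
  ext j
  rw [bComp_eq_sum hc hd hxc hxd]
  simp [AChart.bTransition_of_coord_eq hc hd hxc hxd hk h]

variable {wt : Weight X}

namespace WeightChart

lemma exponent_eq_zero_of_le (W : WeightChart wt) (hi : ¬ i.val < W.chart.k) :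
    W.exponent i = 0 :=
  W.exponent_eq_zero i fun ⟨_, hp⟩ => hi hp.1

variable (wt) in
/-- Every a-chart restricts to a weight chart near each of its points. -/
lemma exists_restr (hc : c ∈ AManifold.charts (X := X)) (hx : x ∈ c.source) :
    ∃ (W : WeightChart wt), x ∈ W.chart.source ∧ W.chart.source ⊆ c.source ∧ W.chart.k = c.k ∧
      W.chart.coord = c.coord ∧ W.chart.point = c.point := by
  classical
  choose a N hN ha using fun i => wt.locally_constant c hc i x hx
  have hI : (⋂ i, interior (N i)) ∈ 𝓝 x := by
    rw [iInter_mem]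
    exact fun i => interior_mem_nhds.2 (hN i)
  have hV : IsOpen (⋂ i, interior (N i)) := isOpen_iInter_of_finite fun i => isOpen_interior
  have hr := AChart.restr_mem_charts hc hV
  refine ⟨⟨c.restr hV, hr, fun i => if ∃ p : Boundary X, (c.restr hV).OnFace i p then a i else 0,
    fun i p hp v => ?_, fun i h => if_neg h⟩, ⟨hx, mem_of_mem_nhds hI⟩, inter_subset_left, rfl,
    rfl, rfl⟩
  have hp' := (AChart.onFace_restr_iff hV p).1 hp
  rw [if_pos ⟨p, hp⟩, ha i p (interior_subset (mem_iInter.1 hp'.1 i)) hp'.2,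
    bComp_eq_of_coord_eq hc hr hp'.2.2.1 hp.2.1 rfl rfl]

lemma exponent_eq_of_onlyFace {W W' : WeightChart wt} (h : W.chart.OnlyFace i y)
    (h' : W'.chart.OnlyFace j y) {V : Set X} {F : (Fin m → ℝ) → ℝ} {a : Fin m → ℝ}
    (hM : AChart.MonomialOn W.chart W'.chart j V F a) (hy : y ∈ V) :
    W.exponent i = a i * W'.exponent j := by
  have hc := W.mem_charts
  have hd := W'.mem_charts
  set p : Boundary X := AChart.facePoint hc h.lt h.mem h.eq_zero
  have hp : W.chart.OnFace i p := AChart.onFace_facePoint hc h.lt h.mem h.eq_zero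
  have hp' : W'.chart.OnFace j p :=
    ⟨h'.lt, h'.mem, h'.eq_zero, (h.faceGerm_eq hc).trans (h'.faceGerm_eq hd).symm⟩
  obtain ⟨v, hv⟩ := bComp_surjective hc h.mem (Pi.single i 1)
  have hve : ∀ e ∈ AManifold.charts (X := X), y ∈ e.source → ∀ l,
      bComp y e v l = W.chart.bTransition e y l i := fun e he hye l => by
    rw [bComp_eq_sum hc he h.mem hye, hv]
    simp [Pi.single_apply]
  have hvN : v ∈ BNormal p := fun e he l hl r hr => by
    obtain ⟨l', hl'⟩ := h.exists_onlyFace hc he hl.2.1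
    obtain rfl : l = l' := by
      by_contra hne
      exact (hl'.pos l hl.1 hne).ne' hl.2.2.1
    refine (hve e he hl.2.1 r).trans (h.bTransition_eq_zero hc he hl' hr)
  have h1 := W.weight_eq i p hp ⟨v, hvN⟩
  rw [W'.weight_eq j p hp' ⟨v, hvN⟩] at h1
  have h2 : bComp y W.chart v i = 1 := by rw [hv]; simp
  have h3 : bComp y W'.chart v j = a i := by
    rw [hve _ hd h'.mem, hM.bTransition_eq hc hd h'.lt hy h.lt h.eq_zero]
  change W'.exponent j * bComp y W'.chart v j = W.exponent i * bComp y W.chart v i at h1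
  rw [h2, h3] at h1
  linarith

lemma exponent_eq_sum (W W' : WeightChart wt) {V : Set X} {F : Fin m → (Fin m → ℝ) → ℝ}
    {a : Fin m → Fin m → ℝ} (hV : IsOpen V) (hxV : x ∈ V) (hx : x ∈ W.chart.source)
    (hx' : V ⊆ W'.chart.source)
    (hM : ∀ j : Fin m, j.val < W'.chart.k →
      AChart.MonomialOn W.chart W'.chart j V (F j) (a j))
    (hi : i.val < W.chart.k) (h0 : W.chart.coord x i = 0) :
    W.exponent i = ∑ j, a j i * W'.exponent j := by
  obtain ⟨y, hyV, hy⟩ := AChart.exists_onlyFace hx hi h0 (hV.mem_nhds hxV)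
  obtain ⟨j, hj⟩ := hy.exists_onlyFace W.mem_charts W'.mem_charts (hx' hyV)
  rw [exponent_eq_of_onlyFace hy hj (hM j hj.lt) hyV, Finset.sum_eq_single j]
  · intro l _ hl
    by_cases hlk : l.val < W'.chart.k
    · have : a l i = 0 := by
        by_contra hne
        exact (hj.pos l hlk hl).ne' ((hy.coord_eq_zero_iff (hM l hlk) hyV).2 hne)
      rw [this, zero_mul]
    · rw [W'.exponent_eq_zero_of_le hlk, mul_zero]
  · simp

end WeightChart

end Faces

/-! ### The line bundle of a weight -/

section Line

variable {m : ℕ} {X : Type*} [TopologicalSpace X] [AManifold m X] {x y : X} {wt : Weight X}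

namespace LineTriv

lemma frame_pos {P : LineTriv wt} (hy : y ∈ aInterior X) (hP : y ∈ domain P) : 0 < frame P y := by
  cases P with
  | none => exact one_pos
  | some W =>
    refine Finset.prod_pos fun i _ => ?_
    by_cases hi : i.val < W.chart.k
    · exact Real.rpow_pos_of_pos ((AChart.posAt_of_mem_aInterior W.mem_charts hy hP).2 i hi) _
    · rw [W.exponent_eq_zero_of_le hi, Real.rpow_zero]; exact one_pos

lemma continuousAt_frame {P : LineTriv wt} (hy : y ∈ aInterior X) (hP : y ∈ domain P) :
    ContinuousAt (frame P) y := by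
  cases P with
  | none => exact continuousAt_const
  | some W =>
    have hpos := AChart.posAt_of_mem_aInterior W.mem_charts hy hP
    exact ContinuousAt.comp (x := y)
      (g := fun u : Fin m → ℝ => ∏ i, u i ^ W.exponent i) (contDiffAt_monomial hpos.2
      fun i hi => W.exponent_eq_zero_of_le hi).continuousAt (W.chart.continuousAt_coord hP)

lemma isOpen_domain (P : LineTriv wt) : IsOpen (domain P) := by
  cases P with
  | none => exact isOpen_aInterior
  | some W => exact W.chart.open_source

lemma exists_tendsto_frame_div_some {W W' : WeightChart wt} (hW : x ∈ W.chart.source)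
    (hW' : x ∈ W'.chart.source) : ∃ L > 0, Tendsto
      (fun y => frame (some W) y / frame (some W') y) (𝓝[aInterior X] x) (𝓝 L) := by
  obtain ⟨V, F, a, hV, hxV, hVc, hVd, hM⟩ :=
    AChart.exists_monomialOn W.mem_charts W'.mem_charts hW hW'
  set δ : Fin m → ℝ := fun i => W.exponent i - ∑ j, a j i * W'.exponent j
  have hsum0 : ∀ i : Fin m, ¬ i.val < W.chart.k → ∑ j, a j i * W'.exponent j = 0 := fun i hi =>
    Finset.sum_eq_zero fun j _ => by
      by_cases hj : j.val < W'.chart.k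
      · rw [(hM j hj).exponent_eq_zero i hi, zero_mul]
      · rw [W'.exponent_eq_zero_of_le hj, mul_zero]
  have hδ0 : ∀ i : Fin m, ¬ i.val < W.chart.k → δ i = 0 := fun i hi => by
    simp only [δ, W.exponent_eq_zero_of_le hi, hsum0 i hi, sub_zero]
  have hδ : ∀ i : Fin m, i.val < W.chart.k → W.chart.coord x i = 0 → δ i = 0 := fun i hi h0 =>
    sub_eq_zero.2 (W.exponent_eq_sum W' hV hxV hW hVd hM hi h0)
  set R : X → ℝ := fun y => (∏ i, W.chart.coord y i ^ δ i) *
    ∏ j, F j (W.chart.coord y) ^ (- W'.exponent j)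
  have hR : ContinuousAt R x := by
    refine ContinuousAt.mul (tendsto_finsetProd _ fun i _ => ?_) (tendsto_finsetProd _ fun j _ => ?_)
    · have hc := continuousAt_pi.1 (W.chart.continuousAt_coord hW) i
      by_cases h : δ i = 0
      · simp only [h, Real.rpow_zero]; exact tendsto_const_nhds
      · refine hc.rpow_const (Or.inl fun h0 => ?_)
        by_cases hi : i.val < W.chart.k
        · exact h (hδ i hi h0)
        · exact h (hδ0 i hi)
    · by_cases hj : j.val < W'.chart.k
      · exact ((hM j hj).continuousAt hxV).rpow_const (Or.inl ((hM j hj).pos' hxV).ne')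
      · simp only [W'.exponent_eq_zero_of_le hj, neg_zero, Real.rpow_zero]
        exact tendsto_const_nhds
  refine ⟨R x, ?_, (hR.tendsto.mono_left nhdsWithin_le_nhds).congr' ?_⟩
  · refine mul_pos (Finset.prod_pos fun i _ => ?_) (Finset.prod_pos fun j _ => ?_)
    · by_cases h : δ i = 0
      · simp [h]
      · have hi : i.val < W.chart.k := by by_contra hi; exact h (hδ0 i hi)
        exact Real.rpow_pos_of_pos (lt_of_le_of_ne (W.chart.coord_nonneg hW hi)
          fun h0 => h (hδ i hi h0.symm)) _
    · by_cases hj : j.val < W'.chart.k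
      · exact Real.rpow_pos_of_pos ((hM j hj).pos' hxV) _
      · simp [W'.exponent_eq_zero_of_le hj]
  · filter_upwards [self_mem_nhdsWithin, nhdsWithin_le_nhds (hV.mem_nhds hxV)] with y hy hyV
    have hyc := AChart.posAt_of_mem_aInterior W.mem_charts hy (hVc hyV)
    rw [eq_div_iff (frame_pos hy (P := some W') (hVd hyV)).ne']
    have hfac : ∀ j, W'.chart.coord y j ^ W'.exponent j = F j (W.chart.coord y) ^ W'.exponent j *
        ∏ i, W.chart.coord y i ^ (a j i * W'.exponent j) := fun j => by
      by_cases hj : j.val < W'.chart.k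
      · have hnn : ∀ i, 0 ≤ W.chart.coord y i ^ a j i := fun i => by
          by_cases hi : i.val < W.chart.k
          · exact Real.rpow_nonneg (hyc.2 i hi).le _
          · rw [(hM j hj).exponent_eq_zero i hi, Real.rpow_zero]; exact zero_le_one
        rw [(hM j hj).coord_eq' hyV, Real.mul_rpow ((hM j hj).pos' hyV).le
          (Finset.prod_nonneg fun i _ => hnn i), ← Real.finsetProd_rpow _ _ fun i _ => hnn i]
        congr 1
        refine Finset.prod_congr rfl fun i _ => ?_
        by_cases hi : i.val < W.chart.k
        · rw [Real.rpow_mul (hyc.2 i hi).le]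
        · rw [(hM j hj).exponent_eq_zero i hi]; simp
      · simp [W'.exponent_eq_zero_of_le hj]
    have hmon : ∏ j, ∏ i, W.chart.coord y i ^ (a j i * W'.exponent j) =
        ∏ i, W.chart.coord y i ^ (∑ j, a j i * W'.exponent j) := by
      rw [Finset.prod_comm]
      refine Finset.prod_congr rfl fun i _ => ?_
      by_cases hi : i.val < W.chart.k
      · rw [Real.rpow_sum_of_pos (hyc.2 i hi)]
      · rw [hsum0 i hi, Real.rpow_zero]
        refine Finset.prod_eq_one fun j _ => ?_
        by_cases hj : j.val < W'.chart.k
        · rw [(hM j hj).exponent_eq_zero i hi, zero_mul, Real.rpow_zero]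
        · rw [W'.exponent_eq_zero_of_le hj, mul_zero, Real.rpow_zero]
    have hF : (∏ j, F j (W.chart.coord y) ^ (- W'.exponent j)) *
        ∏ j, F j (W.chart.coord y) ^ W'.exponent j = 1 := by
      rw [← Finset.prod_mul_distrib]
      refine Finset.prod_eq_one fun j _ => ?_
      by_cases hj : j.val < W'.chart.k
      · rw [← Real.rpow_add ((hM j hj).pos' hyV), neg_add_cancel, Real.rpow_zero]
      · simp [W'.exponent_eq_zero_of_le hj]
    have hU : (∏ i, W.chart.coord y i ^ δ i) *
        ∏ i, W.chart.coord y i ^ (∑ j, a j i * W'.exponent j) =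
        ∏ i, W.chart.coord y i ^ W.exponent i := by
      rw [← Finset.prod_mul_distrib]
      refine Finset.prod_congr rfl fun i _ => ?_
      by_cases hi : i.val < W.chart.k
      · rw [← Real.rpow_add (hyc.2 i hi), sub_add_cancel]
      · simp [hδ0 i hi, hsum0 i hi, W.exponent_eq_zero_of_le hi]
    simp only [frame, R, hfac, Finset.prod_mul_distrib, hmon, ← hU]
    linear_combination ((∏ i, W.chart.coord y i ^ δ i) *
        ∏ i, W.chart.coord y i ^ (∑ j, a j i * W'.exponent j)) * hF

lemma tendsto_frame_div_of_interior {P Q : LineTriv wt} (hx : x ∈ aInterior X)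
    (hP : x ∈ domain P) (hQ : x ∈ domain Q) :
    Tendsto (fun y => frame P y / frame Q y) (𝓝[aInterior X] x) (𝓝 (frame P x / frame Q x)) :=
  ((continuousAt_frame hx hP).div (continuousAt_frame hx hQ)
    (frame_pos hx hQ).ne').tendsto.mono_left nhdsWithin_le_nhds

lemma exists_tendsto_frame_div {P Q : LineTriv wt} (hP : x ∈ domain P) (hQ : x ∈ domain Q) :
    ∃ L > 0, Tendsto (fun y => frame P y / frame Q y) (𝓝[aInterior X] x) (𝓝 L) := by
  by_cases hx : x ∈ aInterior X
  · exact ⟨_, div_pos (frame_pos hx hP) (frame_pos hx hQ), tendsto_frame_div_of_interior hx hP hQ⟩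
  · cases P with
    | none => exact absurd hP hx
    | some W =>
      cases Q with
      | none => exact absurd hQ hx
      | some W' => exact exists_tendsto_frame_div_some hP hQ

lemma tendsto_lineTransition {P Q : LineTriv wt} (hP : x ∈ domain P) (hQ : x ∈ domain Q) :
    Tendsto (fun y => frame P y / frame Q y) (𝓝[aInterior X] x) (𝓝 (lineTransition P Q x)) := by
  obtain ⟨L, -, hL⟩ := exists_tendsto_frame_div hP hQ
  exact tendsto_nhds_limUnder ⟨L, hL⟩

lemma lineTransition_pos {P Q : LineTriv wt} (hP : x ∈ domain P) (hQ : x ∈ domain Q) :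
    0 < lineTransition P Q x := by
  obtain ⟨L, hL0, hL⟩ := exists_tendsto_frame_div hP hQ
  rwa [tendsto_nhds_unique (tendsto_lineTransition hP hQ) hL]

lemma lineTransition_of_interior {P Q : LineTriv wt} (hx : x ∈ aInterior X) (hP : x ∈ domain P)
    (hQ : x ∈ domain Q) : lineTransition P Q x = frame P x / frame Q x :=
  tendsto_nhds_unique (tendsto_lineTransition hP hQ) (tendsto_frame_div_of_interior hx hP hQ)

lemma lineTransition_comp {P Q R : LineTriv wt} (hP : x ∈ domain P) (hQ : x ∈ domain Q)
    (hR : x ∈ domain R) :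
    lineTransition P R x = lineTransition Q R x * lineTransition P Q x := by
  refine tendsto_nhds_unique (tendsto_lineTransition hP hR) ?_
  refine ((tendsto_lineTransition hQ hR).mul (tendsto_lineTransition hP hQ)).congr' ?_
  filter_upwards [self_mem_nhdsWithin,
    nhdsWithin_le_nhds ((isOpen_domain Q).mem_nhds hQ)] with y hy hyQ
  have := (frame_pos hy hyQ).ne'
  field_simp

lemma lineTransition_self {P : LineTriv wt} (hP : x ∈ domain P) : lineTransition P P x = 1 := by
  have h := lineTransition_comp hP hP hP
  have := (lineTransition_pos hP hP).ne'
  field_simp at h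
  exact h.symm

lemma continuousOn_lineTransition (P Q : LineTriv wt) :
    ContinuousOn (lineTransition P Q) (domain P ∩ domain Q) :=
  continuousOn_extendFrom (fun x _ => dense_aInterior X x)
    fun _ hx => ⟨_, tendsto_lineTransition hx.1 hx.2⟩

end LineTriv

open LineTriv

lemma lComp_eq {P Q : LineTriv wt} (hP : x ∈ domain P) (hQ : x ∈ domain Q) (l : LFibre wt x) :
    lComp wt x Q l = lineTransition P Q x * lComp wt x P l :=
  l.2.2 P Q hP hQ

lemma lComp_injective {P : LineTriv wt} (hP : x ∈ domain P) :
    Function.Injective (lComp wt x P) := by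
  rw [injective_iff_map_eq_zero]
  intro l hl
  ext Q
  by_cases h : x ∈ domain Q
  · have := lComp_eq hP h l
    rw [hl, mul_zero] at this
    exact this
  · rw [l.2.1 Q h]; rfl

lemma lComp_surjective {P : LineTriv wt} (hP : x ∈ domain P) :
    Function.Surjective (lComp wt x P) := by
  classical
  intro r
  refine ⟨⟨fun Q => if x ∈ domain Q then lineTransition P Q x * r else 0, fun Q hQ => if_neg hQ,
    fun Q R hQ hR => ?_⟩, ?_⟩
  · simp only [if_pos hQ, if_pos hR, lineTransition_comp hP hQ hR, mul_assoc]
  · change (if x ∈ domain P then lineTransition P P x * r else 0) = r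
    rw [if_pos hP, lineTransition_self hP, one_mul]

/-- A trivialization of `L_λ` identifies its fibres with `ℝ`. -/
noncomputable def lCompEquiv {P : LineTriv wt} (hP : x ∈ domain P) : LFibre wt x ≃ₗ[ℝ] ℝ :=
  LinearEquiv.ofBijective (lComp wt x P) ⟨lComp_injective hP, lComp_surjective hP⟩

namespace WeightChart

variable (W W' : WeightChart wt)

/-- A weight chart identifies the fibres of `ᵇTX ⊗ L_λ` with `ℝᵐ`. -/
noncomputable def compEquiv (hx : x ∈ W.chart.source) : EFibre wt x ≃ₗ[ℝ] (Fin m → ℝ) :=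
  (TensorProduct.congr (bCompEquiv W.mem_charts hx) (lCompEquiv (P := some W) hx)).trans
    (TensorProduct.rid ℝ _)

lemma compEquiv_apply (hx : x ∈ W.chart.source) (s : EFibre wt x) :
    W.compEquiv hx s = W.comp x s := by
  have : (W.compEquiv hx : EFibre wt x →ₗ[ℝ] (Fin m → ℝ)) = W.comp x := by
    refine TensorProduct.ext' fun v l => ?_
    rw [comp_tmul]
    simp [compEquiv]
    rfl
  exact LinearMap.congr_fun this s

lemma comp_injective (hx : x ∈ W.chart.source) : Function.Injective (W.comp x) := by
  have : (W.comp x : EFibre wt x → Fin m → ℝ) = W.compEquiv hx :=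
    funext fun s => (W.compEquiv_apply hx s).symm
  rw [this]
  exact (W.compEquiv hx).injective

variable {W W'}

lemma comp_eq_sum (hx : x ∈ W.chart.source) (hx' : x ∈ W'.chart.source) (s : EFibre wt x)
    (j : Fin m) : W'.comp x s j = lineTransition (some W) (some W') x *
      ∑ i, W.chart.bTransition W'.chart x j i * W.comp x s i := by
  induction s using TensorProduct.induction_on with
  | zero => simp
  | add s t hs ht =>
    simp only [map_add, Pi.add_apply, hs, ht, mul_add, Finset.sum_add_distrib]
  | tmul v l =>
    simp only [comp_tmul, Pi.smul_apply, smul_eq_mul,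
      bComp_eq_sum W.mem_charts W'.mem_charts hx hx' v j,
      lComp_eq (P := some W) (Q := some W') hx hx' l, Finset.mul_sum]
    exact Finset.sum_congr rfl fun i _ => by ring

end WeightChart

end Line

end ACorners

/-! ### Coordinates on the interior -/

namespace ACorners

section Interior

open VectorField

variable {m : ℕ} {X : Type*} [TopologicalSpace X] [AManifold m X] {c d : AChart m X}
  {y : aInterior X} {i j : Fin m}

/-- Smoothness at a point of a vector field on the interior. -/
abbrev IntContMDiffAt (V : Π y : aInterior X, IntTangent y) (y : aInterior X) : Prop :=
  ContMDiffAt 𝓘(ℝ, Fin m → ℝ) (𝓘(ℝ, Fin m → ℝ).prod 𝓘(ℝ, Fin m → ℝ)) ∞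
    (fun z => (Bundle.TotalSpace.mk' (Fin m → ℝ) z (V z) :
      Bundle.TotalSpace (Fin m → ℝ) (fun x : aInterior X => TangentSpace 𝓘(ℝ, Fin m → ℝ) x))) y

/-- Differentiability at a point of a vector field on the interior. -/
abbrev IntMDiffAt (V : Π y : aInterior X, IntTangent y) (y : aInterior X) : Prop :=
  MDifferentiableAt 𝓘(ℝ, Fin m → ℝ) (𝓘(ℝ, Fin m → ℝ).prod 𝓘(ℝ, Fin m → ℝ))
    (fun z => (Bundle.TotalSpace.mk' (Fin m → ℝ) z (V z) :
      Bundle.TotalSpace (Fin m → ℝ) (fun x : aInterior X => TangentSpace 𝓘(ℝ, Fin m → ℝ) x))) y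

namespace AChart

lemma PosAt.of_mem (hc : c ∈ AManifold.charts (X := X)) (hy : (y : X) ∈ c.source) : c.PosAt y :=
  posAt_of_mem_aInterior hc y.2 hy

variable (c) in
/-- The coordinates of an a-chart, as a function on the interior. -/
def intCoord (y : aInterior X) : Fin m → ℝ := c.coord y

lemma contMDiffAt_intCoord (hc : c ∈ AManifold.charts (X := X)) (hy : (y : X) ∈ c.source) :
    ContMDiffAt 𝓘(ℝ, Fin m → ℝ) 𝓘(ℝ, Fin m → ℝ) ∞ c.intCoord y := by
  have hmem : c.interiorChart hc y ∈ IsManifold.maximalAtlas 𝓘(ℝ, Fin m → ℝ) ∞ (aInterior X) :=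
    IsManifold.subset_maximalAtlas ⟨c, hc, y, rfl⟩
  exact (contMDiffOn_of_mem_maximalAtlas hmem).contMDiffAt
    ((c.interiorChart hc y).open_source.mem_nhds (PosAt.of_mem hc hy))

lemma mdifferentiableAt_intCoord (hc : c ∈ AManifold.charts (X := X)) (hy : (y : X) ∈ c.source) :
    MDifferentiableAt 𝓘(ℝ, Fin m → ℝ) 𝓘(ℝ, Fin m → ℝ) c.intCoord y := (contMDiffAt_intCoord hc hy).mdifferentiableAt (by simp)

lemma mfderiv_intCoord (hc : c ∈ AManifold.charts (X := X)) (hy : (y : X) ∈ c.source) :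
    mfderiv 𝓘(ℝ, Fin m → ℝ) 𝓘(ℝ, Fin m → ℝ) c.intCoord y =
      fderiv ℝ (fun u => c.coord ((interiorChartAt y).point u)) ((interiorChartAt y).coord y) := by
  have hpos := interiorChartAt_posAt y
  rw [(mdifferentiableAt_intCoord hc hy).mfderiv]
  simp only [modelWithCornersSelf_coe, range_id, fderivWithin_univ]
  refine Filter.EventuallyEq.fderiv_eq ?_
  filter_upwards [(interiorChartAt y).isOpen_posTarget.mem_nhds (coord_mem_posTarget hpos)]
    with u hu
  have : (((interiorChartAt y).interiorChart (interiorChartAt_mem y) y).symm u : X) =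
      (interiorChartAt y).point u := congrArg Subtype.val (dif_pos hu)
  change c.coord (((interiorChartAt y).interiorChart (interiorChartAt_mem y) y).symm u : X) = _
  rw [this]

lemma mfderiv_intCoord_toIntTangent (hc : c ∈ AManifold.charts (X := X))
    (hy : (y : X) ∈ c.source) (v : BTangent (y : X)) :
    mfderiv 𝓘(ℝ, Fin m → ℝ) 𝓘(ℝ, Fin m → ℝ) c.intCoord y (toIntTangent y v) =
      fun i => bScale c.k i (c.coord y) * bComp (y : X) c v i := by
  set d := interiorChartAt y
  have hd : d ∈ AManifold.charts (X := X) := interiorChartAt_mem y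
  have hyd : d.PosAt (y : X) := interiorChartAt_posAt y
  have hT := (contDiffAt_transition hd hc hyd hy).differentiableAt (by simp)
  rw [mfderiv_intCoord hc hy]
  funext i
  have hsum := LinearMap.pi_apply_eq_sum_univ
    (fderiv ℝ (fun u => c.coord (d.point u)) (d.coord y) : (Fin m → ℝ) →ₗ[ℝ] (Fin m → ℝ))
    (fun j => bScale d.k j (d.coord y) * bComp (y : X) d v j)
  have hv : (toIntTangent y v : Fin m → ℝ) =
      fun j => bScale d.k j (d.coord y) * bComp (y : X) d v j := rfl
  refine (congrFun hsum i).trans ?_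
  rw [bComp_eq_sum hd hc hyd.1 hy, Finset.mul_sum, Finset.sum_apply]
  refine Finset.sum_congr rfl fun j _ => ?_
  have hs : (fun l => if j = l then (1 : ℝ) else 0) = Pi.single j 1 := by
    ext l; simp [Pi.single_apply, eq_comm]
  have hne := bScale_ne_zero (PosAt.of_mem hc hy) i
  rw [bTransition_eq_of_interior hd hc y.2 hyd.1 hy, bJacobian_eq,
    bpartial_eq_fderiv (differentiableAt_pi.1 hT i), hs]
  have : (fderiv ℝ (fun u => c.coord (d.point u)) (d.coord y)) (Pi.single j 1) i =
      fderiv ℝ (fun u => c.coord (d.point u) i) (d.coord y) (Pi.single j 1) := by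
    rw [fderiv_pi fun j => (differentiableAt_pi.1 hT) j]
    rfl
  simp only [Pi.smul_apply, smul_eq_mul, ContinuousLinearMap.coe_coe, this]
  field_simp

end AChart

open AChart

lemma toIntTangent_bijective (y : aInterior X) : Function.Bijective (toIntTangent y) := by
  have hd := interiorChartAt_mem y
  have hyd := interiorChartAt_posAt y
  constructor
  · rw [injective_iff_map_eq_zero]
    intro v hv
    refine bComp_injective hd hyd.1 ?_
    rw [map_zero]
    ext i
    have : bScale (interiorChartAt y).k i ((interiorChartAt y).coord y) *
      bComp (y : X) (interiorChartAt y) v i = 0 := congrFun hv i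
    exact (mul_eq_zero.1 this).resolve_left (bScale_ne_zero hyd i)
  · intro w
    obtain ⟨v, hv⟩ := bComp_surjective hd hyd.1 (fun i =>
      (bScale (interiorChartAt y).k i ((interiorChartAt y).coord y))⁻¹ * (w : Fin m → ℝ) i)
    refine ⟨v, ?_⟩
    funext i
    change bScale (interiorChartAt y).k i ((interiorChartAt y).coord y) *
      bComp (y : X) (interiorChartAt y) v i = _
    rw [hv, mul_inv_cancel_left₀ (bScale_ne_zero hyd i)]

lemma AChart.mfderiv_intCoord_bijective (hc : c ∈ AManifold.charts (X := X))
    (hy : (y : X) ∈ c.source) :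
    Function.Bijective (mfderiv 𝓘(ℝ, Fin m → ℝ) 𝓘(ℝ, Fin m → ℝ) c.intCoord y) := by
  have hne := fun i => bScale_ne_zero (PosAt.of_mem hc hy) i
  constructor
  · rw [injective_iff_map_eq_zero]
    intro w hw
    obtain ⟨v, rfl⟩ := (toIntTangent_bijective y).2 w
    rw [mfderiv_intCoord_toIntTangent hc hy] at hw
    have : v = 0 := by
      refine bComp_injective hc hy ?_
      rw [map_zero]
      ext i
      exact (mul_eq_zero.1 (congrFun hw i)).resolve_left (hne i)
    rw [this, map_zero]
  · intro w
    obtain ⟨v, hv⟩ := bComp_surjective hc hy (fun i =>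
      (bScale c.k i (c.coord y))⁻¹ * (w : Fin m → ℝ) i)
    refine ⟨toIntTangent y v, (mfderiv_intCoord_toIntTangent hc hy v).trans ?_⟩
    funext i
    rw [hv, mul_inv_cancel_left₀ (hne i)]

lemma AChart.isInvertible_mfderiv_intCoord (hc : c ∈ AManifold.charts (X := X))
    (hy : (y : X) ∈ c.source) :
    (mfderiv 𝓘(ℝ, Fin m → ℝ) 𝓘(ℝ, Fin m → ℝ) c.intCoord y).IsInvertible := by
  have h := mfderiv_intCoord_bijective hc hy
  set L : (Fin m → ℝ) →L[ℝ] (Fin m → ℝ) :=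
    mfderiv 𝓘(ℝ, Fin m → ℝ) 𝓘(ℝ, Fin m → ℝ) c.intCoord y
  exact ⟨(LinearEquiv.ofBijective (L : (Fin m → ℝ) →ₗ[ℝ] (Fin m → ℝ)) h).toContinuousLinearEquiv,
    by ext v; rfl⟩

lemma AChart.mdifferentiableAt_of_point (hc : c ∈ AManifold.charts (X := X))
    (hy : (y : X) ∈ c.source) {f : aInterior X → ℝ} {f' : (Fin m → ℝ) → ℝ}
    (hf : DifferentiableAt ℝ f' (c.coord y)) (he : ∀ᶠ z in 𝓝 y, f z = f' (c.coord z)) :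
    MDifferentiableAt 𝓘(ℝ, Fin m → ℝ) 𝓘(ℝ, ℝ) f y :=
  (MDifferentiableAt.comp y (g := f') (f := c.intCoord)
    hf.mdifferentiableAt (mdifferentiableAt_intCoord hc hy)).congr_of_eventuallyEq he

/-- The derivative of a function on the interior, in the coordinates of an a-chart. -/
lemma AChart.mvfderiv_toIntTangent (hc : c ∈ AManifold.charts (X := X))
    (hy : (y : X) ∈ c.source) {f : aInterior X → ℝ} {f' : (Fin m → ℝ) → ℝ}
    (hf : DifferentiableAt ℝ f' (c.coord y)) (he : ∀ᶠ z in 𝓝 y, f z = f' (c.coord z))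
    (v : BTangent (y : X)) :
    mvfderiv 𝓘(ℝ, Fin m → ℝ) f y (toIntTangent y v) =
      ∑ i, bpartial c.k i f' (c.coord y) * bComp (y : X) c v i := by
  have h : HasMFDerivAt 𝓘(ℝ, Fin m → ℝ) 𝓘(ℝ, ℝ) f y ((fderiv ℝ f' (c.coord y)).comp
      (mfderiv 𝓘(ℝ, Fin m → ℝ) 𝓘(ℝ, Fin m → ℝ) c.intCoord y)) :=
    (HasMFDerivAt.comp y (g := f') (f := c.intCoord)
      hf.hasFDerivAt.hasMFDerivAt
      (mdifferentiableAt_intCoord hc hy).hasMFDerivAt).congr_of_eventuallyEq he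
  have h1 : mvfderiv 𝓘(ℝ, Fin m → ℝ) f y (toIntTangent y v) = fderiv ℝ f' (c.coord y)
      (mfderiv 𝓘(ℝ, Fin m → ℝ) 𝓘(ℝ, Fin m → ℝ) c.intCoord y (toIntTangent y v)) := by
    rw [mvfderiv, h.mfderiv]; rfl
  rw [h1, mfderiv_intCoord_toIntTangent hc hy]
  refine (LinearMap.pi_apply_eq_sum_univ
    (fderiv ℝ f' (c.coord y) : (Fin m → ℝ) →ₗ[ℝ] ℝ) _).trans ?_
  refine Finset.sum_congr rfl fun j _ => ?_
  have hs : (fun l => if j = l then (1 : ℝ) else 0) = Pi.single j 1 := by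
    ext l; simp [Pi.single_apply, eq_comm]
  rw [bpartial_eq_fderiv hf, hs, smul_eq_mul, ContinuousLinearMap.coe_coe]
  ring

/-! #### The coordinate frame -/

/-- The `i`-th b-coordinate vector field of the model. -/
noncomputable def modelField (k : ℕ) (i : Fin m) (u : Fin m → ℝ) : Fin m → ℝ :=
  Pi.single i (bScale k i u)

lemma hasFDerivAt_modelField (k : ℕ) (i : Fin m) (u : Fin m → ℝ) :
    HasFDerivAt (modelField k i) (if i.val < k then
      (ContinuousLinearMap.single ℝ (fun _ : Fin m => ℝ) i).comp
        (ContinuousLinearMap.proj (R := ℝ) (φ := fun _ : Fin m => ℝ) i) else 0) u := by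
  by_cases h : i.val < k
  · rw [if_pos h]
    refine HasFDerivAt.congr_of_eventuallyEq (ContinuousLinearMap.hasFDerivAt _)
      (Eventually.of_forall fun v => ?_)
    simp [modelField, bScale, h]
  · rw [if_neg h]
    refine HasFDerivAt.congr_of_eventuallyEq (hasFDerivAt_const (Pi.single i (1 : ℝ)) u)
      (Eventually.of_forall fun v => ?_)
    simp [modelField, bScale, h]

lemma contDiff_modelField (k : ℕ) (i : Fin m) :
    ContDiff ℝ ∞ (modelField k i) := by
  refine contDiff_pi.2 fun j => ?_
  by_cases h : j = i
  · subst h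
    by_cases hk : j.val < k
    · simpa [modelField, bScale, hk] using contDiff_apply ℝ ℝ j
    · simpa [modelField, bScale, hk] using contDiff_const
  · simpa [modelField, h] using contDiff_const

lemma lieBracket_modelField (k : ℕ) (i j : Fin m) (u : Fin m → ℝ) :
    lieBracket ℝ (modelField k i) (modelField k j) u = 0 := by
  rw [lieBracket_eq]
  beta_reduce
  rw [(hasFDerivAt_modelField k i u).fderiv, (hasFDerivAt_modelField k j u).fderiv]
  by_cases hij : i = j
  · subst hij; simp
  · have hji : j ≠ i := Ne.symm hij
    split_ifs <;> simp [modelField, hij, hji]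

lemma mlieBracket_modelField (k : ℕ) (i j : Fin m) (u : Fin m → ℝ) :
    mlieBracket 𝓘(ℝ, Fin m → ℝ) (M := Fin m → ℝ) (modelField k i) (modelField k j) u = 0 := by
  have h := congrFun (mlieBracketWithin_eq_lieBracketWithin (𝕜 := ℝ) (V := modelField k i)
    (W := modelField k j) (s := univ)) u
  refine (congrFun mlieBracketWithin_univ u).symm.trans (h.trans ?_)
  rw [lieBracketWithin_univ]
  exact lieBracket_modelField k i j u

/-- The b-coordinate vector field `xᵢ∂/∂xᵢ` or `∂/∂xᵢ` of an a-chart, on the interior. -/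
noncomputable def AChart.frameField (c : AChart m X) (i : Fin m) (y : aInterior X) :
    IntTangent y :=
  mpullback 𝓘(ℝ, Fin m → ℝ) 𝓘(ℝ, Fin m → ℝ) c.intCoord (modelField c.k i) y

namespace AChart

lemma contMDiffAt_frameField (hc : c ∈ AManifold.charts (X := X)) (hy : (y : X) ∈ c.source)
    (i : Fin m) : IntContMDiffAt (c.frameField i) y := by
  refine ContMDiffAt.mpullback_vectorField_preimage (n := ∞) ?_ (contMDiffAt_intCoord hc hy)
    (isInvertible_mfderiv_intCoord hc hy) (by simp)
  exact contMDiffAt_vectorSpace_iff_contDiffAt.2 (contDiff_modelField c.k i).contDiffAt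

lemma mdifferentiableAt_frameField (hc : c ∈ AManifold.charts (X := X))
    (hy : (y : X) ∈ c.source) (i : Fin m) : IntMDiffAt (c.frameField i) y :=
  (contMDiffAt_frameField hc hy i).mdifferentiableAt (by simp)

lemma mlieBracket_frameField (hc : c ∈ AManifold.charts (X := X)) (hy : (y : X) ∈ c.source)
    (i j : Fin m) :
    mlieBracket 𝓘(ℝ, Fin m → ℝ) (c.frameField i) (c.frameField j) y = 0 := by
  have hm : ∀ (i : Fin m) u, MDifferentiableAt 𝓘(ℝ, Fin m → ℝ)
      (𝓘(ℝ, Fin m → ℝ).prod 𝓘(ℝ, Fin m → ℝ)) (fun z => (Bundle.TotalSpace.mk' (Fin m → ℝ) z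
      (modelField c.k i z) : TangentBundle 𝓘(ℝ, Fin m → ℝ) (Fin m → ℝ))) u := fun i u =>
    (contMDiffAt_vectorSpace_iff_contDiffAt.2
      (contDiff_modelField c.k i).contDiffAt).mdifferentiableAt (n := ∞) (by simp)
  have : IsManifold 𝓘(ℝ, Fin m → ℝ) (minSmoothness ℝ 2) (aInterior X) := by
    rw [minSmoothness_of_isRCLikeNormedField]
    exact IsManifold.of_le (n := ∞) ENat.LEInfty.out
  have h := mpullback_mlieBracket (hm i (c.intCoord y)) (hm j (c.intCoord y))
    (contMDiffAt_intCoord hc hy) (by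
      rw [minSmoothness_of_isRCLikeNormedField]; exact ENat.LEInfty.out)
  exact h.symm.trans ((congrArg _ (mlieBracket_modelField c.k i j (c.intCoord y))).trans
    (map_zero _))

lemma mfderiv_frameField (hc : c ∈ AManifold.charts (X := X)) (hy : (y : X) ∈ c.source)
    (i : Fin m) : mfderiv 𝓘(ℝ, Fin m → ℝ) 𝓘(ℝ, Fin m → ℝ) c.intCoord y (c.frameField i y) =
      modelField c.k i (c.intCoord y) :=
  (isInvertible_mfderiv_intCoord hc hy).self_apply_inverse _

lemma toIntTangent_eq_sum (hc : c ∈ AManifold.charts (X := X)) (hy : (y : X) ∈ c.source)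
    (v : BTangent (y : X)) :
    toIntTangent y v = ∑ i, bComp (y : X) c v i • c.frameField i y := by
  refine (mfderiv_intCoord_bijective hc hy).1 ?_
  rw [map_sum]
  simp only [map_smul, mfderiv_frameField hc hy, mfderiv_intCoord_toIntTangent hc hy]
  funext j
  have : ∀ s : Finset (Fin m), (∑ i ∈ s, bComp (y : X) c v i •
      modelField c.k i (c.intCoord y) : Fin m → ℝ) j =
      ∑ i ∈ s, bComp (y : X) c v i * (Pi.single i (bScale c.k i (c.coord y)) : Fin m → ℝ) j :=
    fun s => Finset.sum_apply _ _ _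
  refine Eq.trans ?_ (this Finset.univ).symm
  simp [Pi.single_apply, mul_comm]

lemma exists_frameField_eq_toIntTangent (hc : c ∈ AManifold.charts (X := X))
    (hy : (y : X) ∈ c.source) (i : Fin m) : ∃ v : BTangent (y : X), bComp (y : X) c v =
      Pi.single i 1 ∧ c.frameField i y = toIntTangent y v := by
  obtain ⟨v, hv⟩ := bComp_surjective hc hy (Pi.single i 1)
  refine ⟨v, hv, ?_⟩
  rw [toIntTangent_eq_sum hc hy, hv, Finset.sum_eq_single i]
  · simp
  · intro j _ hj
    simp [hj]
  · simp

lemma mvfderiv_frameField (hc : c ∈ AManifold.charts (X := X)) (hy : (y : X) ∈ c.source)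
    {f : aInterior X → ℝ} {f' : (Fin m → ℝ) → ℝ} (hf : DifferentiableAt ℝ f' (c.coord y))
    (he : ∀ᶠ z in 𝓝 y, f z = f' (c.coord z)) (i : Fin m) :
    mvfderiv 𝓘(ℝ, Fin m → ℝ) f y (c.frameField i y) = bpartial c.k i f' (c.coord y) := by
  obtain ⟨v, hv, hF⟩ := exists_frameField_eq_toIntTangent hc hy i
  rw [hF, mvfderiv_toIntTangent hc hy hf he, hv]
  simp [Pi.single_apply]

end AChart

end Interior

end ACorners

/-! ### Restriction of a weighted b-metric to the interior -/

namespace ACorners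

lemma isVonNBounded_of_posDef {E : Type*} [NormedAddCommGroup E] [NormedSpace ℝ E]
    [FiniteDimensional ℝ E] (B : E →L[ℝ] E →L[ℝ] ℝ) (hB : ∀ v, v ≠ 0 → 0 < B v v) :
    Bornology.IsVonNBounded ℝ {v : E | B v v < 1} := by
  rw [NormedSpace.isVonNBounded_iff]
  have hcont : Continuous fun v => B v v := by fun_prop
  obtain ⟨δ, hδ, hmin⟩ : ∃ δ > 0, ∀ v ∈ Metric.sphere (0 : E) 1, δ ≤ B v v := by
    by_cases hne : (Metric.sphere (0 : E) 1).Nonempty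
    · obtain ⟨w, hw, hmin⟩ := (isCompact_sphere (0 : E) 1).exists_isMinOn hne hcont.continuousOn
      exact ⟨B w w, hB w (ne_zero_of_mem_unit_sphere ⟨w, hw⟩), fun v hv => hmin hv⟩
    · exact ⟨1, one_pos, fun v hv => absurd ⟨v, hv⟩ hne⟩
  refine (Metric.isBounded_closedBall (x := (0 : E)) (r := 1 + δ⁻¹)).subset fun v hv => ?_
  rw [mem_closedBall_zero_iff]
  by_cases hv0 : v = 0
  · rw [hv0, norm_zero]; positivity
  have hn : 0 < ‖v‖ := norm_pos_iff.2 hv0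
  have h1 := hmin (‖v‖⁻¹ • v) (by simp [norm_smul, hn.ne'])
  simp only [map_smul, smul_apply, smul_eq_mul] at h1
  have h2 : δ * ‖v‖ ^ 2 ≤ B v v := by
    have := mul_le_mul_of_nonneg_right h1 (sq_nonneg ‖v‖)
    have e : ‖v‖⁻¹ * (‖v‖⁻¹ * B v v) * ‖v‖ ^ 2 = B v v := by field_simp
    linarith
  have h3 : δ * ‖v‖ ^ 2 < 1 := h2.trans_lt hv
  by_contra! hlt
  have h4 : 1 ≤ ‖v‖ := le_trans (by have := inv_pos.2 hδ; linarith) hlt.le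
  have h5 : 1 ≤ δ * ‖v‖ := by
    have := mul_le_mul_of_nonneg_left hlt.le hδ.le
    rw [mul_add, mul_inv_cancel₀ hδ.ne'] at this
    linarith
  nlinarith

lemma contDiffAt_sum_smul {E F ι : Type*} [NormedAddCommGroup E] [NormedSpace ℝ E]
    [NormedAddCommGroup F] [NormedSpace ℝ F] [Fintype ι] {f : ι → ι → E → ℝ} (P : ι → ι → F) {x : E}
    (hf : ∀ i j, ContDiffAt ℝ ∞ (f i j) x) :
    ContDiffAt ℝ ∞ (fun u => ∑ i, ∑ j, f i j u • P i j) x :=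
  ContDiffAt.sum fun i _ => ContDiffAt.sum fun j _ => (hf i j).smul contDiffAt_const

section Interior

variable {m : ℕ} {X : Type*} [TopologicalSpace X] [AManifold m X] {c d : AChart m X}
  {y : aInterior X} {i j : Fin m} {wt : Weight X}

open AChart LineTriv

lemma identify_tmul (v : BTangent (y : X)) (l : LFibre wt (y : X)) :
    identify wt y (v ⊗ₜ l) = lComp wt (y : X) none l • toIntTangent y v := by
  simp [identify]

namespace WeightChart

variable {W : WeightChart wt}

lemma lComp_none (hy : (y : X) ∈ W.chart.source) (l : LFibre wt (y : X)) :
    lComp wt (y : X) none l = frame (some W) (y : X) * lComp wt (y : X) (some W) l := by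
  rw [lComp_eq (P := some W) (Q := none) hy y.2 l,
    lineTransition_of_interior (P := some W) (Q := none) y.2 hy y.2]
  simp [frame]

lemma identify_eq_toIntTangent (hy : (y : X) ∈ W.chart.source) (s : EFibre wt (y : X)) :
    identify wt y s = toIntTangent y ((bCompEquiv W.mem_charts hy).symm
      (frame (some W) (y : X) • W.comp y s)) := by
  induction s using TensorProduct.induction_on with
  | zero => simp
  | add s t hs ht => simp only [map_add, hs, ht, smul_add]
  | tmul v l =>
    have : bComp (y : X) W.chart v = bCompEquiv W.mem_charts hy v := rfl
    rw [identify_tmul, comp_tmul, lComp_none hy, this, map_smul, map_smul, map_smul,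
      map_smul, LinearEquiv.symm_apply_apply, mul_smul]

lemma identify_eq_sum (hy : (y : X) ∈ W.chart.source) (s : EFibre wt (y : X)) :
    identify wt y s =
      ∑ i, (frame (some W) (y : X) * W.comp y s i) • W.chart.frameField i y := by
  rw [identify_eq_toIntTangent hy, toIntTangent_eq_sum W.mem_charts hy]
  refine Finset.sum_congr rfl fun i _ => ?_
  rw [← bCompEquiv_apply W.mem_charts hy, LinearEquiv.apply_symm_apply]
  rfl

lemma mfderiv_intCoord_identify (hy : (y : X) ∈ W.chart.source) (s : EFibre wt (y : X)) :
    mfderiv 𝓘(ℝ, Fin m → ℝ) 𝓘(ℝ, Fin m → ℝ) W.chart.intCoord y (identify wt y s) =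
      fun i => bScale W.chart.k i (W.chart.coord y) *
        (frame (some W) (y : X) * W.comp y s i) := by
  rw [identify_eq_toIntTangent hy, mfderiv_intCoord_toIntTangent W.mem_charts hy]
  funext i
  rw [← bCompEquiv_apply W.mem_charts hy, LinearEquiv.apply_symm_apply]
  rfl

end WeightChart

lemma identify_bijective (y : aInterior X) : Function.Bijective (identify wt y) := by
  obtain ⟨W, hy, -⟩ := WeightChart.exists_restr wt (interiorChartAt_mem y)
    (interiorChartAt_posAt y).1
  have hφ := (frame_pos (P := some W) y.2 hy).ne'
  have : (identify wt y : EFibre wt (y : X) → IntTangent y) =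
      toIntTangent y ∘ (bCompEquiv W.mem_charts hy).symm ∘
        (LinearEquiv.smulOfNeZero ℝ (Fin m → ℝ) _ hφ) ∘ W.compEquiv hy := by
    funext s
    simp only [Function.comp_apply, W.compEquiv_apply, LinearEquiv.smulOfNeZero_apply]
    exact WeightChart.identify_eq_toIntTangent hy s
  rw [this]
  exact (toIntTangent_bijective y).comp ((LinearEquiv.bijective _).comp
    ((LinearEquiv.bijective _).comp (LinearEquiv.bijective _)))

variable (wt) in
/-- The natural isomorphism `(ᵇTX ⊗ L_λ)|_{X°} ≅ TX°`, as a linear equivalence. -/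
noncomputable def identifyEquiv (y : aInterior X) : EFibre wt (y : X) ≃ₗ[ℝ] IntTangent y :=
  LinearEquiv.ofBijective (identify wt y) (identify_bijective y)

lemma identifyEquiv_apply (s : EFibre wt (y : X)) : identifyEquiv wt y s = identify wt y s := rfl

instance (y : aInterior X) : T2Space (IntTangent y) := inferInstanceAs (T2Space (Fin m → ℝ))

namespace WeightedBMetric

variable (g : WeightedBMetric wt)

/-- The inner product on `TᵧX°` given by a weighted b-metric. -/
noncomputable def intInner (y : aInterior X) : IntTangent y →L[ℝ] IntTangent y →L[ℝ] ℝ :=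
  LinearMap.toContinuousLinearMap (LinearMap.toContinuousLinearMap.toLinearMap ∘ₗ
    (g.form y).compl₁₂ (identifyEquiv wt y).symm.toLinearMap (identifyEquiv wt y).symm.toLinearMap)

lemma intInner_apply (v w : IntTangent y) :
    g.intInner y v w = g.form y ((identifyEquiv wt y).symm v) ((identifyEquiv wt y).symm w) := rfl

lemma intInner_identify (s t : EFibre wt (y : X)) :
    g.intInner y (identify wt y s) (identify wt y t) = g.form y s t := by
  rw [intInner_apply, ← identifyEquiv_apply, ← identifyEquiv_apply, LinearEquiv.symm_apply_apply,
    LinearEquiv.symm_apply_apply]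

/-- In a weight chart, the inner product on the interior in the coordinates. -/
lemma intInner_eq_sum {W : WeightChart wt} {G : Fin m → Fin m → (Fin m → ℝ) → ℝ}
    (hG : ∀ u ∈ W.chart.target, ∀ s t : EFibre wt (W.chart.point u),
      g.form _ s t = ∑ i, ∑ j, G i j u * W.comp _ s i * W.comp _ t j)
    (hy : (y : X) ∈ W.chart.source) (v w : IntTangent y) :
    g.intInner y v w = ∑ i, ∑ j,
      (G i j (W.chart.coord y) * ((frame (some W) (y : X))⁻¹ * (frame (some W) (y : X))⁻¹) *
        ((bScale W.chart.k i (W.chart.coord y))⁻¹ * (bScale W.chart.k j (W.chart.coord y))⁻¹)) *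
      ((mfderiv 𝓘(ℝ, Fin m → ℝ) 𝓘(ℝ, Fin m → ℝ) W.chart.intCoord y v : Fin m → ℝ) i *
        (mfderiv 𝓘(ℝ, Fin m → ℝ) 𝓘(ℝ, Fin m → ℝ) W.chart.intCoord y w : Fin m → ℝ) j) := by
  obtain ⟨s, rfl⟩ := (identify_bijective (wt := wt) y).2 v
  obtain ⟨t, rfl⟩ := (identify_bijective (wt := wt) y).2 w
  have h := hG _ (W.chart.coord_mem hy)
  rw [W.chart.point_coord hy] at h
  rw [intInner_identify, h, WeightChart.mfderiv_intCoord_identify hy,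
    WeightChart.mfderiv_intCoord_identify hy]
  have hφ := (frame_pos (P := some W) y.2 hy).ne'
  refine Finset.sum_congr rfl fun i _ => Finset.sum_congr rfl fun j _ => ?_
  have hi := bScale_ne_zero (PosAt.of_mem W.mem_charts hy) i
  have hj := bScale_ne_zero (PosAt.of_mem W.mem_charts hy) j
  field_simp

set_option synthInstance.maxHeartbeats 200000 in
lemma contMDiff_intInner : ContMDiff 𝓘(ℝ, Fin m → ℝ)
    (𝓘(ℝ, Fin m → ℝ).prod 𝓘(ℝ, (Fin m → ℝ) →L[ℝ] (Fin m → ℝ) →L[ℝ] ℝ)) ∞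
    (fun y : aInterior X => Bundle.TotalSpace.mk' ((Fin m → ℝ) →L[ℝ] (Fin m → ℝ) →L[ℝ] ℝ)
      (E := fun y : aInterior X => IntTangent y →L[ℝ] IntTangent y →L[ℝ] ℝ) y
      (g.intInner y)) := by
  intro x
  obtain ⟨W, hx, hsub, hk, hcoord, hpoint⟩ := WeightChart.exists_restr wt (interiorChartAt_mem x)
    (interiorChartAt_posAt x).1
  obtain ⟨G, hGs, hG⟩ := g.aSmooth W
  rw [contMDiffAt_hom_bundle]
  refine ⟨contMDiffAt_id, ?_⟩
  have hnear : ∀ᶠ y : aInterior X in 𝓝 x, (y : X) ∈ W.chart.source :=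
    continuous_subtype_val.continuousAt.preimage_mem_nhds (W.chart.open_source.mem_nhds hx)
  set P : Fin m → Fin m → (Fin m → ℝ) →L[ℝ] (Fin m → ℝ) →L[ℝ] ℝ := fun i j =>
    (ContinuousLinearMap.proj (R := ℝ) (φ := fun _ : Fin m => ℝ) i).smulRight
      (ContinuousLinearMap.proj (R := ℝ) (φ := fun _ : Fin m => ℝ) j)
  set f : Fin m → Fin m → (Fin m → ℝ) → ℝ := fun i j u =>
    G i j u * ((∏ l, u l ^ W.exponent l)⁻¹ * (∏ l, u l ^ W.exponent l)⁻¹) *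
      ((bScale W.chart.k i u)⁻¹ * (bScale W.chart.k j u)⁻¹)
  have hpos := PosAt.of_mem W.mem_charts hx
  have hf : ∀ i j, ContDiffAt ℝ ∞ (f i j) (W.chart.coord x) := fun i j => by
    have h1 : ContDiffAt ℝ ∞ (G i j) (W.chart.coord x) :=
      contDiffAt_of_aSmoothOn isOpen_univ hpos (mem_univ _) ((hGs i j).mono inter_subset_left)
    have h2 : ContDiffAt ℝ ∞ (fun u => (∏ l, u l ^ W.exponent l)⁻¹) (W.chart.coord x) :=
      (contDiffAt_monomial hpos.2 fun i hi => W.exponent_eq_zero_of_le hi).inv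
        (frame_pos (P := some W) x.2 hx).ne'
    have h3 : ∀ i, ContDiffAt ℝ ∞ (fun u => (bScale W.chart.k i u)⁻¹) (W.chart.coord x) :=
      fun i => by
        refine ContDiffAt.inv ?_ (bScale_ne_zero hpos i)
        unfold bScale
        split_ifs
        · exact (contDiff_apply ℝ ℝ i).contDiffAt
        · exact contDiffAt_const
    exact (h1.mul (h2.mul h2)).mul ((h3 i).mul (h3 j))
  have hs := contDiffAt_sum_smul P hf
  have hcm := ContMDiffAt.comp x (g := fun u => ∑ i, ∑ j, f i j u • P i j) (f := W.chart.intCoord)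
    hs.contMDiffAt (contMDiffAt_intCoord W.mem_charts hx)
  refine hcm.congr_of_eventuallyEq ?_
  filter_upwards [hnear] with y hy
  have hyc : y ∈ (chartAt (Fin m → ℝ) x).source :=
    PosAt.of_mem (interiorChartAt_mem x) (hsub hy)
  have hyb : y ∈ (trivializationAt (Fin m → ℝ)
      (TangentSpace 𝓘(ℝ, Fin m → ℝ) : aInterior X → Type) x).baseSet := hyc
  have hco : W.chart.intCoord = extChartAt 𝓘(ℝ, Fin m → ℝ) x := by
    funext z
    change W.chart.coord z = (interiorChartAt x).coord z
    rw [hcoord]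
  have hsymm : ∀ v : Fin m → ℝ, mfderiv 𝓘(ℝ, Fin m → ℝ) 𝓘(ℝ, Fin m → ℝ) W.chart.intCoord y
      ((trivializationAt (Fin m → ℝ) (TangentSpace 𝓘(ℝ, Fin m → ℝ)) x).symm y v) = v := by
    intro v
    rw [hco, ← TangentBundle.continuousLinearMapAt_trivializationAt hyc]
    have h := Bundle.Trivialization.continuousLinearMapAt_symmL (R := ℝ) (trivializationAt
      (Fin m → ℝ) (TangentSpace 𝓘(ℝ, Fin m → ℝ) : aInterior X → Type) x) hyb v
    rwa [Bundle.Trivialization.symmL_apply _ hyb] at h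
  ext v w
  rw [inCoordinates_apply_eq₂ hyb hyb (mem_univ _)]
  simp only [Bundle.Trivial.fiberBundle_trivializationAt',
    Bundle.Trivial.linearMapAt_trivialization, LinearMap.id_coe, id_eq]
  refine (g.intInner_eq_sum hG hy _ _).trans ?_
  rw [hsymm, hsymm]
  simp only [Function.comp_apply, sum_apply, smul_apply]
  rfl

/-- The restriction of a weighted b-metric to the interior. -/
noncomputable def intMetric : IntMetric X where
  inner := g.intInner
  symm _ _ _ := g.symm _ _ _
  pos y _ hv := g.pos _ _ fun h => hv ((identifyEquiv wt y).symm.map_eq_zero_iff.1 h)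
  isVonNBounded y := isVonNBounded_of_posDef (E := Fin m → ℝ) (g.intInner y) fun _ hv =>
    g.pos _ _ fun h => hv ((identifyEquiv wt y).symm.map_eq_zero_iff.1 h)
  contMDiff := g.contMDiff_intInner

lemma restrictsTo_intMetric : g.RestrictsTo g.intMetric := fun _ s t => g.intInner_identify s t

lemma RestrictsTo.eq_intMetric {g : WeightedBMetric wt} {h : IntMetric X} (hg : g.RestrictsTo h) :
    h = g.intMetric := by
  have hi : h.inner = g.intInner := by
    funext y
    ext v w
    obtain ⟨s, rfl⟩ := (identify_bijective (wt := wt) y).2 v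
    obtain ⟨t, rfl⟩ := (identify_bijective (wt := wt) y).2 w
    rw [hg, g.intInner_identify]
  cases h with
  | mk inner' symm' pos' bdd' smooth' =>
    change inner' = _ at hi
    subst hi
    rfl

end WeightedBMetric

end Interior

end ACorners

/-! ### The Levi-Civita b-connection in a weight chart -/

namespace ACorners

section Local

variable {m : ℕ} {X : Type*} [TopologicalSpace X] [AManifold m X] {wt : Weight X}
  (g : WeightedBMetric wt) (W : WeightChart wt)

namespace WeightedBMetric

/-- The Gram matrix of a weighted b-metric in the frame of a weight chart. -/
noncomputable def gram (i j : Fin m) : (Fin m → ℝ) → ℝ := (g.aSmooth W).choose i j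

lemma aSmoothOn_gram (i j : Fin m) : ASmoothOn W.chart.k W.chart.target (g.gram W i j) :=
  (g.aSmooth W).choose_spec.1 i j

lemma form_eq {u : Fin m → ℝ} (hu : u ∈ W.chart.target) (s t : EFibre wt (W.chart.point u)) :
    g.form _ s t = ∑ i, ∑ j, g.gram W i j u * W.comp _ s i * W.comp _ t j :=
  (g.aSmooth W).choose_spec.2 u hu s t

lemma gram_eq_form {u : Fin m → ℝ} (hu : u ∈ W.chart.target) (i j : Fin m) :
    g.gram W i j u = g.form _ ((W.compEquiv (W.chart.point_mem hu)).symm (Pi.single i 1))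
      ((W.compEquiv (W.chart.point_mem hu)).symm (Pi.single j 1)) := by
  rw [form_eq g W hu, ← W.compEquiv_apply (W.chart.point_mem hu),
    ← W.compEquiv_apply (W.chart.point_mem hu), LinearEquiv.apply_symm_apply,
    LinearEquiv.apply_symm_apply]
  simp [Pi.single_apply]

lemma gram_symm {u : Fin m → ℝ} (hu : u ∈ W.chart.target) (i j : Fin m) :
    g.gram W i j u = g.gram W j i u := by
  rw [gram_eq_form g W hu, gram_eq_form g W hu, g.symm]

/-- The Gram matrix. -/
noncomputable def gramMatrix (u : Fin m → ℝ) : Matrix (Fin m) (Fin m) ℝ :=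
  Matrix.of fun i j => g.gram W i j u

lemma det_gramMatrix_ne_zero {u : Fin m → ℝ} (hu : u ∈ W.chart.target) :
    (g.gramMatrix W u).det ≠ 0 := by
  intro h0
  obtain ⟨a, ha, hA⟩ := Matrix.exists_mulVec_eq_zero_iff.2 h0
  set s := (W.compEquiv (W.chart.point_mem hu)).symm a
  have hs : W.comp _ s = a := by
    rw [← W.compEquiv_apply (W.chart.point_mem hu), LinearEquiv.apply_symm_apply]
  have hpos := g.pos _ s fun h => ha (by rw [← hs, h, map_zero])
  rw [form_eq g W hu, hs] at hpos
  refine hpos.ne' ?_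
  refine Finset.sum_eq_zero fun i _ => ?_
  have hi := congrFun hA i
  simp only [Matrix.mulVec, dotProduct, gramMatrix, Matrix.of_apply, Pi.zero_apply] at hi
  calc ∑ j, g.gram W i j u * a i * a j = a i * ∑ j, g.gram W i j u * a j := by
        rw [Finset.mul_sum]; exact Finset.sum_congr rfl fun j _ => by ring
    _ = 0 := by rw [hi, mul_zero]

/-- The derivative of the metric along the `k`-th b-coordinate field, relative to the flat
b-connection of the weight. -/
noncomputable def gramDeriv (k i j : Fin m) (u : Fin m → ℝ) : ℝ :=
  bpartial W.chart.k k (g.gram W i j) u - 2 * W.exponent k * g.gram W i j u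

/-- The Christoffel symbols of the first kind. -/
noncomputable def christoffelFirst (k i j : Fin m) (u : Fin m → ℝ) : ℝ :=
  (1 / 2) * (g.gramDeriv W k i j u + g.gramDeriv W i k j u - g.gramDeriv W j k i u)

/-- The Christoffel symbols of the second kind. -/
noncomputable def christoffel (l k i : Fin m) (u : Fin m → ℝ) : ℝ :=
  ∑ j, (g.gramMatrix W u)⁻¹ l j * g.christoffelFirst W k i j u

lemma gramDeriv_symm {u : Fin m → ℝ} (hu : u ∈ W.chart.target) (k i j : Fin m) :
    g.gramDeriv W k i j u = g.gramDeriv W k j i u := by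
  have h : EqOn (g.gram W i j) (g.gram W j i) W.chart.target := fun v hv => gram_symm g W hv i j
  rw [gramDeriv, gramDeriv, bpartial_congr W.chart.open_target h k hu, h hu]

lemma christoffelFirst_symm {u : Fin m → ℝ} (hu : u ∈ W.chart.target) (k i j : Fin m) :
    g.christoffelFirst W k i j u = g.christoffelFirst W i k j u := by
  rw [christoffelFirst, christoffelFirst, gramDeriv_symm g W hu j k i]
  ring

lemma christoffelFirst_add {u : Fin m → ℝ} (hu : u ∈ W.chart.target) (k i j : Fin m) :
    g.christoffelFirst W k i j u + g.christoffelFirst W k j i u = g.gramDeriv W k i j u := by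
  rw [christoffelFirst, christoffelFirst, gramDeriv_symm g W hu k j i,
    gramDeriv_symm g W hu i k j, gramDeriv_symm g W hu j k i]
  ring

lemma christoffel_symm {u : Fin m → ℝ} (hu : u ∈ W.chart.target) (l k i : Fin m) :
    g.christoffel W l k i u = g.christoffel W l i k u := by
  rw [christoffel, christoffel]
  exact Finset.sum_congr rfl fun j _ => by rw [christoffelFirst_symm g W hu]

lemma sum_gram_mul_christoffel {u : Fin m → ℝ} (hu : u ∈ W.chart.target) (k i j : Fin m) :
    ∑ l, g.gram W l j u * g.christoffel W l k i u = g.christoffelFirst W k i j u := by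
  have h1 : g.gramMatrix W u * (g.gramMatrix W u)⁻¹ = 1 :=
    Matrix.mul_nonsing_inv _ (isUnit_iff_ne_zero.2 (det_gramMatrix_ne_zero g W hu))
  have h2 : ∀ r, ∑ l, g.gram W l j u * (g.gramMatrix W u)⁻¹ l r = if j = r then 1 else 0 := by
    intro r
    have := congrFun (congrFun h1 j) r
    rw [Matrix.mul_apply, Matrix.one_apply] at this
    rw [← this]
    exact Finset.sum_congr rfl fun l _ => by
      rw [gram_symm g W hu l j]; rfl
  simp only [christoffel, Finset.mul_sum, ← mul_assoc]
  rw [Finset.sum_comm]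
  simp only [← Finset.sum_mul, h2]
  simp

lemma aSmoothOn_christoffel (l k i : Fin m) :
    ASmoothOn W.chart.k W.chart.target (g.christoffel W l k i) := by
  have hU := W.chart.open_target
  have hD : ∀ k i j, ASmoothOn W.chart.k W.chart.target (g.gramDeriv W k i j) := fun k i j =>
    ((aSmoothOn_gram g W i j).bpartial k).sub hU ((aSmoothOn_gram g W i j).const_mul hU _)
  refine ASmoothOn.sum hU fun j _ => ?_
  exact (ASmoothOn.matrix_inv hU (aSmoothOn_gram g W)
    (fun u hu => det_gramMatrix_ne_zero g W hu) l j).mul hU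
    ((((hD k i j).add hU (hD i k j)).sub hU (hD j k i)).const_mul hU _)

/-- The components of the Levi-Civita b-connection applied to the section with components `σ` in
the frame of a weight chart. -/
noncomputable def connCoeff (σ : Fin m → (Fin m → ℝ) → ℝ) (k l : Fin m) (u : Fin m → ℝ) : ℝ :=
  bpartial W.chart.k k (σ l) u + W.exponent k * σ l u + ∑ i, g.christoffel W l k i u * σ i u

variable {W} {σ τ : Fin m → (Fin m → ℝ) → ℝ}

lemma aSmoothOn_connCoeff (hσ : ∀ i, ASmoothOn W.chart.k W.chart.target (σ i)) (k l : Fin m) :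
    ASmoothOn W.chart.k W.chart.target (g.connCoeff W σ k l) := by
  have hU := W.chart.open_target
  exact (((hσ l).bpartial k).add hU ((hσ l).const_mul hU _)).add hU
    (ASmoothOn.sum hU fun i _ => (aSmoothOn_christoffel g W l k i).mul hU (hσ i))

lemma connCoeff_add (hσ : ∀ i, ASmoothOn W.chart.k W.chart.target (σ i))
    (hτ : ∀ i, ASmoothOn W.chart.k W.chart.target (τ i)) {u : Fin m → ℝ} (hu : u ∈ W.chart.target)
    (k l : Fin m) : g.connCoeff W (fun i u => σ i u + τ i u) k l u =
      g.connCoeff W σ k l u + g.connCoeff W τ k l u := by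
  simp only [connCoeff, bpartial_add (hσ l).aDiffOn (hτ l).aDiffOn k hu, mul_add,
    Finset.sum_add_distrib]
  ring

lemma connCoeff_mul {f : (Fin m → ℝ) → ℝ} (hf : ASmoothOn W.chart.k W.chart.target f)
    (hσ : ∀ i, ASmoothOn W.chart.k W.chart.target (σ i)) {u : Fin m → ℝ} (hu : u ∈ W.chart.target)
    (k l : Fin m) : g.connCoeff W (fun i u => f u * σ i u) k l u =
      f u * g.connCoeff W σ k l u + bpartial W.chart.k k f u * σ l u := by
  have : ∀ i, g.christoffel W l k i u * (f u * σ i u) = f u * (g.christoffel W l k i u * σ i u) :=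
    fun i => by ring
  simp only [connCoeff, bpartial_mul hf.aDiffOn (hσ l).aDiffOn k hu, this, ← Finset.mul_sum]
  ring

/-- Compatibility of the connection with the metric, in a weight chart. -/
lemma bpartial_gram (hσ : ∀ i, ASmoothOn W.chart.k W.chart.target (σ i))
    (hτ : ∀ i, ASmoothOn W.chart.k W.chart.target (τ i)) {u : Fin m → ℝ} (hu : u ∈ W.chart.target)
    (k : Fin m) :
    bpartial W.chart.k k (fun u => ∑ i, ∑ j, g.gram W i j u * σ i u * τ j u) u =
      (∑ i, ∑ j, g.gram W i j u * g.connCoeff W σ k i u * τ j u) +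
        ∑ i, ∑ j, g.gram W i j u * σ i u * g.connCoeff W τ k j u := by
  have hU := W.chart.open_target
  have hG := aSmoothOn_gram g W
  have hterm : ∀ i j, ASmoothOn W.chart.k W.chart.target
      (fun u => g.gram W i j u * σ i u * τ j u) := fun i j => ((hG i j).mul hU (hσ i)).mul hU (hτ j)
  have hb : ∀ i j, bpartial W.chart.k k (fun u => g.gram W i j u * σ i u * τ j u) u =
      (g.gramDeriv W k i j u + 2 * W.exponent k * g.gram W i j u) * σ i u * τ j u +
      g.gram W i j u * bpartial W.chart.k k (σ i) u * τ j u +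
      g.gram W i j u * σ i u * bpartial W.chart.k k (τ j) u := fun i j => by
    rw [bpartial_mul ((hG i j).mul hU (hσ i)).aDiffOn (hτ j).aDiffOn k hu]
    beta_reduce
    rw [bpartial_mul (hG i j).aDiffOn (hσ i).aDiffOn k hu, gramDeriv]
    ring
  rw [bpartial_sum hU (fun i _ => ASmoothOn.sum hU fun j _ => hterm i j) k hu]
  have hs : ∀ i, bpartial W.chart.k k (fun u => ∑ j, g.gram W i j u * σ i u * τ j u) u =
      ∑ j, bpartial W.chart.k k (fun u => g.gram W i j u * σ i u * τ j u) u := fun i =>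
    bpartial_sum hU (fun j _ => hterm i j) k hu
  have hΓ1 : ∑ i, ∑ j, g.gram W i j u * (∑ r, g.christoffel W i k r u * σ r u) * τ j u =
      ∑ r, ∑ j, g.christoffelFirst W k r j u * σ r u * τ j u := by
    simp only [← sum_gram_mul_christoffel g W hu, Finset.mul_sum, Finset.sum_mul]
    calc _ = ∑ i, ∑ r, ∑ j, g.gram W i j u * (g.christoffel W i k r u * σ r u) * τ j u :=
          Finset.sum_congr rfl fun i _ => Finset.sum_comm
      _ = ∑ r, ∑ i, ∑ j, g.gram W i j u * (g.christoffel W i k r u * σ r u) * τ j u :=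
          Finset.sum_comm
      _ = ∑ r, ∑ j, ∑ i, g.gram W i j u * (g.christoffel W i k r u * σ r u) * τ j u :=
          Finset.sum_congr rfl fun r _ => Finset.sum_comm
      _ = _ := by simp only [mul_assoc]
  have hΓ2 : ∑ i, ∑ j, g.gram W i j u * σ i u * (∑ r, g.christoffel W j k r u * τ r u) =
      ∑ i, ∑ r, g.christoffelFirst W k r i u * σ i u * τ r u := by
    simp only [← sum_gram_mul_christoffel g W hu, Finset.mul_sum, Finset.sum_mul]
    refine Finset.sum_congr rfl fun i _ => ?_
    rw [Finset.sum_comm]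
    refine Finset.sum_congr rfl fun r _ => Finset.sum_congr rfl fun j _ => ?_
    rw [gram_symm g W hu i j]
    ring
  have e1 : ∑ i, ∑ j, g.gram W i j u * g.connCoeff W σ k i u * τ j u =
      (∑ i, ∑ j, (g.gram W i j u * bpartial W.chart.k k (σ i) u * τ j u +
        W.exponent k * g.gram W i j u * σ i u * τ j u)) +
      ∑ r, ∑ j, g.christoffelFirst W k r j u * σ r u * τ j u := by
    rw [← hΓ1, ← Finset.sum_add_distrib]
    refine Finset.sum_congr rfl fun i _ => ?_
    rw [← Finset.sum_add_distrib]
    exact Finset.sum_congr rfl fun j _ => by rw [connCoeff]; ring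
  have e2 : ∑ i, ∑ j, g.gram W i j u * σ i u * g.connCoeff W τ k j u =
      (∑ i, ∑ j, (g.gram W i j u * σ i u * bpartial W.chart.k k (τ j) u +
        W.exponent k * g.gram W i j u * σ i u * τ j u)) +
      ∑ i, ∑ r, g.christoffelFirst W k r i u * σ i u * τ r u := by
    rw [← hΓ2, ← Finset.sum_add_distrib]
    refine Finset.sum_congr rfl fun i _ => ?_
    rw [← Finset.sum_add_distrib]
    exact Finset.sum_congr rfl fun j _ => by rw [connCoeff]; ring
  rw [e1, e2]
  simp only [hs, ← Finset.sum_add_distrib]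
  refine Finset.sum_congr rfl fun i _ => Finset.sum_congr rfl fun j _ => ?_
  rw [hb, ← christoffelFirst_add g W hu k i j]
  ring

end WeightedBMetric

end Local

end ACorners

/-! ### The Levi-Civita connection on the interior, in weight charts -/

namespace ACorners

lemma bpartial_mul_of_differentiableAt {m : ℕ} {k : ℕ} {f h : (Fin m → ℝ) → ℝ} {u : Fin m → ℝ}
    (hf : DifferentiableAt ℝ f u) (hh : DifferentiableAt ℝ h u) (i : Fin m) :
    bpartial k i (fun v => f v * h v) u = bpartial k i f u * h u + f u * bpartial k i h u := by
  have h1 : HasFDerivAt (fun v => f v * h v) (f u • fderiv ℝ h u + h u • fderiv ℝ f u) u :=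
    hf.hasFDerivAt.mul hh.hasFDerivAt
  rw [bpartial_eq_fderiv h1.differentiableAt, bpartial_eq_fderiv hf, bpartial_eq_fderiv hh,
    h1.fderiv]
  simp only [add_apply, smul_apply, smul_eq_mul]
  ring

section Interior

open VectorField AChart LineTriv

variable {m : ℕ} {X : Type*} [TopologicalSpace X] [AManifold m X] {wt : Weight X}
  {y : aInterior X} {W : WeightChart wt}

namespace WeightedBMetric

variable (g : WeightedBMetric wt)

/-- The Levi-Civita connection of the restriction of a weighted b-metric to the interior. -/
noncomputable def intLeviCivita : IntConnection X :=
  letI : Bundle.RiemannianBundle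
    (fun x : aInterior X => TangentSpace 𝓘(ℝ, Fin m → ℝ) x) := ⟨g.intMetric.toRiemannianMetric⟩
  leviCivita 𝓘(ℝ, Fin m → ℝ) (aInterior X)

lemma isLeviCivita_intLeviCivita : ACorners.IsLeviCivita g.intMetric g.intLeviCivita := by
  let : Bundle.RiemannianBundle
    (fun x : aInterior X => TangentSpace 𝓘(ℝ, Fin m → ℝ) x) := ⟨g.intMetric.toRiemannianMetric⟩
  exact ⟨leviCivita_torsion, leviCivita_isMetricCompatible⟩

lemma eq_intLeviCivita {cov : IntConnection X} (hcov : ACorners.IsLeviCivita g.intMetric cov)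
    {V : Π y : aInterior X, IntTangent y} (hV : IntMDiffAt V y) :
    cov V y = g.intLeviCivita V y := by
  let : Bundle.RiemannianBundle
    (fun x : aInterior X => TangentSpace 𝓘(ℝ, Fin m → ℝ) x) := ⟨g.intMetric.toRiemannianMetric⟩
  exact eq_leviCivita hcov.1 hcov.2 hV

lemma intLeviCivita_sum_frame {F : Fin m → Π y : aInterior X, IntTangent y}
    (hF : ∀ i, IntMDiffAt (F i) y)
    (hbr : ∀ i j, mlieBracket 𝓘(ℝ, Fin m → ℝ) (F i) (F j) y = 0)
    (hspan : ∀ z : IntTangent y, ∃ a : Fin m → ℝ, z = ∑ j, a j • F j y)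
    {Γ : Fin m → Fin m → Fin m → ℝ}
    (hΓ : ∀ k i j, 2 * ∑ l, Γ l k i * g.intInner y (F l y) (F j y) =
      mvfderiv 𝓘(ℝ, Fin m → ℝ) (fun z => g.intInner z (F i z) (F j z)) y (F k y) +
        mvfderiv 𝓘(ℝ, Fin m → ℝ) (fun z => g.intInner z (F k z) (F j z)) y (F i y) -
        mvfderiv 𝓘(ℝ, Fin m → ℝ) (fun z => g.intInner z (F k z) (F i z)) y (F j y))
    {v : Fin m → aInterior X → ℝ}
    (hv : ∀ i, MDifferentiableAt 𝓘(ℝ, Fin m → ℝ) 𝓘(ℝ, ℝ) (v i) y) (k : Fin m) :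
    g.intLeviCivita (fun z => ∑ i, v i z • F i z) y (F k y) =
      ∑ l, (mvfderiv 𝓘(ℝ, Fin m → ℝ) (v l) y (F k y) + ∑ i, Γ l k i * v i y) • F l y := by
  let : Bundle.RiemannianBundle
    (fun x : aInterior X => TangentSpace 𝓘(ℝ, Fin m → ℝ) x) := ⟨g.intMetric.toRiemannianMetric⟩
  exact leviCivita_sum_frame hF hbr hspan hΓ hv k

lemma intInner_frameField (hy : (y : X) ∈ W.chart.source) (i j : Fin m) :
    g.intInner y (W.chart.frameField i y) (W.chart.frameField j y) =
      (frame (some W) (y : X))⁻¹ * (frame (some W) (y : X))⁻¹ *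
        g.gram W i j (W.chart.coord y) := by
  have hne := fun i => bScale_ne_zero (PosAt.of_mem W.mem_charts hy) i
  have hm : ∀ i l, (mfderiv 𝓘(ℝ, Fin m → ℝ) 𝓘(ℝ, Fin m → ℝ) W.chart.intCoord y
      (W.chart.frameField i y) : Fin m → ℝ) l =
      (Pi.single i (bScale W.chart.k i (W.chart.coord y)) : Fin m → ℝ) l := fun i l =>
    congrFun (mfderiv_frameField W.mem_charts hy i) l
  rw [intInner_eq_sum g (fun u hu => form_eq g W hu) hy]
  simp only [hm]
  rw [Finset.sum_eq_single i, Finset.sum_eq_single j]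
  · rw [Pi.single_eq_same, Pi.single_eq_same]
    have := hne i
    have := hne j
    field_simp
  · intro l _ hl
    rw [Pi.single_eq_of_ne hl, mul_zero, mul_zero]
  · simp
  · intro l _ hl
    refine Finset.sum_eq_zero fun r _ => ?_
    rw [Pi.single_eq_of_ne hl, zero_mul, mul_zero]
  · simp

end WeightedBMetric

lemma WeightChart.eventually_mem_source (hy : (y : X) ∈ W.chart.source) :
    ∀ᶠ z : aInterior X in 𝓝 y, (z : X) ∈ W.chart.source :=
  continuous_subtype_val.continuousAt.preimage_mem_nhds (W.chart.open_source.mem_nhds hy)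

lemma WeightChart.differentiableAt_of_aSmoothOn {f : (Fin m → ℝ) → ℝ}
    (hf : ASmoothOn W.chart.k W.chart.target f) (hy : (y : X) ∈ W.chart.source) :
    DifferentiableAt ℝ f (W.chart.coord y) :=
  (contDiffAt_of_aSmoothOn isOpen_univ (PosAt.of_mem W.mem_charts hy) (mem_univ _)
    (hf.mono inter_subset_left)).differentiableAt (by simp)

lemma WeightChart.differentiableAt_monomial (hy : (y : X) ∈ W.chart.source) :
    DifferentiableAt ℝ (fun u : Fin m → ℝ => ∏ l, u l ^ W.exponent l) (W.chart.coord y) :=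
  (contDiffAt_monomial (PosAt.of_mem W.mem_charts hy).2
    fun _ hi => W.exponent_eq_zero_of_le hi).differentiableAt (by simp)

lemma WeightChart.bpartial_monomial_exponent (hy : (y : X) ∈ W.chart.source) (k : Fin m) :
    bpartial W.chart.k k (fun u : Fin m → ℝ => ∏ l, u l ^ W.exponent l) (W.chart.coord y) =
      W.exponent k * frame (some W) (y : X) :=
  bpartial_monomial (PosAt.of_mem W.mem_charts hy).2 (fun _ hi => W.exponent_eq_zero_of_le hi) k

namespace WeightedBMetric

variable (g : WeightedBMetric wt)

lemma mvfderiv_intInner_frameField (hy : (y : X) ∈ W.chart.source) (k i j : Fin m) :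
    mvfderiv 𝓘(ℝ, Fin m → ℝ)
      (fun z => g.intInner z (W.chart.frameField i z) (W.chart.frameField j z)) y
      (W.chart.frameField k y) =
    (frame (some W) (y : X))⁻¹ * (frame (some W) (y : X))⁻¹ *
      g.gramDeriv W k i j (W.chart.coord y) := by
  set φ : (Fin m → ℝ) → ℝ := fun u => ∏ l, u l ^ W.exponent l
  have hφ0 : φ (W.chart.coord y) ≠ 0 := (frame_pos (P := some W) y.2 hy).ne'
  have hφ := W.differentiableAt_monomial hy
  have hφi : DifferentiableAt ℝ (fun u => (φ u)⁻¹) (W.chart.coord y) := hφ.inv hφ0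
  have hG := W.differentiableAt_of_aSmoothOn (aSmoothOn_gram g W i j) hy
  have hk : bpartial W.chart.k k (fun u => (φ u)⁻¹) (W.chart.coord y) =
      - W.exponent k * (φ (W.chart.coord y))⁻¹ := by
    have h1 : HasFDerivAt (fun u => (φ u)⁻¹)
        (-((φ (W.chart.coord y)) ^ 2)⁻¹ • fderiv ℝ φ (W.chart.coord y)) (W.chart.coord y) :=
      (hasDerivAt_inv hφ0).comp_hasFDerivAt _ hφ.hasFDerivAt
    have h2 := W.bpartial_monomial_exponent hy k
    rw [bpartial_eq_fderiv hφ] at h2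
    rw [bpartial_eq_fderiv hφi, h1.fderiv, smul_apply, smul_eq_mul, mul_left_comm, h2]
    change _ * (_ * φ (W.chart.coord y)) = _
    field_simp
  rw [mvfderiv_frameField W.mem_charts hy ((hφi.mul hφi).mul hG) (by
    filter_upwards [W.eventually_mem_source hy] with z hz using g.intInner_frameField hz i j)]
  change bpartial W.chart.k k (fun u => (fun v => (φ v)⁻¹ * (φ v)⁻¹) u * g.gram W i j u) _ = _
  have hφ2 : DifferentiableAt ℝ (fun v => (φ v)⁻¹ * (φ v)⁻¹) (W.chart.coord y) := hφi.mul hφi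
  rw [bpartial_mul_of_differentiableAt hφ2 hG,
    bpartial_mul_of_differentiableAt hφi hφi, hk, gramDeriv]
  change _ = (φ (W.chart.coord y))⁻¹ * (φ (W.chart.coord y))⁻¹ * _
  ring

end WeightedBMetric

variable {s : Π x : X, EFibre wt x}

lemma identify_eventuallyEq (s : Π x : X, EFibre wt x) (hy : (y : X) ∈ W.chart.source) :
    ∀ᶠ z : aInterior X in 𝓝 y, identify wt z (s z) =
      ∑ i, (frame (some W) (z : X) * W.comp z (s z) i) • W.chart.frameField i z := by
  filter_upwards [W.eventually_mem_source hy] with z hz using WeightChart.identify_eq_sum hz _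

lemma eventually_frame_mul_comp (s : Π x : X, EFibre wt x) (hy : (y : X) ∈ W.chart.source)
    (i : Fin m) : ∀ᶠ z : aInterior X in 𝓝 y, frame (some W) (z : X) * W.comp z (s z) i =
      (fun u => (∏ l, u l ^ W.exponent l) * W.comp _ (s (W.chart.point u)) i)
        (W.chart.coord z) := by
  filter_upwards [W.eventually_mem_source hy] with z hz
  rw [W.chart.point_coord hz]
  rfl

lemma mdifferentiableAt_frame_mul_comp (hs : s ∈ eSections wt) (hy : (y : X) ∈ W.chart.source)
    (i : Fin m) : MDifferentiableAt 𝓘(ℝ, Fin m → ℝ) 𝓘(ℝ, ℝ)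
      (fun z : aInterior X => frame (some W) (z : X) * W.comp z (s z) i) y :=
  mdifferentiableAt_of_point W.mem_charts hy
    ((W.differentiableAt_monomial hy).mul (W.differentiableAt_of_aSmoothOn (hs W i) hy))
    (eventually_frame_mul_comp s hy i)

lemma mdifferentiableAt_sum_frame (hs : s ∈ eSections wt) (hy : (y : X) ∈ W.chart.source) :
    IntMDiffAt (fun z : aInterior X =>
      ∑ i, (frame (some W) (z : X) * W.comp z (s z) i) • W.chart.frameField i z) y :=
  .sum_section fun i _ => (mdifferentiableAt_frame_mul_comp hs hy i).smul_section
    (mdifferentiableAt_frameField W.mem_charts hy i)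

lemma mdifferentiableAt_identify (hs : s ∈ eSections wt) (y : aInterior X) :
    IntMDiffAt (fun z : aInterior X => identify wt z (s z)) y := by
  obtain ⟨W, hy, -⟩ := WeightChart.exists_restr wt (interiorChartAt_mem y)
    (interiorChartAt_posAt y).1
  refine (mdifferentiableAt_sum_frame hs hy).congr_of_eventuallyEq ?_
  filter_upwards [identify_eventuallyEq s hy] with z hz
  rw [hz]

namespace WeightedBMetric

variable (g : WeightedBMetric wt)

/-- The components of a section in the frame of a weight chart. -/
noncomputable def _root_.ACorners.WeightChart.components (W : WeightChart wt)
    (s : Π x : X, EFibre wt x) (i : Fin m) (u : Fin m → ℝ) : ℝ :=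
  W.comp _ (s (W.chart.point u)) i

lemma intLeviCivita_frameField (hs : s ∈ eSections wt) (hy : (y : X) ∈ W.chart.source)
    (k : Fin m) :
    g.intLeviCivita (fun z : aInterior X => identify wt z (s z)) y (W.chart.frameField k y) =
      ∑ l, (frame (some W) (y : X) *
        g.connCoeff W (W.components s) k l (W.chart.coord y)) • W.chart.frameField l y := by
  have h1 := congrArg (· (W.chart.frameField k y))
    (g.intLeviCivita.isCovariantDerivativeOnUniv.congr_of_eventuallyEq
    (mdifferentiableAt_identify hs y) (mdifferentiableAt_sum_frame hs hy) univ_mem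
    (identify_eventuallyEq s hy))
  refine h1.trans ?_
  have h2 := g.intLeviCivita_sum_frame (F := W.chart.frameField)
    (Γ := fun l k i => g.christoffel W l k i (W.chart.coord y))
    (v := fun i z => frame (some W) (z : X) * W.comp z (s z) i)
    (mdifferentiableAt_frameField W.mem_charts hy) (mlieBracket_frameField W.mem_charts hy)
    (fun z => by
      obtain ⟨v, rfl⟩ := (toIntTangent_bijective y).2 z
      exact ⟨_, toIntTangent_eq_sum W.mem_charts hy v⟩)
    (fun k i j => by
      rw [mvfderiv_intInner_frameField g hy, mvfderiv_intInner_frameField g hy,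
        mvfderiv_intInner_frameField g hy]
      have h := g.sum_gram_mul_christoffel W (W.chart.coord_mem hy) k i j
      rw [christoffelFirst] at h
      rw [← mul_add, ← mul_sub]
      have h' : g.gramDeriv W k i j (W.chart.coord y) + g.gramDeriv W i k j (W.chart.coord y) -
        g.gramDeriv W j k i (W.chart.coord y) = 2 * ∑ l, g.gram W l j (W.chart.coord y) *
          g.christoffel W l k i (W.chart.coord y) := by rw [h]; ring
      rw [h', mul_left_comm, Finset.mul_sum (a := _ * _)]
      congr 1
      refine Finset.sum_congr rfl fun l _ => ?_
      rw [g.intInner_frameField hy]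
      ring)
    (mdifferentiableAt_frame_mul_comp hs hy) k
  refine h2.trans (Finset.sum_congr rfl fun l _ => ?_)
  congr 1
  rw [mvfderiv_frameField W.mem_charts hy
    ((W.differentiableAt_monomial hy).mul (W.differentiableAt_of_aSmoothOn (hs W l) hy))
    (eventually_frame_mul_comp s hy l)]
  have h3 := bpartial_mul_of_differentiableAt (k := W.chart.k) (W.differentiableAt_monomial hy)
    (W.differentiableAt_of_aSmoothOn (hs W l) hy) k
  refine (congrArg (· + _) h3).trans ?_
  rw [W.bpartial_monomial_exponent hy k]
  have h4 : ∀ i, W.components s i (W.chart.coord y) = W.comp y (s y) i := fun i => by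
    rw [WeightChart.components, W.chart.point_coord hy]
  simp only [connCoeff, h4, mul_add, Finset.mul_sum]
  have h5 : ∀ i, W.comp _ (s (W.chart.point (W.chart.coord y))) i = W.comp y (s y) i := h4
  rw [h5]
  change W.exponent k * frame (some W) (y : X) * _ + frame (some W) (y : X) *
    bpartial W.chart.k k (W.components s l) (W.chart.coord y) + _ = _
  have h6 : ∀ i, g.christoffel W l k i (W.chart.coord y) *
      (frame (some W) (y : X) * W.comp y (s y) i) = frame (some W) (y : X) *
        (g.christoffel W l k i (W.chart.coord y) * W.comp y (s y) i) := fun i => by ring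
  simp only [h6]
  ring

/-- On the interior, the Levi-Civita connection is given by `connCoeff` in every weight chart. -/
lemma intLeviCivita_toIntTangent (hs : s ∈ eSections wt) (hy : (y : X) ∈ W.chart.source)
    (w : BTangent (y : X)) {e : EFibre wt (y : X)}
    (he : ∀ l, W.comp y e l = ∑ k, g.connCoeff W (W.components s) k l (W.chart.coord y) *
      bComp (y : X) W.chart w k) :
    g.intLeviCivita (fun z : aInterior X => identify wt z (s z)) y (toIntTangent y w) =
      identify wt y e := by
  rw [toIntTangent_eq_sum W.mem_charts hy, map_sum, WeightChart.identify_eq_sum hy]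
  simp only [map_smul, g.intLeviCivita_frameField hs hy, he, Finset.smul_sum, Finset.mul_sum,
    Finset.sum_smul, smul_smul]
  rw [Finset.sum_comm]
  refine Finset.sum_congr rfl fun l _ => Finset.sum_congr rfl fun k _ => ?_
  congr 1
  ring

end WeightedBMetric

end Interior

end ACorners

/-! ### The Levi-Civita b-connection -/

namespace ACorners

section Connection

open AChart LineTriv

variable {m : ℕ} {X : Type*} [TopologicalSpace X] [AManifold m X] {wt : Weight X}
  {x : X} {s t : Π x : X, EFibre wt x}

lemma eq_of_eqOn_aInterior {f h : X → ℝ} (hf : ContinuousAt f x) (hh : ContinuousAt h x)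
    {O : Set X} (hO : O ∈ 𝓝 x) (H : ∀ y ∈ aInterior X, y ∈ O → f y = h y) : f x = h x := by
  refine tendsto_nhds_unique (hf.mono_left (nhdsWithin_le_nhds (s := aInterior X)))
    ((hh.mono_left nhdsWithin_le_nhds).congr' ?_)
  filter_upwards [self_mem_nhdsWithin, nhdsWithin_le_nhds hO] with y hy hyO using (H y hy hyO).symm

lemma IsASmoothHom.exists_components {A : Π x : X, BTangent x →ₗ[ℝ] EFibre wt x}
    (hA : IsASmoothHom A) (W : WeightChart wt) : ∃ a : Fin m → Fin m → (Fin m → ℝ) → ℝ,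
    (∀ i j, ASmoothOn W.chart.k W.chart.target (a i j)) ∧
    ∀ x ∈ W.chart.source, ∀ (w : BTangent x) (i : Fin m),
      W.comp x (A x w) i = ∑ j, a i j (W.chart.coord x) * bComp x W.chart w j := by
  obtain ⟨a, ha, h⟩ := hA W
  refine ⟨a, ha, fun x hx => ?_⟩
  have := h _ (W.chart.coord_mem hx)
  rwa [W.chart.point_coord hx] at this

namespace WeightChart

variable {W W' : WeightChart wt}

lemma continuousAt_comp_coord {f : (Fin m → ℝ) → ℝ} (hf : ASmoothOn W.chart.k W.chart.target f)
    (hx : x ∈ W.chart.source) : ContinuousAt (fun y => f (W.chart.coord y)) x :=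
  (hf.continuousOn.comp W.chart.continuousOn_coord fun _ => W.chart.coord_mem).continuousAt
    (W.chart.open_source.mem_nhds hx)

lemma components_coord (hx : x ∈ W.chart.source) (s : Π x : X, EFibre wt x) (i : Fin m) :
    W.components s i (W.chart.coord x) = W.comp x (s x) i := by
  rw [components, W.chart.point_coord hx]

lemma aSmoothOn_components (hs : s ∈ eSections wt) (i : Fin m) :
    ASmoothOn W.chart.k W.chart.target (W.components s i) := hs W i

lemma exists_comp_eq (hx : x ∈ W.chart.source) (a : Fin m → ℝ) :
    ∃ e : EFibre wt x, W.comp x e = a :=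
  ⟨(W.compEquiv hx).symm a, by rw [← W.compEquiv_apply hx, LinearEquiv.apply_symm_apply]⟩

variable (wt) in
/-- A weight chart at `x`, a restriction of `aChartAt x`. -/
noncomputable def _root_.ACorners.weightChartAt (x : X) : WeightChart wt :=
  (exists_restr wt (AManifold.exists_chart x).choose_spec.1
    (AManifold.exists_chart x).choose_spec.2).choose

variable (wt) in
lemma weightChartAt_spec (x : X) : x ∈ (weightChartAt wt x).chart.source ∧ (weightChartAt wt x).chart.source ⊆
    (aChartAt x).source ∧ (weightChartAt wt x).chart.k = (aChartAt x).k ∧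
    (weightChartAt wt x).chart.coord = (aChartAt x).coord ∧ (weightChartAt wt x).chart.point = (aChartAt x).point :=
  (exists_restr wt (AManifold.exists_chart x).choose_spec.1
    (AManifold.exists_chart x).choose_spec.2).choose_spec

variable (wt) in
lemma mem_source_weightChartAt (x : X) : x ∈ (weightChartAt wt x).chart.source := (weightChartAt_spec wt x).1

lemma bd_eq_sum (f : X → ℝ) (x : X) (w : BTangent x) :
    bd f x w = ∑ i, bpartial (weightChartAt wt x).chart.k i (fun u => f ((weightChartAt wt x).chart.point u))
      ((weightChartAt wt x).chart.coord x) * bComp x (weightChartAt wt x).chart w i := by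
  obtain ⟨hx, -, hk, hcoord, hpoint⟩ := weightChartAt_spec wt x
  rw [bd, AChart.bDeriv_apply, bComp_eq_of_coord_eq (AManifold.exists_chart x).choose_spec.1
    (weightChartAt wt x).mem_charts (AManifold.exists_chart x).choose_spec.2 hx hk hcoord w, hk, hcoord,
    hpoint]
  rfl

end WeightChart

namespace WeightedBMetric

variable (g : WeightedBMetric wt) {W W' : WeightChart wt}

/-- The components in different weight charts define the same connection. -/
lemma sum_connCoeff_mul_bTransition (hs : s ∈ eSections wt) (hx : x ∈ W.chart.source)
    (hx' : x ∈ W'.chart.source) (l r : Fin m) :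
    ∑ k, g.connCoeff W' (W'.components s) k l (W'.chart.coord x) *
        W.chart.bTransition W'.chart x k r =
      lineTransition (some W) (some W') x * ∑ i, W.chart.bTransition W'.chart x l i *
        g.connCoeff W (W.components s) r i (W.chart.coord x) := by
  have hO : W.chart.source ∩ W'.chart.source ∈ 𝓝 x :=
    inter_mem (W.chart.open_source.mem_nhds hx) (W'.chart.open_source.mem_nhds hx')
  have hT : ∀ i j, ContinuousAt (fun y => W.chart.bTransition W'.chart y i j) x := fun i j =>
    (continuousOn_bTransition W.mem_charts W'.mem_charts i j).continuousAt hO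
  refine eq_of_eqOn_aInterior
    (f := fun x => ∑ k, g.connCoeff W' (W'.components s) k l (W'.chart.coord x) *
        W.chart.bTransition W'.chart x k r)
    (h := fun x => lineTransition (some W) (some W') x *
      ∑ i, W.chart.bTransition W'.chart x l i *
        g.connCoeff W (W.components s) r i (W.chart.coord x)) ?_ ?_ hO ?_
  · exact tendsto_finsetSum _ fun k _ =>
      (W'.continuousAt_comp_coord (g.aSmoothOn_connCoeff (hs W') k l) hx').mul (hT k r)
  · exact ((continuousOn_lineTransition (some W) (some W')).continuousAt hO).mul
      (tendsto_finsetSum _ fun i _ => (hT l i).mul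
        (W.continuousAt_comp_coord (g.aSmoothOn_connCoeff (hs W) r i) hx))
  · intro y hyi hy
    obtain ⟨w, hw⟩ := bComp_surjective W.mem_charts hy.1 (Pi.single r 1)
    have hw' : ∀ k, bComp y W'.chart w k = W.chart.bTransition W'.chart y k r := fun k => by
      rw [bComp_eq_sum W.mem_charts W'.mem_charts hy.1 hy.2, hw]
      simp [Pi.single_apply]
    obtain ⟨e, he⟩ := W.exists_comp_eq hy.1 fun l =>
      ∑ k, g.connCoeff W (W.components s) k l (W.chart.coord y) * bComp y W.chart w k
    obtain ⟨e', he'⟩ := W'.exists_comp_eq hy.2 fun l =>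
      ∑ k, g.connCoeff W' (W'.components s) k l (W'.chart.coord y) * bComp y W'.chart w k
    have h1 := g.intLeviCivita_toIntTangent (y := ⟨y, hyi⟩) hs hy.1 w (congrFun he)
    have h2 := g.intLeviCivita_toIntTangent (y := ⟨y, hyi⟩) hs hy.2 w (congrFun he')
    have hee : e' = e := (identify_bijective (wt := wt) ⟨y, hyi⟩).1 (h2.symm.trans h1)
    have h3 := W.comp_eq_sum hy.1 hy.2 e l
    rw [← hee, he', hee, he] at h3
    simpa [hw', hw, Pi.single_apply] using h3

/-- The Levi-Civita b-connection. -/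
noncomputable def nabla (s : Π x : X, EFibre wt x) (x : X) : BTangent x →ₗ[ℝ] EFibre wt x :=
  ((weightChartAt wt x).compEquiv (WeightChart.mem_source_weightChartAt wt x)).symm.toLinearMap ∘ₗ
    LinearMap.pi fun l => ∑ k, g.connCoeff (weightChartAt wt x)
      ((weightChartAt wt x).components s) k l ((weightChartAt wt x).chart.coord x) •
        (LinearMap.proj k).comp (bComp x (weightChartAt wt x).chart)

lemma comp_weightChartAt_nabla (s : Π x : X, EFibre wt x) (x : X) (w : BTangent x) (l : Fin m) :
    (weightChartAt wt x).comp x (g.nabla s x w) l = ∑ k, g.connCoeff (weightChartAt wt x)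
      ((weightChartAt wt x).components s) k l ((weightChartAt wt x).chart.coord x) *
        bComp x (weightChartAt wt x).chart w k := by
  rw [← WeightChart.compEquiv_apply _ (WeightChart.mem_source_weightChartAt wt x), nabla,
    LinearMap.comp_apply, LinearEquiv.coe_coe, LinearEquiv.apply_symm_apply]
  simp

lemma comp_nabla (hs : s ∈ eSections wt) (hx : x ∈ W.chart.source) (w : BTangent x) (l : Fin m) :
    W.comp x (g.nabla s x w) l =
      ∑ k, g.connCoeff W (W.components s) k l (W.chart.coord x) * bComp x W.chart w k := by
  set V := weightChartAt wt x
  have hV : x ∈ V.chart.source := WeightChart.mem_source_weightChartAt wt x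
  have hL : ∀ i, V.comp x (g.nabla s x w) i = _ := g.comp_weightChartAt_nabla s x w
  rw [V.comp_eq_sum hV hx]
  calc lineTransition (some V) (some W) x * ∑ i, V.chart.bTransition W.chart x l i *
        V.comp x (g.nabla s x w) i
      = ∑ r, (lineTransition (some V) (some W) x * ∑ i, V.chart.bTransition W.chart x l i *
        g.connCoeff V (V.components s) r i (V.chart.coord x)) * bComp x V.chart w r := by
        simp only [hL, Finset.mul_sum, Finset.sum_mul]
        rw [Finset.sum_comm]
        simp only [mul_assoc]
        rfl
    _ = ∑ r, (∑ k, g.connCoeff W (W.components s) k l (W.chart.coord x) *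
        V.chart.bTransition W.chart x k r) * bComp x V.chart w r := by
        simp only [g.sum_connCoeff_mul_bTransition hs hV hx]
    _ = _ := by
        simp only [bComp_eq_sum V.mem_charts W.mem_charts hV hx, Finset.mul_sum, Finset.sum_mul]
        rw [Finset.sum_comm]
        simp only [mul_assoc]

lemma isASmoothHom_nabla (hs : s ∈ eSections wt) : IsASmoothHom (g.nabla s) := fun W =>
  ⟨fun l k => g.connCoeff W (W.components s) k l, fun l k => g.aSmoothOn_connCoeff (hs W) k l,
    fun u hu w l => by rw [g.comp_nabla hs (W.chart.point_mem hu), W.chart.coord_point hu]⟩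

lemma nabla_eq_of_comp_weightChartAt {e : EFibre wt x} {w : BTangent x}
    (h : ∀ l, ∑ k, g.connCoeff (weightChartAt wt x) ((weightChartAt wt x).components s) k l
      ((weightChartAt wt x).chart.coord x) * bComp x (weightChartAt wt x).chart w k =
        (weightChartAt wt x).comp x e l) : g.nabla s x w = e := by
  refine (weightChartAt wt x).comp_injective (WeightChart.mem_source_weightChartAt wt x) ?_
  funext l
  rw [comp_weightChartAt_nabla, h]

lemma nabla_add (hs : s ∈ eSections wt) (ht : t ∈ eSections wt) :
    g.nabla (s + t) = g.nabla s + g.nabla t := by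
  funext x
  ext1 w
  refine g.nabla_eq_of_comp_weightChartAt fun l => ?_
  set W := weightChartAt wt x with hW
  have hx : x ∈ W.chart.source := WeightChart.mem_source_weightChartAt wt x
  have h : W.components (s + t) = fun i u => W.components s i u + W.components t i u := by
    funext i u
    simp [WeightChart.components]
  have h1 := fun k => connCoeff_add g (W.aSmoothOn_components hs) (W.aSmoothOn_components ht)
    (W.chart.coord_mem hx) k l
  have hs' : ∀ l, W.comp x (g.nabla s x w) l = _ := g.comp_weightChartAt_nabla s x w
  have ht' : ∀ l, W.comp x (g.nabla t x w) l = _ := g.comp_weightChartAt_nabla t x w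
  rw [Pi.add_apply, LinearMap.add_apply, map_add, Pi.add_apply, hs', ht', ← hW, h]
  simp only [h1, add_mul, Finset.sum_add_distrib]

lemma nabla_mul {f : X → ℝ} (hf : IsASmooth f) (hs : s ∈ eSections wt) (w : BTangent x) :
    g.nabla (fun y => f y • s y) x w = f x • g.nabla s x w + bd f x w • s x := by
  refine g.nabla_eq_of_comp_weightChartAt fun l => ?_
  set W := weightChartAt wt x with hW
  have hx : x ∈ W.chart.source := WeightChart.mem_source_weightChartAt wt x
  have h : W.components (fun y => f y • s y) =
      fun i u => f (W.chart.point u) * W.components s i u := by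
    funext i u
    simp [WeightChart.components]
  have h1 := fun k => connCoeff_mul g (hf _ W.mem_charts) (W.aSmoothOn_components hs)
    (W.chart.coord_mem hx) k l
  have hs' : ∀ l, W.comp x (g.nabla s x w) l = _ := g.comp_weightChartAt_nabla s x w
  rw [map_add, map_smul, map_smul, Pi.add_apply, Pi.smul_apply, Pi.smul_apply, hs',
    WeightChart.bd_eq_sum (wt := wt) f, ← hW, h]
  simp only [h1, WeightChart.components_coord hx, W.chart.point_coord hx, smul_eq_mul, add_mul,
    Finset.sum_add_distrib, Finset.mul_sum, Finset.sum_mul]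
  congr 1
  · exact Finset.sum_congr rfl fun k _ => by ring
  · exact Finset.sum_congr rfl fun k _ => by ring

lemma isASmooth_const (r : ℝ) : IsASmooth (fun _ : X => r) := fun c _ =>
  aSmoothOn_const c.open_target r

lemma bd_const (r : ℝ) (w : BTangent x) : bd (fun _ : X => r) x w = 0 := by
  simp [bd, AChart.bDeriv_apply, bpartial_const]

/-- The Levi-Civita b-connection of a weighted b-metric. -/
noncomputable def bLeviCivita : BConnection wt where
  toLinearMap :=
    { toFun := fun s => g.nabla s.1
      map_add' := fun s t => g.nabla_add s.2 t.2
      map_smul' := fun r s => by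
        funext x
        ext1 w
        have h := g.nabla_mul (isASmooth_const r) s.2 w
        rw [bd_const, zero_smul, add_zero] at h
        exact h }
  isASmoothHom s := g.isASmoothHom_nabla s.2
  leibniz _ hf s _ w := g.nabla_mul hf s.2 w

lemma identify_nabla (hs : s ∈ eSections wt) (y : aInterior X) (w : BTangent (y : X)) :
    identify wt y (g.nabla s y w) =
      g.intLeviCivita (fun z : aInterior X => identify wt z (s z)) y (toIntTangent y w) :=
  (g.intLeviCivita_toIntTangent hs (WeightChart.mem_source_weightChartAt wt (y : X)) w
    (g.comp_weightChartAt_nabla s y w)).symm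

lemma isLeviCivita_bLeviCivita : g.bLeviCivita.IsLeviCivita g :=
  ⟨g.intMetric, g.intLeviCivita, g.restrictsTo_intMetric, g.isLeviCivita_intLeviCivita,
    fun s y w => g.identify_nabla s.2 y w⟩

lemma eq_bLeviCivita {D : BConnection wt} (hD : D.IsLeviCivita g) : D = g.bLeviCivita := by
  obtain ⟨h, cov, hg, hcov, hR⟩ := hD
  obtain rfl := hg.eq_intMetric
  have hint : ∀ (s : eSections wt) (y : aInterior X) (w : BTangent (y : X)),
      D.toLinearMap s y w = g.nabla s.1 y w := fun s y w => by
    refine (identify_bijective (wt := wt) y).1 ?_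
    rw [g.identify_nabla s.2, hR s y w,
      g.eq_intLeviCivita hcov (mdifferentiableAt_identify s.2 y)]
  have hmap : D.toLinearMap = g.bLeviCivita.toLinearMap := by
    ext1 s
    funext x
    ext1 w
    set W := weightChartAt wt x
    have hx : x ∈ W.chart.source := WeightChart.mem_source_weightChartAt wt x
    obtain ⟨a, ha, hDa⟩ := (D.isASmoothHom s).exists_components W
    refine W.comp_injective hx ?_
    funext l
    change _ = W.comp x (g.nabla s.1 x w) l
    rw [hDa x hx, g.comp_nabla s.2 hx]
    refine Finset.sum_congr rfl fun k _ => ?_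
    congr 1
    refine eq_of_eqOn_aInterior (f := fun y => a l k (W.chart.coord y))
      (h := fun y => g.connCoeff W (W.components s.1) k l (W.chart.coord y)) (W.continuousAt_comp_coord (ha l k) hx)
      (W.continuousAt_comp_coord (g.aSmoothOn_connCoeff (s.2 W) k l) hx)
      (W.chart.open_source.mem_nhds hx) fun y hyi hy => ?_
    obtain ⟨v, hv⟩ := bComp_surjective W.mem_charts hy (Pi.single k 1)
    have h1 := congrFun (congrArg (W.comp y) (hint s ⟨y, hyi⟩ v)) l
    rw [hDa y hy, g.comp_nabla s.2 hy, hv] at h1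
    simpa [Pi.single_apply] using h1
  cases D
  cases h' : g.bLeviCivita
  rw [h'] at hmap
  congr

lemma torsionFree_bLeviCivita : g.bLeviCivita.TorsionFree := by
  intro u v l W x hx i
  have hxt := W.chart.coord_mem hx
  have hcomp : ∀ v : bVectorFields X, W.components (fun y => v.1 y ⊗ₜ[ℝ] l.1 y) = fun i u =>
      lComp wt _ (some W) (l.1 (W.chart.point u)) * bComp _ W.chart (v.1 (W.chart.point u)) i := by
    intro v
    funext i u
    simp [WeightChart.components, WeightChart.comp_tmul]
  have hl : lComp wt _ (some W) (l.1 (W.chart.point (W.chart.coord x))) =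
      lComp wt x (some W) (l.1 x) := by rw [W.chart.point_coord hx]
  have key : ∀ u v : bVectorFields X,
      W.comp x (g.bLeviCivita.toLinearMap ⟨_, tmul_mem_eSections v.2 l.2⟩ x (u.1 x)) i
        - W.flatDeriv l.1 x (u.1 x) * bComp x W.chart (v.1 x) i =
      lComp wt x (some W) (l.1 x) *
        (W.chart.bDeriv (fun y => bComp y W.chart (v.1 y) i) x (u.1 x) +
        ∑ k, ∑ j, g.christoffel W i k j (W.chart.coord x) * bComp x W.chart (v.1 x) j *
          bComp x W.chart (u.1 x) k) := by
    intro u v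
    have h1 : W.comp x (g.bLeviCivita.toLinearMap ⟨_, tmul_mem_eSections v.2 l.2⟩ x (u.1 x)) i =
        _ := g.comp_nabla (tmul_mem_eSections v.2 l.2) hx (u.1 x) i
    rw [h1, hcomp v]
    have hv : ∀ j, bComp _ W.chart (v.1 (W.chart.point (W.chart.coord x))) j =
        bComp x W.chart (v.1 x) j := fun j => by rw [W.chart.point_coord hx]
    have h2 := fun k => connCoeff_mul g (l.2 W) (v.2 W.chart W.mem_charts) hxt k i
    simp only [h2, hl, hv]
    simp only [connCoeff, WeightChart.flatDeriv, hv, LinearMap.add_apply, LinearMap.smul_apply,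
      LinearMap.sum_apply, LinearMap.comp_apply, LinearMap.proj_apply, AChart.bDeriv_apply,
      smul_eq_mul]
    rw [add_mul, Finset.sum_mul, Finset.mul_sum, Finset.sum_mul, ← Finset.sum_add_distrib,
      ← Finset.sum_sub_distrib, ← Finset.sum_add_distrib, Finset.mul_sum]
    refine Finset.sum_congr rfl fun k _ => ?_
    rw [← Finset.sum_mul]
    ring
  rw [key u v, key v u, AChart.bBracket, Finset.sum_comm]
  have hsymm : ∑ j, ∑ k, g.christoffel W i k j (W.chart.coord x) *
      bComp x W.chart (v.1 x) j * bComp x W.chart (u.1 x) k = ∑ k, ∑ j,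
      g.christoffel W i k j (W.chart.coord x) * bComp x W.chart (u.1 x) j *
        bComp x W.chart (v.1 x) k :=
    Finset.sum_congr rfl fun k _ => Finset.sum_congr rfl fun j _ => by
      rw [christoffel_symm g W hxt]; ring
  rw [hsymm]
  ring

lemma parallel_bLeviCivita : g.bLeviCivita.Parallel g := by
  intro s t x w
  set W := weightChartAt wt x with hW
  have hx : x ∈ W.chart.source := WeightChart.mem_source_weightChartAt wt x
  have hxt := W.chart.coord_mem hx
  have hform : ∀ e f : EFibre wt x, g.form x e f = ∑ i, ∑ j,
      g.gram W i j (W.chart.coord x) * W.comp x e i * W.comp x f j := by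
    have h := form_eq g W hxt
    rwa [W.chart.point_coord hx] at h
  have hcongr : EqOn (fun u => g.form _ (s.1 (W.chart.point u)) (t.1 (W.chart.point u)))
      (fun u => ∑ i, ∑ j, g.gram W i j u * W.components s.1 i u * W.components t.1 j u)
      W.chart.target := fun u hu => form_eq g W hu _ _
  have h1 : ∀ l, W.comp x (g.bLeviCivita.toLinearMap s x w) l = _ :=
    g.comp_nabla s.2 hx w
  have h2 : ∀ l, W.comp x (g.bLeviCivita.toLinearMap t x w) l = _ :=
    g.comp_nabla t.2 hx w
  rw [WeightChart.bd_eq_sum (wt := wt), ← hW, hform, hform]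
  simp only [h1, h2]
  have h3 : ∀ k, bpartial W.chart.k k
      (fun u => g.form _ (s.1 (W.chart.point u)) (t.1 (W.chart.point u))) (W.chart.coord x) =
      (∑ i, ∑ j, g.gram W i j (W.chart.coord x) *
        g.connCoeff W (W.components s.1) k i (W.chart.coord x) * W.comp x (t.1 x) j) +
        ∑ i, ∑ j, g.gram W i j (W.chart.coord x) * W.comp x (s.1 x) i *
          g.connCoeff W (W.components t.1) k j (W.chart.coord x) := fun k => by
    rw [bpartial_congr W.chart.open_target hcongr k hxt, bpartial_gram g
      (W.aSmoothOn_components s.2) (W.aSmoothOn_components t.2) hxt k]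
    simp only [WeightChart.components_coord hx]
  simp only [h3, add_mul, Finset.sum_add_distrib, Finset.sum_mul, Finset.mul_sum]
  congr 1
  · rw [Finset.sum_comm]
    refine Finset.sum_congr rfl fun i _ => ?_
    rw [Finset.sum_comm]
    exact Finset.sum_congr rfl fun j _ => Finset.sum_congr rfl fun k _ => by ring
  · rw [Finset.sum_comm]
    refine Finset.sum_congr rfl fun i _ => ?_
    rw [Finset.sum_comm]
    exact Finset.sum_congr rfl fun j _ => Finset.sum_congr rfl fun k _ => by ring

end WeightedBMetric

end Connection

end ACorners

theorem proposition5p1 {m : ℕ} {X : Type*} [TopologicalSpace X] [AManifold m X]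
    (wt : Weight X) (g : WeightedBMetric wt) :
    ∃ D : BConnection wt, D.IsLeviCivita g ∧
      (∀ D' : BConnection wt, D'.IsLeviCivita g → D' = D) ∧
      D.TorsionFree ∧ D.Parallel g :=
  ⟨g.bLeviCivita, g.isLeviCivita_bLeviCivita, fun _ => g.eq_bLeviCivita,
    g.torsionFree_bLeviCivita, g.parallel_bLeviCivita⟩
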